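/- Let $\alpha>\beta>0$. Let $\omega=(\omega_x)_{x\in\mathbb Z}$ be i.i.d. random variables with law $\mathrm{Beta}(\alpha,\beta)$ on $(0,1)$, and let $\mathbb P,\mathbb E$ denote their joint law and its expectation. Given $\omega$, let $P_{0,\omega}$ be the law of the Markov chain $(X_n)_{n\ge 0}$ on $\mathbb Z$ with $X_0=0$ that jumps from $x$ to $x+1$ with probability $\omega_x$ and to $x-1$ with probability $1-\omega_x$. Let $H_k=\inf\{n\ge 0: X_n=k\}$ for $k\in\mathbb N$, let $\varphi(\omega,\lambda)=E_{0,\omega}[\lambda^{H_1}]$ (with $\lambda^\infty=0$), and let $Z(\omega)=\frac1\lambda\varphi(\omega,\lambda)$. For $z<1$ let $h^{(1)}(\alpha,\beta;z)$ be the law on $(0,1)$ with density $$h_z(u)=\frac{\Gamma(\alpha+\beta)}{\Gamma(\alpha)\Gamma(\beta)}\,\frac{1}{F(\alpha,\alpha;\alpha+\beta;z)}\,u^{\alpha-1}(1-u)^{\beta-1}(1-uz)^{-\alpha},\qquad 0<u<1,$$ where $F(a,b;c;z)=\frac{\Gamma(c)}{\Gamma(b)\Gamma(c-b)}\int_0^1u^{b-1}(1-u)^{c-b-1}(1-uz)^{-a}\,du$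 is the classical hypergeometric function ${}_2F_1$. **Theorem.** (i) For $0<\lambda<1$, the random variable $Z$ has law $h^{(1)}(\alpha,\beta;\lambda^2)$ under $\mathbb P$. This extends to the endpoints of $[0,1]$ in the limiting sense: for every environment $\omega\in(0,1)^{\mathbb Z}$, $\varphi(\omega,\lambda)/\lambda$ converges as $\lambda\downarrow0$, and the limit has law $h^{(1)}(\alpha,\beta;0)$; for $\lambda=1$, $Z$ has law $\delta_1$, which is the weak limit of $h^{(1)}(\alpha,\beta;z)$ as $z\uparrow1$. (ii) For $0<\lambda<1$, $\log\varphi(\cdot,\lambda)$ is integrable and $$\mathbb E[\log\varphi(\omega,\lambda)]=\log\lambda+\int_0^1\log u\;h_{\lambda^2}(u)\,du ,$$ where the last integral converges absolutely. (iii) For $\mathbb P$-almost every $\omega$, all $H_k$ are $P_{0,\omega}$-almost surely finite, and the laws of $\frac1kH_k$ under $P_{0,\omega}$ satisfy the large deviation principle on $\mathbb R$ at speed $k$, with the rate function $$I(x)=\sup_{0<\lambda\le1}\big(x\log\lambda-\mathbb E[\log\varphi(\omega,\lambda)]\big)=\sup_{0<\lambda<1}\Big(x\log\lambda-\log\lambda-\int_0^1\log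 u\;h_{\lambda^2}(u)\,du\Big),\qquad x\in\mathbb R,$$ that is: $I:\mathbb R\to[0,\infty]$ is lower semicontinuous, $\limsup_k\frac1k\log P_{0,\omega}(\frac1kH_k\in C)\le-\inf_CI$ for every closed $C\subset\mathbb R$, and $\liminf_k\frac1k\log P_{0,\omega}(\frac1kH_k\in G)\ge-\inf_GI$ for every open $G\subset\mathbb R$. -/

import Mathlib

open MeasureTheory ProbabilityTheory Filter Topology

noncomputable section

namespace BetaWalk

/-- An environment on `ℤ`: `ω x` is the probability of the jump `x → x + 1`, and `1 - ω x` is the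
probability of the jump `x → x - 1`. -/
abbrev Env : Type := ℤ → Set.Ioo (0 : ℝ) 1

/-- The Beta(α, β) law, seen as a measure on the open interval `(0, 1)`. -/
def siteLaw (α β : ℝ) : Measure (Set.Ioo (0 : ℝ) 1) :=
  (betaMeasure α β).comap Subtype.val

theorem isProbabilityMeasure_siteLaw {α β : ℝ} (hα : 0 < α) (hβ : 0 < β) :
    IsProbabilityMeasure (siteLaw α β) := by
  have := isProbabilityMeasureBeta hα hβ
  refine ⟨?_⟩
  rw [siteLaw, (MeasurableEmbedding.subtype_coe measurableSet_Ioo).comap_apply, Set.image_univ,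
    Subtype.range_coe, prob_compl_eq_zero_iff measurableSet_Ioo |>.symm, betaMeasure,
    withDensity_apply _ measurableSet_Ioo.compl]
  refine setLIntegral_eq_zero measurableSet_Ioo.compl fun x hx => ?_
  rw [betaPDF_eq, if_neg (by simpa using hx)]
  simp

/-- The law of the i.i.d. Beta(α, β) environment. -/
def envLaw (α β : ℝ) (hα : 0 < α) (hβ : 0 < β) : Measure Env :=
  haveI := isProbabilityMeasure_siteLaw hα hβ
  Measure.infinitePi (fun _ : ℤ => siteLaw α β)

/-- The transition kernel of the walk in the environment `ω`. -/
def stepKernel (ω : Env) : Kernel ℤ ℤ where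
  toFun x := ENNReal.ofReal (ω x) • Measure.dirac (x + 1)
    + ENNReal.ofReal (1 - ω x) • Measure.dirac (x - 1)
  measurable' := measurable_of_countable _

instance (ω : Env) : IsMarkovKernel (stepKernel ω) where
  isProbabilityMeasure x := ⟨by
    change (ENNReal.ofReal (ω x : ℝ) • Measure.dirac (x + 1)
      + ENNReal.ofReal (1 - (ω x : ℝ)) • Measure.dirac (x - 1) : Measure ℤ) Set.univ = 1
    simp only [Measure.add_apply, Measure.smul_apply, measure_univ, smul_eq_mul, mul_one]
    rw [← ENNReal.ofReal_add (ω x).2.1.le (sub_nonneg.2 (ω x).2.2.le)]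
    simp⟩

/-- The same kernel, as a function of the whole past up to time `n`: it only reads the present. -/
def pastKernel (ω : Env) (n : ℕ) : Kernel (Finset.Iic n → ℤ) ℤ :=
  (stepKernel ω).comap (fun h => h ⟨n, Finset.mem_Iic.2 le_rfl⟩) (measurable_pi_apply _)

instance (ω : Env) (n : ℕ) : IsMarkovKernel (pastKernel ω n) := by
  unfold pastKernel
  infer_instance

/-- The quenched law: the law on trajectories of the Markov chain started at `x₀` in the
environment `ω`. -/
def quenched (x₀ : ℤ) (ω : Env) : Measure (ℕ → ℤ) :=
  Kernel.traj (X := fun _ => ℤ) (pastKernel ω) 0 (fun _ => x₀)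

/-- The hitting time `H_k = inf {n ≥ 0 : X_n = k}` (it is `⊤` if `k` is never reached). -/
def hit (k : ℕ) : (ℕ → ℤ) → ℕ∞ :=
  hittingAfter (fun n (X : ℕ → ℤ) => X n) {(k : ℤ)} 0

/-- `φ(ω, l) = E_{0,ω}[l ^ H_1]`, with `l ^ ∞ = 0`. -/
def phi (ω : Env) (l : ℝ) : ℝ :=
  ∫ X, (if hit 1 X = ⊤ then 0 else l ^ (hit 1 X).toNat) ∂(quenched 0 ω)

/-- `Z(ω) = φ(ω, l) / l`. -/
def Z (l : ℝ) (ω : Env) : ℝ := 1 / l * phi ω l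

/-- The quenched law of `H_k / k`. -/
def hitLaw (ω : Env) (k : ℕ) : Measure ℝ :=
  (quenched 0 ω).map (fun X => ((hit k X).toNat : ℝ) / k)

/-- The hypergeometric function `₂F₁(a, b; c; z)` for `0 < b < c` and `z < 1`. -/
def hypF (a b c z : ℝ) : ℝ :=
  Real.Gamma c / (Real.Gamma b * Real.Gamma (c - b)) *
    ∫ u in (0 : ℝ)..1, u ^ (b - 1) * (1 - u) ^ (c - b - 1) * (1 - u * z) ^ (-a)

/-- The density of the hypergeometric law `h⁽¹⁾(α, β; z)`, `z < 1`, on the interval `(0, 1)`. -/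
def hypDensity (α β z u : ℝ) : ℝ :=
  Real.Gamma (α + β) / (Real.Gamma α * Real.Gamma β) * (1 / hypF α α (α + β) z) *
    (u ^ (α - 1) * (1 - u) ^ (β - 1) * (1 - u * z) ^ (-α))

/-- The hypergeometric law `h⁽¹⁾(α, β; z)`, `z < 1`. -/
def hypLaw (α β z : ℝ) : Measure ℝ :=
  (volume.restrict (Set.Ioo 0 1)).withDensity (fun u => ENNReal.ofReal (hypDensity α β z u))

/-- The large deviation principle at speed `k` for the measures `μ k`, with rate function `I`
(lower semicontinuous with values in `[0, ∞]`). -/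
structure LargeDeviationPrinciple (μ : ℕ → Measure ℝ) (I : ℝ → EReal) : Prop where
  nonneg : ∀ x, 0 ≤ I x
  lowerSemicontinuous : LowerSemicontinuous I
  upper_bound : ∀ F : Set ℝ, IsClosed F →
    limsup (fun k : ℕ => ENNReal.log (μ k F) / (k : EReal)) atTop ≤ -⨅ x ∈ F, I x
  lower_bound : ∀ G : Set ℝ, IsOpen G →
    -⨅ x ∈ G, I x ≤ liminf (fun k : ℕ => ENNReal.log (μ k G) / (k : EReal)) atTop

/-- The Legendre transform `x ↦ sup {x * log l - g l : l ∈ D}`, in the variable `log l`, of a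
function `g` defined on a set `D` of positive numbers `l`. -/
def legendre (D : Set ℝ) (g : ℝ → ℝ) (x : ℝ) : EReal :=
  ⨆ l ∈ D, ((x * Real.log l - g l : ℝ) : EReal)

end BetaWalk

end

open MeasureTheory ProbabilityTheory Filter Topology

noncomputable section

namespace BetaWalk

open scoped ENNReal NNReal

/-! The walk moves by nearest-neighbour jumps, so a left jump from `0` must be undone by a passage
from `-1` to `0`, followed by a passage from `0` to `1`. In generating functions (`passGF_eq`) this
gives `Z = w / (1 - l ^ 2 * (1 - w) * Z')`, where `w` is the environment at `0` and `Z'` is `Z` for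
the environment shifted by `-1`. Since `Z'` reads only sites to the left of `0`, it is independent
of `w`, and the law of `Z` is stationary for a random Möbius recursion.

The hypergeometric law is stationary for this recursion (`lintegral_hypLaw_stationary`): a Möbius
substitution turns the transition into a kernel `(1 - z * y * v) ^ (-(α + β))` between two Beta
weights, and the Euler integral of this kernel is again a power. The recursion started at `-N`
forgets its initial value at rate `l ^ N` (`abs_iterZ_sub_le`), so `Z` has this law (`hasLaw_Z`).
For `β < α` the normalising integral diverges as `z ↑ 1`, the law concentrates at `1`, and `φ(ω, 1)
= 1` almost surely (`ae_phi_one`): every `H_k` is finite.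

Given `ω`, `H_k` is a sum of `k` independent passage times, with generating function `∏ φ(shift i ω,
l)`. The upper bound of the large deviation principle is the exponential Chebyshev inequality
together with a law of large numbers for `log φ`. Only functions of finitely many sites are
averaged, and these split into finitely many i.i.d. subsequences (`ae_tendsto_average_shift`); `log
φ` is handled by local majorants.

For the lower bound the passage times are truncated at `M` and tilted by `exp (θ * n)` with `θ` of
either sign. For `x > 1` and `M` large some `θ` gives mean `x`, and Chebyshev's inequality yields a
lower bound with the truncated exponent `truncLyap`. As `M → ∞` the minimum over `θ` of `truncLyap M
θ - θ * x` increases at least to `-I x` (`exists_lt_truncLyap`). Positive `θ` do not matter in the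
limit: sites with `ω` close to `0` are traps, so no exponential moment of the passage time is almost
surely finite. This is why the supremum in `I` extends over `l ≤ 1` only. -/

/-! ### First passage probabilities -/

/-- The environment seen from the site `j`. -/
def shift (j : ℤ) (ω : Env) : Env := fun x => ω (x + j)

/-- The probability that the walk started at `x` hits `k` for the first time at time `n`, defined
by a first step recursion. -/
def hitP (ω : Env) (k : ℤ) : ℕ → ℤ → ℝ≥0∞
  | 0, x => if x = k then 1 else 0
  | n + 1, x => if x = k then 0 else
      ENNReal.ofReal (ω x) * hitP ω k n (x + 1) + ENNReal.ofReal (1 - ω x) * hitP ω k n (x - 1)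

theorem hitP_self_zero (ω : Env) (k : ℤ) : hitP ω k 0 k = 1 := by simp [hitP]

theorem hitP_self_succ (ω : Env) (k : ℤ) (n : ℕ) : hitP ω k (n + 1) k = 0 := by simp [hitP]

theorem hitP_zero_of_ne (ω : Env) {k x : ℤ} (h : x ≠ k) : hitP ω k 0 x = 0 := by simp [hitP, h]

theorem hitP_succ_of_ne (ω : Env) {k x : ℤ} (h : x ≠ k) (n : ℕ) :
    hitP ω k (n + 1) x = ENNReal.ofReal (ω x) * hitP ω k n (x + 1)
      + ENNReal.ofReal (1 - ω x) * hitP ω k n (x - 1) := by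
  simp [hitP, h]

theorem hitP_shift (j : ℤ) (ω : Env) (k : ℤ) (n : ℕ) :
    ∀ x, hitP (shift j ω) k n x = hitP ω (k + j) n (x + j) := by
  induction n with
  | zero => intro x; simp [hitP]
  | succ n ih =>
    intro x
    by_cases h : x = k
    · subst h; simp [hitP_self_succ]
    · rw [hitP_succ_of_ne _ h, hitP_succ_of_ne _ (by omega), ih, ih]
      rw [show x + 1 + j = x + j + 1 by ring, show x - 1 + j = x + j - 1 by ring]
      rfl

theorem measurable_hitP (k : ℤ) (n : ℕ) : ∀ x, Measurable fun ω : Env => hitP ω k n x := by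
  induction n with
  | zero => intro x; simp only [hitP]; exact measurable_const
  | succ n ih =>
    intro x
    have h1 := ih (x + 1)
    have h2 := ih (x - 1)
    have h3 : Measurable fun ω : Env => (ω x : ℝ) := by fun_prop
    simp only [hitP]
    split_ifs
    · exact measurable_const
    · fun_prop

/-- The probability of a first passage at time `n` only reads the environment between `x - n`
and the target. -/
theorem hitP_congr {ω ω' : Env} (k : ℤ) (n : ℕ) :
    ∀ x, x ≤ k → (∀ y, x - n ≤ y → y < k → ω y = ω' y) → hitP ω k n x = hitP ω' k n x := by
  induction n with
  | zero => intro x _ _; simp [hitP]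
  | succ n ih =>
    intro x hx h
    by_cases hk : x = k
    · subst hk; simp [hitP_self_succ]
    · rw [hitP_succ_of_ne _ hk, hitP_succ_of_ne _ hk, h x (by push_cast; omega) (by omega),
        ih (x + 1) (by omega) fun y h1 h2 => h y (by push_cast; omega) h2,
        ih (x - 1) (by omega) fun y h1 h2 => h y (by push_cast; omega) h2]

/-- To reach `j + 1` from the left one has to pass through `j`. -/
theorem hitP_conv (ω : Env) (j : ℤ) (n : ℕ) : ∀ x, x ≤ j →
    hitP ω (j + 1) n x
      = ∑ p ∈ Finset.HasAntidiagonal.antidiagonal n, hitP ω j p.1 x * hitP ω (j + 1) p.2 j := by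
  induction n with
  | zero =>
    intro x hx
    rw [hitP_zero_of_ne _ (by omega)]
    simp [hitP]
  | succ n ih =>
    intro x hx
    rw [Finset.Nat.antidiagonal_succ]
    by_cases h : x = j
    · subst h
      simp [hitP_self_succ, hitP_self_zero]
    · rw [hitP_succ_of_ne _ (by omega), ih _ (by omega), ih _ (by omega)]
      simp only [Finset.sum_cons, Finset.sum_map, hitP_zero_of_ne _ h, zero_mul, zero_add,
        Function.Embedding.prodMap, Function.Embedding.coeFn_mk, Prod.map,
        Function.Embedding.refl_apply, Nat.succ_eq_add_one, hitP_succ_of_ne _ h,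
        Finset.mul_sum, ← Finset.sum_add_distrib]
      refine Finset.sum_congr rfl fun p _ => ?_
      ring

/-- The probability that the walk started at `0` reaches `1` for the first time at time `n`. -/
def passP (ω : Env) (n : ℕ) : ℝ≥0∞ := hitP ω 1 n 0

theorem hitP_eq_passP (ω : Env) (j : ℤ) (n : ℕ) : hitP ω (j + 1) n j = passP (shift j ω) n := by
  rw [passP, hitP_shift, zero_add, add_comm]

theorem measurable_passP (n : ℕ) : Measurable fun ω => passP ω n := measurable_hitP 1 n 0

theorem passP_zero (ω : Env) : passP ω 0 = 0 := by simp [passP, hitP]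

/-- Conditioning on the first jump: a right jump has arrived, while a left jump leaves a passage
from `-1` to `0`, which is a passage in the environment shifted by `-1`, and after it one from `0`
to `1`. -/
theorem passP_succ (ω : Env) (n : ℕ) : passP ω (n + 1) =
    ENNReal.ofReal (ω 0) * (if n = 0 then 1 else 0) + ENNReal.ofReal (1 - ω 0) *
      ∑ p ∈ Finset.HasAntidiagonal.antidiagonal n, passP (shift (-1) ω) p.1 * passP ω p.2 := by
  have h : hitP ω 1 n (0 - 1) = ∑ p ∈ Finset.HasAntidiagonal.antidiagonal n,
      passP (shift (-1) ω) p.1 * passP ω p.2 := by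
    have := hitP_conv ω 0 n (-1) (by norm_num)
    simp only [zero_add] at this
    rw [zero_sub, this]
    refine Finset.sum_congr rfl fun p _ => ?_
    rw [← hitP_eq_passP]
    rfl
  rw [passP, hitP_succ_of_ne _ (by norm_num), h]
  congr 2
  rw [zero_add]
  cases n <;> simp [hitP]

/-- The generating function of the first passage time from `0` to `1`. -/
def passGF (ω : Env) (l : ℝ≥0∞) : ℝ≥0∞ := ∑' n, passP ω n * l ^ n

theorem measurable_passGF (l : ℝ≥0∞) : Measurable fun ω => passGF ω l :=
  Measurable.tsum fun n => (measurable_passP n).mul_const _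

/-- The antidiagonals partition `ℕ × ℕ`, and in `ℝ≥0∞` the order of summation is free. The weight
`h` is arbitrary so that the identity serves both powers of `l` and the general sums `hitSum`. -/
theorem tsum_antidiagonal (f g : ℕ → ℝ≥0∞) (h : ℕ → ℝ≥0∞) :
    ∑' n, (∑ p ∈ Finset.HasAntidiagonal.antidiagonal n, f p.1 * g p.2) * h n
      = ∑' m, f m * ∑' n, g n * h (m + n) := by
  have h1 : ∀ n, (∑ p ∈ Finset.HasAntidiagonal.antidiagonal n, f p.1 * g p.2) * h n
      = ∑' p : Finset.HasAntidiagonal.antidiagonal n, f p.1.1 * g p.1.2 * h (p.1.1 + p.1.2) := by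
    intro n
    rw [Finset.sum_mul, ← Finset.sum_coe_sort, tsum_fintype]
    refine Finset.sum_congr rfl fun p _ => ?_
    rw [Finset.HasAntidiagonal.mem_antidiagonal.1 p.2]
  simp_rw [h1]
  rw [← ENNReal.tsum_sigma' (fun p : Σ n : ℕ, Finset.HasAntidiagonal.antidiagonal n =>
    f p.2.1.1 * g p.2.1.2 * h (p.2.1.1 + p.2.1.2)),
    ← Finset.HasAntidiagonal.sigmaAntidiagonalEquivProd.symm.tsum_eq, ENNReal.tsum_prod']
  refine tsum_congr fun m => ?_
  rw [← ENNReal.tsum_mul_left]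
  refine tsum_congr fun n => ?_
  simp [Finset.HasAntidiagonal.sigmaAntidiagonalEquivProd, mul_assoc]

/-- The convolution in `passP_succ` becomes a product. Working in `ℝ≥0∞` keeps the identity valid
for `l > 1`, where the series may diverge; `not_ae_passGF_lt_top` depends on this. -/
theorem passGF_eq (ω : Env) (l : ℝ≥0∞) : passGF ω l = l * ENNReal.ofReal (ω 0)
    + l * ENNReal.ofReal (1 - ω 0) * passGF (shift (-1) ω) l * passGF ω l := by
  have h : ∀ n, passP ω (n + 1) * l ^ (n + 1) =
      (if n = 0 then l * ENNReal.ofReal (ω 0) else 0) + l * ENNReal.ofReal (1 - ω 0) *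
        ((∑ p ∈ Finset.HasAntidiagonal.antidiagonal n, passP (shift (-1) ω) p.1 * passP ω p.2) * l ^ n) := by
    intro n
    rw [passP_succ]
    split_ifs with h
    · subst h; simp; ring
    · ring
  conv_lhs => rw [passGF, tsum_eq_zero_add' ENNReal.summable]
  simp_rw [h]
  rw [ENNReal.tsum_add, ENNReal.tsum_mul_left, tsum_ite_eq, tsum_antidiagonal, passP_zero]
  simp only [pow_add, zero_mul, zero_add]
  congr 1
  rw [mul_assoc (l * _)]
  congr 1
  rw [passGF, passGF, ← ENNReal.tsum_mul_right]
  refine tsum_congr fun m => ?_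
  rw [mul_assoc, ← ENNReal.tsum_mul_left (a := l ^ m)]
  congr 1
  exact tsum_congr fun n => by ring

/-- The sum of `g` against the law of the hitting time of `k`. -/
def hitSum (ω : Env) (k : ℕ) (g : ℕ → ℝ≥0∞) : ℝ≥0∞ := ∑' n, hitP ω k n 0 * g n

theorem hitSum_zero (ω : Env) (g : ℕ → ℝ≥0∞) : hitSum ω 0 g = g 0 := by
  rw [hitSum, tsum_eq_single 0]
  · simp [hitP]
  · intro n hn
    obtain ⟨m, rfl⟩ := Nat.exists_eq_succ_of_ne_zero hn
    simp [hitP]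

/-- By `hitP_conv`, `H_{k+1}` is `H_k` plus an independent passage time from `k` to `k + 1`. -/
theorem hitSum_succ (ω : Env) (k : ℕ) (g : ℕ → ℝ≥0∞) :
    hitSum ω (k + 1) g = ∑' m, passP (shift k ω) m * hitSum ω k fun n => g (n + m) := by
  have h : ∀ n, hitP ω ((k + 1 : ℕ) : ℤ) n 0 = ∑ p ∈ Finset.HasAntidiagonal.antidiagonal n,
      hitP ω k p.1 0 * passP (shift k ω) p.2 := by
    intro n
    push_cast
    rw [hitP_conv ω k n 0 (by positivity)]
    simp only [hitP_eq_passP]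
  rw [hitSum]
  simp_rw [h]
  rw [tsum_antidiagonal (fun n => hitP ω k n 0) (passP (shift k ω)) g]
  simp_rw [hitSum, ← ENNReal.tsum_mul_left]
  rw [ENNReal.tsum_comm]
  exact tsum_congr fun m => tsum_congr fun n => by ring

theorem hitSum_const_mul (ω : Env) (k : ℕ) (c : ℝ≥0∞) (g : ℕ → ℝ≥0∞) :
    hitSum ω k (fun n => c * g n) = c * hitSum ω k g := by
  rw [hitSum, hitSum, ← ENNReal.tsum_mul_left]
  exact tsum_congr fun n => by ring

theorem hitSum_mono (ω : Env) (k : ℕ) {f g : ℕ → ℝ≥0∞} (h : ∀ n, f n ≤ g n) :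
    hitSum ω k f ≤ hitSum ω k g :=
  ENNReal.tsum_le_tsum fun n => by gcongr; exact h n

theorem hitSum_pow (ω : Env) (l : ℝ≥0∞) (k : ℕ) :
    hitSum ω k (fun n => l ^ n) = ∏ i ∈ Finset.range k, passGF (shift i ω) l := by
  induction k with
  | zero => simp [hitSum_zero]
  | succ k ih =>
    rw [hitSum_succ, Finset.prod_range_succ, ← ih, mul_comm, passGF, ← ENNReal.tsum_mul_right]
    refine tsum_congr fun m => ?_
    have h : (fun n => l ^ (n + m)) = fun n => l ^ m * l ^ n :=
      funext fun n => by rw [pow_add, mul_comm]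
    rw [h, hitSum_const_mul, mul_assoc]

/-! ### The quenched law of the hitting times -/

instance (x : ℤ) (ω : Env) : IsProbabilityMeasure (quenched x ω) := by
  unfold quenched; infer_instance

theorem hit_eq_iff (k n : ℕ) (X : ℕ → ℤ) :
    hit k X = n ↔ (∀ m < n, X m ≠ k) ∧ X n = k := by
  classical
  constructor
  · intro h
    refine ⟨fun m hm => ?_, ?_⟩
    · refine notMem_of_lt_hittingAfter (u := fun n (X : ℕ → ℤ) => X n) (s := {(k : ℤ)}) (n := 0)
        (ω := X) ?_ (Nat.zero_le m)
      change _ < hit k X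
      rw [h]
      exact WithTop.coe_lt_coe.2 hm
    · have hne : ∃ j, 0 ≤ j ∧ X j ∈ ({(k : ℤ)} : Set ℤ) := by
        by_contra hc
        rw [hit, hittingAfter, if_neg hc] at h
        exact ENat.top_ne_natCast n h
      rw [hit, hittingAfter, if_pos hne] at h
      have h' : sInf {i : ℕ | 0 ≤ i ∧ X i ∈ ({(k : ℤ)} : Set ℤ)} = n :=
        WithTop.coe_injective h
      have := Nat.sInf_mem (s := {i : ℕ | 0 ≤ i ∧ X i ∈ ({(k : ℤ)} : Set ℤ)}) hne
      rw [h'] at this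
      exact this.2
  · rintro ⟨h1, h2⟩
    have hne : ∃ j, 0 ≤ j ∧ X j ∈ ({(k : ℤ)} : Set ℤ) := ⟨n, Nat.zero_le n, h2⟩
    rw [hit, hittingAfter, if_pos hne]
    have : sInf {i : ℕ | 0 ≤ i ∧ X i ∈ ({(k : ℤ)} : Set ℤ)} = n := by
      refine le_antisymm (Nat.sInf_le ⟨Nat.zero_le n, h2⟩) ?_
      refine le_csInf hne fun m hm => ?_
      by_contra hlt
      exact h1 m (not_le.1 hlt) hm.2
    exact congrArg WithTop.some this

theorem measurableSet_hit_eq (k n : ℕ) : MeasurableSet {X : ℕ → ℤ | hit k X = n} := by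
  simp_rw [hit_eq_iff]
  refine MeasurableSet.inter (s₁ := {X : ℕ → ℤ | ∀ m < n, X m ≠ k})
    (s₂ := {X : ℕ → ℤ | X n = k}) ?_ ?_
  · simp only [Set.ofPred_forall]
    refine MeasurableSet.iInter fun m => MeasurableSet.iInter fun _ => ?_
    exact (measurableSet_singleton (k : ℤ)).compl.preimage (measurable_pi_apply m)
  · exact (measurableSet_singleton (k : ℤ)).preimage (measurable_pi_apply n)

theorem measurable_hit (k : ℕ) : Measurable (hit k) := by
  refine measurable_to_countable' fun n => ?_
  induction n using ENat.recTopCoe with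
  | top =>
    have : hit k ⁻¹' {⊤} = (⋃ n : ℕ, {X | hit k X = n})ᶜ := by
      ext X
      simp only [Set.mem_preimage, Set.mem_singleton_iff, Set.mem_compl_iff, Set.mem_iUnion,
        Set.mem_ofPred_eq, not_exists]
      constructor
      · intro h n; rw [h]; exact ENat.top_ne_natCast n
      · intro h
        by_contra hne
        obtain ⟨n, hn⟩ := ENat.ne_top_iff_exists.1 hne
        exact h n hn.symm
    rw [this]
    exact (MeasurableSet.iUnion fun n => measurableSet_hit_eq k n).compl
  | coe n => exact measurableSet_hit_eq k n

theorem lintegral_stepKernel (ω : Env) (x : ℤ) (g : ℤ → ℝ≥0∞) :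
    ∫⁻ y, g y ∂(stepKernel ω x)
      = ENNReal.ofReal (ω x) * g (x + 1) + ENNReal.ofReal (1 - ω x) * g (x - 1) := by
  change ∫⁻ y, g y ∂(ENNReal.ofReal (ω x : ℝ) • Measure.dirac (x + 1)
      + ENNReal.ofReal (1 - (ω x : ℝ)) • Measure.dirac (x - 1) : Measure ℤ) = _
  simp

/-- The Markov property at time `n`. -/
theorem lintegral_quenched_succ (ω : Env) (x : ℤ) (n : ℕ) (A : Set (Finset.Iic n → ℤ))
    (g : ℤ → ℝ≥0∞) :
    ∫⁻ X, A.indicator 1 (Preorder.frestrictLe n X) * g (X (n + 1)) ∂(quenched x ω)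
      = ∫⁻ X, A.indicator 1 (Preorder.frestrictLe n X) *
        (ENNReal.ofReal (ω (X n)) * g (X n + 1) + ENNReal.ofReal (1 - ω (X n)) * g (X n - 1))
          ∂(quenched x ω) := by
  set μ := Kernel.partialTraj (X := fun _ => ℤ) (pastKernel ω) 0 n (fun _ => x) with hμ
  have hA : Measurable (A.indicator (1 : (Finset.Iic n → ℤ) → ℝ≥0∞)) :=
    measurable_of_countable _
  have h1 : (quenched x ω).map
      (fun X => (Preorder.frestrictLe (π := fun _ => ℤ) n X, X (n + 1))) = μ ⊗ₘ pastKernel ω n :=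
    (Kernel.partialTraj_compProd_eq_map_traj (Nat.zero_le n)).symm
  have h2 : (quenched x ω).map (Preorder.frestrictLe (π := fun _ => ℤ) n) = μ := by
    rw [quenched, Kernel.traj_map_frestrictLe_apply]
  have hm : Measurable fun p : (Finset.Iic n → ℤ) × ℤ => A.indicator 1 p.1 * g p.2 :=
    measurable_of_countable _
  have hm2 : Measurable fun X : ℕ → ℤ => (Preorder.frestrictLe (π := fun _ => ℤ) n X, X (n + 1)) :=
    by fun_prop
  calc _ = ∫⁻ p, A.indicator 1 p.1 * g p.2 ∂(μ ⊗ₘ pastKernel ω n) := by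
        rw [← h1, lintegral_map hm hm2]
    _ = ∫⁻ h, A.indicator 1 h * (∫⁻ y, g y ∂(pastKernel ω n h)) ∂μ := by
        rw [Measure.lintegral_compProd hm]
        refine lintegral_congr fun h => ?_
        exact lintegral_const_mul (A.indicator 1 h) (measurable_of_countable g)
    _ = _ := by
        rw [← h2, lintegral_map (measurable_of_countable _) (by fun_prop)]
        refine lintegral_congr fun X => ?_
        rw [pastKernel, Kernel.comap_apply, lintegral_stepKernel]
        rfl

theorem quenched_start (ω : Env) (x : ℤ) : ∀ᵐ X ∂(quenched x ω), X 0 = x := by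
  have h : (quenched x ω).map (Preorder.frestrictLe (π := fun _ => ℤ) 0)
      = Measure.dirac (fun _ => x) := by
    rw [quenched, Kernel.traj_map_frestrictLe_apply, Kernel.partialTraj_self, Kernel.id_apply]
  have hs : MeasurableSet {h : Finset.Iic 0 → ℤ | h ⟨0, by simp⟩ = x} :=
    (Set.to_countable _).measurableSet
  have h2 : ∀ᵐ h ∂((quenched x ω).map (Preorder.frestrictLe (π := fun _ => ℤ) 0)),
      h ⟨0, by simp⟩ = x := by
    rw [h]
    exact (ae_dirac_iff hs).2 rfl
  exact ae_of_ae_map (by fun_prop) h2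

theorem quenched_hit_eq (ω : Env) (x : ℤ) (k n : ℕ) :
    quenched x ω {X | hit k X = n} = hitP ω k n x := by
  classical
  -- The integrand lets the chain run for `m` steps and leaves the other `n - m` steps to the
  -- recursion. By the Markov property its integral does not depend on `m`; `m = 0` is the
  -- right-hand side and `m = n` the left-hand side.
  have key : ∀ m ≤ n, ∫⁻ X, {X : ℕ → ℤ | ∀ j < m, X j ≠ k}.indicator 1 X * hitP ω k (n - m) (X m)
      ∂(quenched x ω) = hitP ω k n x := by
    intro m
    induction m with
    | zero =>
      intro _
      have : (fun X : ℕ → ℤ => {X : ℕ → ℤ | ∀ j < 0, X j ≠ k}.indicator (1 : (ℕ → ℤ) → ℝ≥0∞) X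
          * hitP ω k (n - 0) (X 0)) =ᵐ[quenched x ω] fun _ => hitP ω k n x := by
        filter_upwards [quenched_start ω x] with X hX
        simp [hX]
      rw [lintegral_congr_ae this]
      simp
    | succ m ih =>
      intro hm
      rw [← ih (by omega)]
      have := lintegral_quenched_succ ω x m {h | ∀ j : Finset.Iic m, h j ≠ k}
        (hitP ω k (n - (m + 1)))
      have h1 : ∀ X : ℕ → ℤ, {h : Finset.Iic m → ℤ | ∀ j : Finset.Iic m, h j ≠ k}.indicator
          (1 : (Finset.Iic m → ℤ) → ℝ≥0∞) (Preorder.frestrictLe (π := fun _ => ℤ) m X)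
          = {X : ℕ → ℤ | ∀ j < m + 1, X j ≠ k}.indicator 1 X := by
        intro X
        simp only [Set.indicator_apply, Set.mem_ofPred_eq, Preorder.frestrictLe_apply,
          Subtype.forall, Finset.mem_Iic, Nat.lt_succ_iff]
        rfl
      simp_rw [h1] at this
      rw [this]
      refine lintegral_congr fun X => ?_
      by_cases hX : ∀ j < m, X j ≠ k
      · by_cases hX' : X m = k
        · have e : n - m = (n - (m + 1)) + 1 := by omega
          have : ¬ ∀ j < m + 1, X j ≠ k := fun h => h m (by omega) hX'
          simp only [Set.indicator_apply, Set.mem_ofPred_eq, if_pos hX, if_neg this]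
          rw [e, hX', hitP_self_succ]
          simp
        · have e : n - m = (n - (m + 1)) + 1 := by omega
          have : ∀ j < m + 1, X j ≠ k := fun j hj => by
            rcases Nat.lt_succ_iff_lt_or_eq.1 hj with h | h
            · exact hX j h
            · exact h ▸ hX'
          simp only [Set.indicator_apply, Set.mem_ofPred_eq, if_pos hX, if_pos this]
          rw [e, hitP_succ_of_ne _ hX']
      · have : ¬ ∀ j < m + 1, X j ≠ k := fun h => hX fun j hj => h j (by omega)
        simp only [Set.indicator_apply, Set.mem_ofPred_eq, if_neg hX, if_neg this, zero_mul]
  rw [← key n le_rfl, ← lintegral_indicator_one (measurableSet_hit_eq k n)]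
  refine lintegral_congr fun X => ?_
  simp only [Set.indicator_apply, Set.mem_ofPred_eq, hit_eq_iff, Nat.sub_self, hitP]
  by_cases h1 : ∀ j < n, X j ≠ k <;> by_cases h2 : X n = k <;> simp [h1, h2]

theorem lintegral_quenched_hit (ω : Env) (k : ℕ) (g : ℕ → ℝ≥0∞) :
    ∫⁻ X, (if hit k X = ⊤ then 0 else g (hit k X).toNat) ∂(quenched 0 ω) = hitSum ω k g := by
  classical
  have h : ∀ X : ℕ → ℤ, (if hit k X = ⊤ then 0 else g (hit k X).toNat)
      = ∑' n : ℕ, g n * {X | hit k X = n}.indicator 1 X := by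
    intro X
    split_ifs with h
    · simp [h]
    · obtain ⟨m, hm⟩ := ENat.ne_top_iff_exists.1 h
      rw [tsum_eq_single m]
      · simp [← hm]
      · intro n hn
        simp [← hm, hn.symm]
  simp_rw [h]
  rw [lintegral_tsum fun n => ((measurable_one.indicator
    (measurableSet_hit_eq k n)).const_mul _).aemeasurable, hitSum]
  refine tsum_congr fun n => ?_
  rw [lintegral_const_mul _ (measurable_one.indicator (measurableSet_hit_eq k n)),
    lintegral_indicator_one (measurableSet_hit_eq k n), quenched_hit_eq, mul_comm]

theorem hitSum_one_le (ω : Env) (k : ℕ) : hitSum ω k (fun _ => 1) ≤ 1 := by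
  rw [← lintegral_quenched_hit]
  calc _ ≤ ∫⁻ X, 1 ∂(quenched 0 ω) := lintegral_mono fun X => by split_ifs <;> simp
    _ = 1 := by simp

theorem hitSum_one_eq_prod (ω : Env) (k : ℕ) :
    hitSum ω k (fun _ => 1) = ∏ i ∈ Finset.range k, passGF (shift i ω) 1 := by
  rw [← hitSum_pow]; simp

theorem passGF_eq_hitSum (ω : Env) (l : ℝ≥0∞) : passGF ω l = hitSum ω 1 (fun n => l ^ n) := by
  simp [passGF, hitSum, passP]

theorem passGF_one_le (ω : Env) : passGF ω 1 ≤ 1 := by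
  have := hitSum_one_le ω 1
  rwa [passGF_eq_hitSum, show (fun n : ℕ => (1 : ℝ≥0∞) ^ n) = fun _ => 1 by simp]

theorem passGF_mono (ω : Env) {l l' : ℝ≥0∞} (h : l ≤ l') : passGF ω l ≤ passGF ω l' :=
  ENNReal.tsum_le_tsum fun n => by gcongr

theorem ae_hit_ne_top (ω : Env) (h : ∀ i : ℕ, passGF (shift i ω) 1 = 1) :
    ∀ᵐ X ∂(quenched 0 ω), ∀ k : ℕ, hit k X ≠ ⊤ := by
  classical
  rw [ae_all_iff]
  intro k
  have h1 : ∫⁻ X, (if hit k X = ⊤ then 0 else 1) ∂(quenched 0 ω) = 1 := by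
    rw [lintegral_quenched_hit ω k (fun _ => 1), hitSum_one_eq_prod]
    simp [h]
  have hm : MeasurableSet {X | hit k X ≠ ⊤} :=
    (measurableSet_singleton _).compl.preimage (measurable_hit k)
  refine (mem_ae_iff_prob_eq_one hm).2 ?_
  rw [← h1, ← lintegral_indicator_one hm]
  refine lintegral_congr fun X => ?_
  by_cases hX : hit k X = ⊤ <;> simp [hX]

/-- `toNat` sends `⊤` to `0`, so infinite hitting times would appear in `hitLaw` as spurious mass at
`0`; the hypothesis `h` excludes them. -/
theorem hitLaw_apply (ω : Env) (h : ∀ i : ℕ, passGF (shift i ω) 1 = 1) (k : ℕ) {A : Set ℝ}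
    (hA : MeasurableSet A) :
    hitLaw ω k A = hitSum ω k fun n => A.indicator 1 ((n : ℝ) / k) := by
  classical
  have hm : Measurable fun X : ℕ → ℤ => ((hit k X).toNat : ℝ) / k :=
    (measurable_of_countable fun n : ℕ∞ => (n.toNat : ℝ) / k).comp (measurable_hit k)
  rw [hitLaw, Measure.map_apply hm hA, ← lintegral_indicator_one (hA.preimage hm),
    ← lintegral_quenched_hit]
  refine lintegral_congr_ae ?_
  filter_upwards [ae_hit_ne_top ω h] with X hX
  rw [if_neg (hX k)]
  rfl

theorem phi_eq (ω : Env) {l : ℝ} (hl : 0 ≤ l) : phi ω l = (passGF ω (ENNReal.ofReal l)).toReal := by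
  classical
  have h : ∀ X : ℕ → ℤ, ENNReal.ofReal (if hit 1 X = ⊤ then 0 else l ^ (hit 1 X).toNat) =
      if hit 1 X = ⊤ then 0 else (ENNReal.ofReal l) ^ (hit 1 X).toNat := by
    intro X
    split_ifs
    · simp
    · rw [ENNReal.ofReal_pow hl]
  have hm : Measurable fun X : ℕ → ℤ => if hit 1 X = ⊤ then 0 else l ^ (hit 1 X).toNat :=
    (measurable_of_countable fun n : ℕ∞ => if n = ⊤ then 0 else l ^ n.toNat).comp (measurable_hit 1)
  rw [phi, integral_eq_lintegral_of_nonneg_ae (Eventually.of_forall fun X => by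
    simp only [Pi.zero_apply]; split_ifs; exacts [le_rfl, pow_nonneg hl _]) hm.aestronglyMeasurable]
  simp_rw [h]
  rw [lintegral_quenched_hit, passGF_eq_hitSum]

/-! ### The law of the environment -/

theorem isProbabilityMeasure_envLaw {α β : ℝ} (hα : 0 < α) (hβ : 0 < β) :
    IsProbabilityMeasure (envLaw α β hα hβ) := by
  have := isProbabilityMeasure_siteLaw hα hβ
  unfold envLaw
  infer_instance

theorem measurable_shift (j : ℤ) : Measurable (shift j) := by
  unfold shift
  fun_prop

theorem shift_shift (i j : ℤ) (ω : Env) : shift i (shift j ω) = shift (i + j) ω := by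
  funext x
  simp [shift, add_assoc]

theorem shift_zero (ω : Env) : shift 0 ω = ω := by
  funext x
  simp [shift]

theorem measurePreserving_shift {α β : ℝ} (hα : 0 < α) (hβ : 0 < β) (j : ℤ) :
    MeasurePreserving (shift j) (envLaw α β hα hβ) (envLaw α β hα hβ) := by
  have := isProbabilityMeasure_siteLaw hα hβ
  refine ⟨measurable_shift j, ?_⟩
  exact Measure.map_infinitePi_infinitePi_of_inj (P := fun _ : ℤ => siteLaw α β)
    (f := fun x : ℤ => x + j) (add_left_injective j)

theorem measurePreserving_eval_env {α β : ℝ} (hα : 0 < α) (hβ : 0 < β) (x : ℤ) :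
    MeasurePreserving (fun ω : Env => ω x) (envLaw α β hα hβ) (siteLaw α β) := by
  have := isProbabilityMeasure_siteLaw hα hβ
  exact measurePreserving_eval_infinitePi (fun _ : ℤ => siteLaw α β) x

theorem measurable_update_env :
    Measurable fun p : Set.Ioo (0 : ℝ) 1 × Env => Function.update p.2 0 p.1 := by
  refine measurable_pi_lambda _ fun x => ?_
  by_cases h : x = 0
  · subst h; simpa using measurable_fst
  · simp only [Function.update_of_ne h]
    exact (measurable_pi_apply x).comp measurable_snd

/-- Resampling the environment at the origin does not change its law. -/
theorem measurePreserving_update {α β : ℝ} (hα : 0 < α) (hβ : 0 < β) :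
    MeasurePreserving (fun p : Set.Ioo (0 : ℝ) 1 × Env => Function.update p.2 0 p.1)
      ((siteLaw α β).prod (envLaw α β hα hβ)) (envLaw α β hα hβ) := by
  classical
  have := isProbabilityMeasure_siteLaw hα hβ
  have := isProbabilityMeasure_envLaw hα hβ
  refine ⟨measurable_update_env, ?_⟩
  conv_rhs => unfold envLaw
  refine Measure.eq_infinitePi _ fun s t ht => ?_
  rw [Measure.map_apply measurable_update_env (MeasurableSet.pi s.countable_toSet fun i _ => ht i)]
  by_cases h0 : (0 : ℤ) ∈ s
  · have : (fun p : Set.Ioo (0 : ℝ) 1 × Env => Function.update p.2 0 p.1) ⁻¹' Set.pi s t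
        = t 0 ×ˢ Set.pi (s.erase 0 : Finset ℤ) t := by
      ext p
      simp only [Set.mem_preimage, Set.mem_pi, Set.mem_prod, Finset.coe_erase, Set.mem_sdiff,
        Finset.mem_coe, Set.mem_singleton_iff]
      constructor
      · intro h
        refine ⟨by simpa using h 0 h0, fun i hi => ?_⟩
        simpa [Function.update_of_ne hi.2] using h i hi.1
      · rintro ⟨h1, h2⟩ i hi
        by_cases hi0 : i = 0
        · subst hi0; simpa using h1
        · simpa [Function.update_of_ne hi0] using h2 i ⟨hi, hi0⟩
    rw [this, Measure.prod_prod, envLaw, Measure.infinitePi_pi _ (fun i _ => ht i),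
      Finset.mul_prod_erase _ (fun i => siteLaw α β (t i)) h0]
  · have : (fun p : Set.Ioo (0 : ℝ) 1 × Env => Function.update p.2 0 p.1) ⁻¹' Set.pi s t
        = Set.univ ×ˢ Set.pi s t := by
      ext p
      simp only [Set.mem_preimage, Set.mem_pi, Set.mem_prod, Finset.mem_coe, Set.mem_univ, true_and]
      refine forall₂_congr fun i hi => ?_
      rw [Function.update_of_ne (by rintro rfl; exact h0 hi)]
    rw [this, Measure.prod_prod, envLaw, Measure.infinitePi_pi _ (fun i _ => ht i)]
    simp

/-! ### Averages over a finite window -/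

/-- The number of `i < k` congruent to `r` modulo `m` is `(k + (m - 1 - r)) / m`. -/
theorem sum_range_eq_sum_residues (a : ℕ → ℝ) {m : ℕ} (hm : 0 < m) (k : ℕ) :
    ∑ i ∈ Finset.range k, a i
      = ∑ r ∈ Finset.range m, ∑ j ∈ Finset.range ((k + (m - 1 - r)) / m), a (m * j + r) := by
  induction k with
  | zero =>
    rw [Finset.sum_range_zero]
    refine (Finset.sum_eq_zero fun r _ => ?_).symm
    rw [Nat.div_eq_of_lt (by omega), Finset.sum_range_zero]
  | succ k ih =>
    have hk := Nat.div_add_mod k m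
    have hs := Nat.mod_lt k hm
    set q := k / m
    set s := k % m
    have h : ∀ r ∈ Finset.range m, ∑ j ∈ Finset.range ((k + 1 + (m - 1 - r)) / m), a (m * j + r)
        = ∑ j ∈ Finset.range ((k + (m - 1 - r)) / m), a (m * j + r)
          + if r = s then a k else 0 := by
      intro r hr
      have hr := Finset.mem_range.1 hr
      have hdiv : ∀ t, (m * q + t) / m = q + t / m := fun t => Nat.mul_add_div hm q t
      rw [← hk, show m * q + s + 1 + (m - 1 - r) = m * q + (s + 1 + (m - 1 - r)) by ring,
        show m * q + s + (m - 1 - r) = m * q + (s + (m - 1 - r)) by ring, hdiv, hdiv]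
      rcases lt_trichotomy r s with h | h | h
      · rw [if_neg h.ne, Nat.div_eq_of_lt_le (k := 1) (by omega) (by omega),
          Nat.div_eq_of_lt_le (k := 1) (by omega) (by omega), add_zero]
      · subst h
        rw [if_pos rfl, Nat.div_eq_of_lt_le (k := 1) (by omega) (by omega),
          Nat.div_eq_of_lt (b := m) (by omega), Finset.sum_range_succ]
        simp
      · rw [if_neg h.ne', Nat.div_eq_of_lt (b := m) (by omega),
          Nat.div_eq_of_lt (b := m) (by omega), add_zero, add_zero]
    rw [Finset.sum_range_succ, ih, Finset.sum_congr rfl h, Finset.sum_add_distrib,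
      Finset.sum_ite_eq' , if_pos (Finset.mem_range.2 hs)]

theorem tendsto_residue_count {m : ℕ} (hm : 0 < m) (r : ℕ) :
    Tendsto (fun k : ℕ => (((k + (m - 1 - r)) / m : ℕ) : ℝ) / k) atTop (𝓝 (1 / m)) := by
  have hm' : (0 : ℝ) < m := by exact_mod_cast hm
  have h1 : Tendsto (fun k : ℕ => (1 : ℝ) / k) atTop (𝓝 0) :=
    tendsto_const_nhds.div_atTop tendsto_natCast_atTop_atTop
  rw [tendsto_iff_norm_sub_tendsto_zero]
  refine squeeze_zero' (Eventually.of_forall fun _ => norm_nonneg _) ?_ h1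
  filter_upwards [eventually_gt_atTop 0] with k hk
  have hk' : (0 : ℝ) < k := by exact_mod_cast hk
  set c := (k + (m - 1 - r)) / m with hc
  have h2 : m * c ≤ k + m := (Nat.mul_div_le _ _).trans (by omega)
  have h3 : k ≤ m * c + m := by
    have := Nat.lt_mul_div_succ (k + (m - 1 - r)) hm
    rw [← hc] at this
    nlinarith
  have h2' : (m : ℝ) * c ≤ k + m := by exact_mod_cast h2
  have h3' : (k : ℝ) ≤ m * c + m := by exact_mod_cast h3
  rw [Real.norm_eq_abs, show (c : ℝ) / k - 1 / m = ((m * c - k) / m) / k by field_simp, abs_div,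
    abs_of_pos hk']
  gcongr
  rw [abs_div, abs_of_pos hm', div_le_one hm', abs_le]
  constructor <;> linarith

/-- The law of large numbers along the shift, for a function of finitely many sites. -/
theorem ae_tendsto_average_shift {α β : ℝ} (hα : 0 < α) (hβ : 0 < β) {g : Env → ℝ}
    (hg : Measurable g) {N : ℕ} (hd : DependsOn g (Set.Icc (-N : ℤ) 0))
    (hint : Integrable g (envLaw α β hα hβ)) :
    ∀ᵐ ω ∂(envLaw α β hα hβ), Tendsto (fun k : ℕ => (∑ i ∈ Finset.range k, g (shift i ω)) / k)
      atTop (𝓝 (∫ ω, g ω ∂(envLaw α β hα hβ))) := by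
  have := isProbabilityMeasure_siteLaw hα hβ
  have := isProbabilityMeasure_envLaw hα hβ
  -- The windows `[i - N, i]` and `[j - N, j]` are disjoint once `i` and `j` differ by at least `N +
  -- 1`. Along each residue class modulo `m` the shifted functions are therefore i.i.d., and the
  -- ordinary strong law applies.
  set m := N + 1 with hm
  have hm0 : 0 < m := by omega
  set P := envLaw α β hα hβ with hP
  have hcoord : iIndepFun (fun (i : ℤ) (ω : Env) => ω i) P :=
    iIndepFun_infinitePi (P := fun _ : ℤ => siteLaw α β) (X := fun _ w => w)
      (fun _ => measurable_id)
  have hind : ∀ i j : ℤ, i + m ≤ j → (fun ω => g (shift i ω)) ⟂ᵢ[P] (fun ω => g (shift j ω)) := by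
    intro i j hij
    let S : ℤ → Finset ℤ := fun i => Finset.Icc (i - N) i
    let w : Set.Ioo (0 : ℝ) 1 := ⟨1 / 2, by norm_num, by norm_num⟩
    -- Filling the sites outside the window with the constant `w` exhibits `g ∘ shift i` as a
    -- measurable function of the coordinates in the window.
    let ext : (i : ℤ) → (S i → Set.Ioo (0 : ℝ) 1) → Env := fun i h x =>
      if hx : x ∈ S i then h ⟨x, hx⟩ else w
    have hext : ∀ i, Measurable (ext i) := by
      intro i
      refine measurable_pi_lambda _ fun x => ?_
      by_cases hx : x ∈ S i
      · simp only [ext, dif_pos hx]; exact measurable_pi_apply _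
      · simp only [ext, dif_neg hx]; exact measurable_const
    have hrec : ∀ i, (fun ω => g (shift i ω))
        = (fun h => g (shift i (ext i h))) ∘ fun (ω : Env) (x : S i) => ω x := by
      intro i
      funext ω
      refine hd fun x hx => ?_
      have : x + i ∈ S i := Finset.mem_Icc.2 ⟨by linarith [hx.1], by linarith [hx.2]⟩
      simp [shift, ext, this]
    rw [hrec i, hrec j]
    refine (hcoord.indepFun_finset (S i) (S j) ?_ fun i => measurable_pi_apply i).comp
      (hg.comp ((measurable_shift i).comp (hext i))) (hg.comp ((measurable_shift j).comp (hext j)))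
    rw [Finset.disjoint_left]
    intro x hx hx'
    rw [Finset.mem_Icc] at hx hx'
    rw [hm] at hij
    push_cast at hij
    linarith [hx.2, hx'.1]
  have hslln : ∀ r : ℕ, ∀ᵐ ω ∂P, Tendsto (fun n : ℕ =>
      (∑ j ∈ Finset.range n, g (shift ((m * j + r : ℕ) : ℤ) ω)) / n) atTop (𝓝 (∫ ω, g ω ∂P)) := by
    intro r
    have hid : ∀ i : ℤ, ∫ ω, g (shift i ω) ∂P = ∫ ω, g ω ∂P := fun i => by
      rw [← integral_map (measurable_shift i).aemeasurable
        (by rw [(measurePreserving_shift hα hβ i).map_eq]; exact hint.aestronglyMeasurable),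
        (measurePreserving_shift hα hβ i).map_eq]
    rw [← hid ((m * 0 + r : ℕ) : ℤ)]
    refine strong_law_ae_real (fun j ω => g (shift ((m * j + r : ℕ) : ℤ) ω))
      ((measurePreserving_shift hα hβ _).integrable_comp_of_integrable hint) ?_ ?_
    · have hlt : ∀ i j : ℕ, i < j → ((m * i + r : ℕ) : ℤ) + m ≤ ((m * j + r : ℕ) : ℤ) := by
        intro i j hij
        have : m * (i + 1) ≤ m * j := Nat.mul_le_mul_left m hij
        push_cast
        zify at this
        linarith
      intro i j hij
      rcases lt_or_gt_of_ne hij with h | h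
      · exact hind _ _ (hlt i j h)
      · exact (hind _ _ (hlt j i h)).symm
    · intro i
      refine ⟨(hg.comp (measurable_shift _)).aemeasurable,
        (hg.comp (measurable_shift _)).aemeasurable, ?_⟩
      have hmap : ∀ i : ℤ, P.map (fun ω => g (shift i ω)) = P.map g := fun i => by
        conv_rhs => rw [hP, ← (measurePreserving_shift hα hβ i).map_eq,
          Measure.map_map hg (measurable_shift i)]
        rfl
      rw [hmap, hmap]
  filter_upwards [ae_all_iff.2 hslln] with ω hω
  have hlim : Tendsto (fun k : ℕ => ∑ r ∈ Finset.range m,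
      (∑ j ∈ Finset.range ((k + (m - 1 - r)) / m), g (shift ((m * j + r : ℕ) : ℤ) ω)) /
        (((k + (m - 1 - r)) / m : ℕ) : ℝ) * ((((k + (m - 1 - r)) / m : ℕ) : ℝ) / k)) atTop
      (𝓝 (∑ r ∈ Finset.range m, (∫ ω, g ω ∂P) * (1 / m))) := by
    refine tendsto_finsetSum _ fun r _ => ?_
    refine Tendsto.mul ?_ (tendsto_residue_count hm0 r)
    refine (hω r).comp (f := fun k : ℕ => (k + (m - 1 - r)) / m) ?_
    exact (Nat.tendsto_div_const_atTop hm0.ne').comp (tendsto_add_atTop_nat _)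
  have hval : ∑ r ∈ Finset.range m, (∫ ω, g ω ∂P) * (1 / (m : ℝ)) = ∫ ω, g ω ∂P := by
    rw [Finset.sum_const, Finset.card_range, nsmul_eq_mul]
    have : (m : ℝ) ≠ 0 := by exact_mod_cast hm0.ne'
    field_simp
  rw [hval] at hlim
  refine hlim.congr fun k => ?_
  rw [sum_range_eq_sum_residues (fun i => g (shift i ω)) hm0 k, Finset.sum_div]
  refine Finset.sum_congr rfl fun r _ => ?_
  by_cases hc : ((k + (m - 1 - r)) / m) = 0
  · rw [hc]; simp
  · have : (((k + (m - 1 - r)) / m : ℕ) : ℝ) ≠ 0 := by exact_mod_cast hc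
    rw [div_mul_div_cancel₀ this]

/-! ### Beta integrals and the hypergeometric law -/

theorem lintegral_beta {a b : ℝ} (ha : 0 < a) (hb : 0 < b) :
    ∫⁻ u in Set.Ioo (0 : ℝ) 1, ENNReal.ofReal (u ^ (a - 1) * (1 - u) ^ (b - 1))
      = ENNReal.ofReal (beta a b) := by
  have h := lintegral_betaPDF_eq_one ha hb
  rw [lintegral_betaPDF] at h
  have hb0 := beta_pos ha hb
  have h2 : ∀ u : ℝ, ENNReal.ofReal (1 / beta a b * u ^ (a - 1) * (1 - u) ^ (b - 1))
      = ENNReal.ofReal (1 / beta a b) * ENNReal.ofReal (u ^ (a - 1) * (1 - u) ^ (b - 1)) :=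
    fun u => by rw [mul_assoc, ENNReal.ofReal_mul (by positivity)]
  simp_rw [h2] at h
  rw [lintegral_const_mul' _ _ ENNReal.ofReal_ne_top] at h
  set J := ∫⁻ u in Set.Ioo (0 : ℝ) 1, ENNReal.ofReal (u ^ (a - 1) * (1 - u) ^ (b - 1))
  calc J = ENNReal.ofReal (beta a b * (1 / beta a b)) * J := by
        rw [mul_one_div_cancel hb0.ne', ENNReal.ofReal_one, one_mul]
    _ = _ := by rw [ENNReal.ofReal_mul hb0.le, mul_assoc, h, mul_one]

theorem integrableOn_beta {a b : ℝ} (ha : 0 < a) (hb : 0 < b) :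
    IntegrableOn (fun u : ℝ => u ^ (a - 1) * (1 - u) ^ (b - 1)) (Set.Ioo 0 1) := by
  refine ⟨Measurable.aestronglyMeasurable (by fun_prop), ?_⟩
  rw [hasFiniteIntegral_iff_ofReal, lintegral_beta ha hb]
  · exact ENNReal.ofReal_lt_top
  · filter_upwards [ae_restrict_mem measurableSet_Ioo] with u hu
    have := hu.1
    have : 0 < 1 - u := sub_pos.2 hu.2
    simp only [Pi.zero_apply]
    positivity

theorem lintegral_siteLaw {α β : ℝ} {f : ℝ → ℝ≥0∞} (hf : Measurable f) :
    ∫⁻ w, f w ∂(siteLaw α β) = ENNReal.ofReal (1 / beta α β) *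
      ∫⁻ u in Set.Ioo (0 : ℝ) 1, ENNReal.ofReal (u ^ (α - 1) * (1 - u) ^ (β - 1)) * f u := by
  have h : (siteLaw α β).map Subtype.val = (betaMeasure α β).restrict (Set.Ioo 0 1) := by
    rw [siteLaw, (MeasurableEmbedding.subtype_coe measurableSet_Ioo).map_comap,
      Subtype.range_coe]
  rw [← lintegral_map hf measurable_subtype_coe, h, betaMeasure,
    restrict_withDensity measurableSet_Ioo,
    lintegral_withDensity_eq_lintegral_mul _ (by unfold betaPDF; fun_prop) hf,
    ← lintegral_const_mul' _ _ ENNReal.ofReal_ne_top]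
  refine setLIntegral_congr_fun measurableSet_Ioo fun u hu => ?_
  rw [Pi.mul_apply, betaPDF_of_pos_lt_one hu.1 hu.2, mul_assoc (1 / beta α β),
    ENNReal.ofReal_mul' (mul_nonneg (Real.rpow_nonneg hu.1.le _)
      (Real.rpow_nonneg (sub_nonneg.2 hu.2.le) _)), mul_assoc]

theorem lintegral_siteLaw' {α β : ℝ} {f : Set.Ioo (0 : ℝ) 1 → ℝ≥0∞} {g : ℝ → ℝ≥0∞}
    (hg : Measurable g) (hfg : ∀ w, f w = g w) :
    ∫⁻ w, f w ∂(siteLaw α β) = ENNReal.ofReal (1 / beta α β) *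
      ∫⁻ u in Set.Ioo (0 : ℝ) 1, ENNReal.ofReal (u ^ (α - 1) * (1 - u) ^ (β - 1)) * g u := by
  simp_rw [hfg]
  exact lintegral_siteLaw hg

theorem abs_log_le_rpow {u a : ℝ} (hu : 0 < u) (hu1 : u ≤ 1) (ha : 0 < a) :
    |Real.log u| ≤ 1 / a * u ^ (-a) := by
  have h := Real.abs_log_mul_self_rpow_lt u a hu hu1 ha
  rw [abs_mul, abs_of_pos (Real.rpow_pos_of_pos hu a)] at h
  rw [Real.rpow_neg hu.le, ← div_eq_mul_inv, le_div_iff₀ (Real.rpow_pos_of_pos hu a)]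
  exact h.le

theorem integrable_siteLaw_of_le {α β a b C : ℝ} (ha : 0 < a) (hb : 0 < b)
    {f : ℝ → ℝ} (hf : Measurable f)
    (h : ∀ u ∈ Set.Ioo (0 : ℝ) 1,
      u ^ (α - 1) * (1 - u) ^ (β - 1) * |f u| ≤ C * (u ^ (a - 1) * (1 - u) ^ (b - 1))) :
    Integrable (fun w : Set.Ioo (0 : ℝ) 1 => f w) (siteLaw α β) := by
  have hC : 0 ≤ C := by
    have h1 := h (1 / 2) ⟨by norm_num, by norm_num⟩
    have h2 : (0 : ℝ) < (1 / 2) ^ (a - 1) * (1 - 1 / 2) ^ (b - 1) := by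
      have : (0 : ℝ) < 1 - 1 / 2 := by norm_num
      positivity
    have h3 : (0 : ℝ) ≤ (1 / 2) ^ (α - 1) * (1 - 1 / 2) ^ (β - 1) * |f (1 / 2)| := by
      have : (0 : ℝ) < 1 - 1 / 2 := by norm_num
      positivity
    exact nonneg_of_mul_nonneg_left (h3.trans h1) h2
  refine ⟨(hf.comp measurable_subtype_coe).aestronglyMeasurable, ?_⟩
  rw [hasFiniteIntegral_iff_norm]
  simp_rw [Real.norm_eq_abs]
  rw [lintegral_siteLaw' (α := α) (β := β) (g := fun u => ENNReal.ofReal |f u|) (by fun_prop) (fun _ => rfl)]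
  refine ENNReal.mul_lt_top ENNReal.ofReal_lt_top ?_
  calc _ ≤ ∫⁻ u in Set.Ioo (0 : ℝ) 1, ENNReal.ofReal C *
        ENNReal.ofReal (u ^ (a - 1) * (1 - u) ^ (b - 1)) := by
        refine setLIntegral_mono' measurableSet_Ioo fun u hu => ?_
        rw [← ENNReal.ofReal_mul' (abs_nonneg _), ← ENNReal.ofReal_mul hC]
        exact ENNReal.ofReal_le_ofReal (h u hu)
    _ < ∞ := by
        rw [lintegral_const_mul' _ _ ENNReal.ofReal_ne_top, lintegral_beta ha hb]
        exact ENNReal.mul_lt_top ENNReal.ofReal_lt_top ENNReal.ofReal_lt_top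

/-- The logarithm is at most a multiple of `u ^ (-α / 2)`, which still leaves an integrable Beta(α /
2, β) weight. -/
theorem integrable_log_siteLaw {α β : ℝ} (hα : 0 < α) (hβ : 0 < β) :
    Integrable (fun w : Set.Ioo (0 : ℝ) 1 => Real.log w) (siteLaw α β) := by
  refine integrable_siteLaw_of_le (a := α / 2) (b := β) (C := 1 / (α / 2)) (by positivity) hβ
    Real.measurable_log fun u hu => ?_
  have h0 : 0 < 1 - u := sub_pos.2 hu.2
  have h1 := abs_log_le_rpow hu.1 hu.2.le (half_pos hα)
  have h2 : u ^ (α - 1) * u ^ (-(α / 2)) = u ^ (α / 2 - 1) := by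
    rw [← Real.rpow_add hu.1]; congr 1; ring
  have h3 := Real.rpow_nonneg hu.1.le (α - 1)
  have h4 := Real.rpow_nonneg h0.le (β - 1)
  calc _ ≤ u ^ (α - 1) * (1 - u) ^ (β - 1) * (1 / (α / 2) * u ^ (-(α / 2))) := by gcongr
    _ = 1 / (α / 2) * ((u ^ (α - 1) * u ^ (-(α / 2))) * (1 - u) ^ (β - 1)) := by ring
    _ = _ := by rw [h2]

theorem integrable_log_one_sub_siteLaw {α β : ℝ} (hα : 0 < α) (hβ : 0 < β) :
    Integrable (fun w : Set.Ioo (0 : ℝ) 1 => Real.log (1 - w)) (siteLaw α β) := by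
  refine integrable_siteLaw_of_le (f := fun u => Real.log (1 - u)) (a := α) (b := β / 2)
    (C := 1 / (β / 2)) hα (by positivity) (by fun_prop) fun u hu => ?_
  have h0 : 0 < 1 - u := sub_pos.2 hu.2
  have h1 := abs_log_le_rpow h0 (by linarith [hu.1]) (half_pos hβ)
  have h2 : (1 - u) ^ (β - 1) * (1 - u) ^ (-(β / 2)) = (1 - u) ^ (β / 2 - 1) := by
    rw [← Real.rpow_add h0]; congr 1; ring
  have h3 := Real.rpow_nonneg hu.1.le (α - 1)
  have h4 := Real.rpow_nonneg h0.le (β - 1)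
  calc _ ≤ u ^ (α - 1) * (1 - u) ^ (β - 1) * (1 / (β / 2) * (1 - u) ^ (-(β / 2))) := by gcongr
    _ = 1 / (β / 2) * (u ^ (α - 1) * ((1 - u) ^ (β - 1) * (1 - u) ^ (-(β / 2)))) := by ring
    _ = _ := by rw [h2]

/-- The Möbius substitution `y = w / (1 - c * (1 - w))` in beta integrals. -/
theorem lintegral_beta_moebius {α β c : ℝ} (hc0 : 0 ≤ c) (hc1 : c < 1) (f : ℝ → ℝ≥0∞) :
    ∫⁻ w in Set.Ioo (0 : ℝ) 1, ENNReal.ofReal (w ^ (α - 1) * (1 - w) ^ (β - 1)) *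
        f (w / (1 - c * (1 - w)))
      = ∫⁻ y in Set.Ioo (0 : ℝ) 1, ENNReal.ofReal (y ^ (α - 1) * (1 - y) ^ (β - 1) *
        (1 - c) ^ α * (1 - c * y) ^ (-(α + β))) * f y := by
  have hd : ∀ y ∈ Set.Ioo (0 : ℝ) 1, 0 < 1 - c * y := fun y hy => by nlinarith [hy.1, hy.2]
  have hc : 0 < 1 - c := sub_pos.2 hc1
  -- The integral is transported along the inverse map `y ↦ y * (1 - c) / (1 - c * y)`, an
  -- increasing bijection of `(0, 1)` with derivative `(1 - c) / (1 - c * y) ^ 2`.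
  have himg : (fun y => y * (1 - c) / (1 - c * y)) '' Set.Ioo (0 : ℝ) 1 = Set.Ioo 0 1 := by
    ext w
    constructor
    · rintro ⟨y, hy, rfl⟩
      have := hd y hy
      refine ⟨div_pos (mul_pos hy.1 hc) this, ?_⟩
      rw [div_lt_one this]
      nlinarith [hy.2]
    · intro hw
      have h1 : 0 < 1 - c * (1 - w) := by nlinarith [hw.1, hw.2]
      have h2 : 1 - c * (1 - w) - c * w ≠ 0 := by
        have : 1 - c * (1 - w) - c * w = 1 - c := by ring
        rw [this]; exact hc.ne'
      refine ⟨w / (1 - c * (1 - w)), ⟨div_pos hw.1 h1, ?_⟩, ?_⟩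
      · rw [div_lt_one h1]
        nlinarith [hw.2]
      · have h3 : 1 - c * (w / (1 - c * (1 - w))) = (1 - c) / (1 - c * (1 - w)) := by
          field_simp
          ring
        simp only []
        rw [h3]
        field_simp
  have hder : ∀ y ∈ Set.Ioo (0 : ℝ) 1, HasDerivWithinAt (fun y => y * (1 - c) / (1 - c * y))
      ((1 - c) / (1 - c * y) ^ 2) (Set.Ioo 0 1) y := by
    intro y hy
    have h1 := hd y hy
    have h2 : HasDerivAt (fun y : ℝ => y * (1 - c)) (1 - c) y := by
      simpa using (hasDerivAt_id y).mul_const (1 - c)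
    have h3 : HasDerivAt (fun y : ℝ => 1 - c * y) (-c) y := by
      simpa using ((hasDerivAt_id y).const_mul c).const_sub 1
    have h4 := h2.div h3 h1.ne'
    refine (h4.congr_deriv ?_).hasDerivWithinAt
    congr 1
    ring
  have hinj : Set.InjOn (fun y => y * (1 - c) / (1 - c * y)) (Set.Ioo (0 : ℝ) 1) := by
    intro y hy y' hy' h
    simp only [] at h
    rw [div_eq_div_iff (hd y hy).ne' (hd y' hy').ne'] at h
    have : (1 - c) * (y - y') = 0 := by linear_combination h
    rcases mul_eq_zero.1 this with h | h
    · exact absurd h hc.ne'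
    · linarith
  conv_lhs => rw [← himg]
  rw [lintegral_image_eq_lintegral_abs_deriv_mul measurableSet_Ioo hder hinj]
  refine setLIntegral_congr_fun measurableSet_Ioo fun y hy => ?_
  have h1 := hd y hy
  have h1' : 1 - y * c ≠ 0 := by rw [mul_comm]; exact h1.ne'
  have h2 : 0 < 1 - y := sub_pos.2 hy.2
  have e1 : 1 - y * (1 - c) / (1 - c * y) = (1 - y) / (1 - c * y) := by
    field_simp
    ring
  have e2 : y * (1 - c) / (1 - c * y) / (1 - c * ((1 - y) / (1 - c * y))) = y := by
    have : 1 - c * ((1 - y) / (1 - c * y)) = (1 - c) / (1 - c * y) := by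
      field_simp
      ring
    rw [this]
    field_simp
  rw [e1, e2, ← mul_assoc, ← ENNReal.ofReal_mul (abs_nonneg _)]
  congr 2
  rw [abs_of_pos (by positivity), Real.div_rpow (mul_pos hy.1 hc).le h1.le,
    Real.mul_rpow hy.1.le hc.le, Real.div_rpow h2.le h1.le, Real.rpow_neg h1.le]
  -- The denominators contribute exponents `α - 1` and `β - 1`, and the derivative contributes `2`.
  have e3 : (1 - c * y) ^ (α + β)
      = (1 - c * y) ^ (α - 1) * (1 - c * y) ^ (β - 1) * (1 - c * y) ^ 2 := by
    rw [← Real.rpow_add h1, ← Real.rpow_two, ← Real.rpow_add h1]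
    congr 1; ring
  have e4 : (1 - c) ^ α = (1 - c) ^ (α - 1) * (1 - c) := by
    rw [← Real.rpow_add_one hc.ne']; congr 1; ring
  rw [e3, e4]
  have p1 := Real.rpow_pos_of_pos h1 (α - 1)
  have p2 := Real.rpow_pos_of_pos h1 (β - 1)
  field_simp

/-- The hypergeometric function `₂F₁(α + β, α; α + β; x)` is a power. -/
theorem lintegral_beta_rpow {α β x : ℝ} (hα : 0 < α) (hβ : 0 < β) (hx0 : 0 ≤ x) (hx1 : x < 1) :
    ∫⁻ v in Set.Ioo (0 : ℝ) 1, ENNReal.ofReal (v ^ (α - 1) * (1 - v) ^ (β - 1) *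
      (1 - x * v) ^ (-(α + β))) = ENNReal.ofReal ((1 - x) ^ (-α)) * ENNReal.ofReal (beta α β) := by
  -- With test function `1` the substitution has the plain Beta integral on its left-hand side.
  have h := lintegral_beta_moebius (α := α) (β := β) hx0 hx1 1
  have hx : 0 < 1 - x := sub_pos.2 hx1
  simp only [Pi.one_apply, mul_one] at h
  rw [lintegral_beta hα hβ] at h
  rw [h, ← lintegral_const_mul' _ _ ENNReal.ofReal_ne_top]
  refine setLIntegral_congr_fun measurableSet_Ioo fun v hv => ?_
  rw [← ENNReal.ofReal_mul (by positivity)]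
  congr 1
  rw [Real.rpow_neg hx.le]
  have := Real.rpow_pos_of_pos hx α
  field_simp

/-- The Euler integral of `₂F₁(α, α; α + β; z)`. -/
def eulerInt (α β z : ℝ) : ℝ :=
  ∫ u in Set.Ioo (0 : ℝ) 1, u ^ (α - 1) * (1 - u) ^ (β - 1) * (1 - u * z) ^ (-α)

theorem hypDensity_eq {α β : ℝ} (hα : 0 < α) (hβ : 0 < β) (z u : ℝ) : hypDensity α β z u =
    (eulerInt α β z)⁻¹ * (u ^ (α - 1) * (1 - u) ^ (β - 1) * (1 - u * z) ^ (-α)) := by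
  have h : hypF α α (α + β) z
      = Real.Gamma (α + β) / (Real.Gamma α * Real.Gamma β) * eulerInt α β z := by
    rw [hypF, eulerInt, intervalIntegral.integral_of_le zero_le_one, integral_Ioc_eq_integral_Ioo,
      add_sub_cancel_left]
  have h1 := Real.Gamma_pos_of_pos hα
  have h2 := Real.Gamma_pos_of_pos hβ
  have h3 := Real.Gamma_pos_of_pos (add_pos hα hβ)
  rw [hypDensity, h]
  congr 1
  rw [one_div, mul_inv, ← mul_assoc, mul_inv_cancel₀ (by positivity), one_mul]

theorem integrableOn_euler {α β z : ℝ} (hα : 0 < α) (hβ : 0 < β) (hz0 : 0 ≤ z) (hz1 : z < 1) :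
    IntegrableOn (fun u : ℝ => u ^ (α - 1) * (1 - u) ^ (β - 1) * (1 - u * z) ^ (-α))
      (Set.Ioo 0 1) := by
  refine Integrable.mono' ((integrableOn_beta hα hβ).mul_const ((1 - z) ^ (-α)))
    (Measurable.aestronglyMeasurable (by fun_prop)) ?_
  filter_upwards [ae_restrict_mem measurableSet_Ioo] with u hu
  have h1 : 0 < 1 - u := sub_pos.2 hu.2
  have h2 : 1 - z ≤ 1 - u * z := by nlinarith [hu.2]
  have h3 : 0 < 1 - z := sub_pos.2 hz1
  have h4 : 0 < 1 - u * z := h3.trans_le h2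
  have h5 := hu.1
  rw [Real.norm_of_nonneg (by positivity)]
  exact mul_le_mul_of_nonneg_left (Real.rpow_le_rpow_of_nonpos h3 h2 (by linarith))
    (by positivity)

theorem eulerInt_pos {α β z : ℝ} (hα : 0 < α) (hβ : 0 < β) (hz0 : 0 ≤ z) (hz1 : z < 1) :
    0 < eulerInt α β z := by
  have hpos : ∀ u ∈ Set.Ioo (0 : ℝ) 1,
      0 < u ^ (α - 1) * (1 - u) ^ (β - 1) * (1 - u * z) ^ (-α) := by
    intro u hu
    have h1 : 0 < 1 - u := sub_pos.2 hu.2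
    have h4 : 0 < 1 - u * z := by nlinarith [hu.1, hu.2]
    have h5 := hu.1
    positivity
  rw [eulerInt, setIntegral_pos_iff_support_of_nonneg_ae _ (integrableOn_euler hα hβ hz0 hz1)]
  · rw [Set.inter_eq_right.2 fun u hu => Function.mem_support.2 (hpos u hu).ne']
    simp
  · filter_upwards [ae_restrict_mem measurableSet_Ioo] with u hu using (hpos u hu).le

theorem measurable_hypDensity (α β z : ℝ) : Measurable (hypDensity α β z) := by
  unfold hypDensity
  fun_prop

theorem hypDensity_nonneg {α β z u : ℝ} (hα : 0 < α) (hβ : 0 < β) (hz0 : 0 ≤ z) (hz1 : z < 1)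
    (hu : u ∈ Set.Ioo (0 : ℝ) 1) : 0 ≤ hypDensity α β z u := by
  have h1 : 0 < 1 - u := sub_pos.2 hu.2
  have h4 : 0 < 1 - u * z := by nlinarith [hu.1, hu.2]
  have h5 := hu.1
  have := eulerInt_pos hα hβ hz0 hz1
  rw [hypDensity_eq hα hβ]
  positivity

theorem lintegral_hypLaw (α β z : ℝ) {f : ℝ → ℝ≥0∞} (hf : Measurable f) :
    ∫⁻ u, f u ∂(hypLaw α β z)
      = ∫⁻ u in Set.Ioo (0 : ℝ) 1, ENNReal.ofReal (hypDensity α β z u) * f u := by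
  rw [hypLaw, lintegral_withDensity_eq_lintegral_mul _
    (measurable_hypDensity α β z).ennreal_ofReal hf]
  rfl

theorem isProbabilityMeasure_hypLaw {α β z : ℝ} (hα : 0 < α) (hβ : 0 < β) (hz0 : 0 ≤ z)
    (hz1 : z < 1) : IsProbabilityMeasure (hypLaw α β z) := by
  refine ⟨?_⟩
  have h := lintegral_hypLaw α β z (f := 1) measurable_one
  simp only [Pi.one_apply, mul_one, lintegral_one] at h
  have hpos := eulerInt_pos hα hβ hz0 hz1
  rw [h, ← ofReal_integral_eq_lintegral_ofReal]
  · simp_rw [hypDensity_eq hα hβ]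
    rw [integral_const_mul]
    change ENNReal.ofReal (_ * eulerInt α β z) = 1
    rw [inv_mul_cancel₀ hpos.ne', ENNReal.ofReal_one]
  · rw [show hypDensity α β z = _ from funext (hypDensity_eq hα hβ z)]
    exact (integrableOn_euler hα hβ hz0 hz1).const_mul _
  · filter_upwards [ae_restrict_mem measurableSet_Ioo] with u hu
      using hypDensity_nonneg hα hβ hz0 hz1 hu

theorem ae_hypLaw_mem (α β z : ℝ) : ∀ᵐ u ∂(hypLaw α β z), u ∈ Set.Ioo (0 : ℝ) 1 :=
  (withDensity_absolutelyContinuous _ _).ae_le (ae_restrict_mem measurableSet_Ioo)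

theorem ofReal_mul_mul_congr {a b d q s t : ℝ} (x : ℝ≥0∞) (ha : 0 ≤ a) (hb : 0 ≤ b) (hq : 0 ≤ q)
    (hs : 0 ≤ s) (h : a * b * d = q * (s * t)) :
    ENNReal.ofReal a * ENNReal.ofReal b * (ENNReal.ofReal d * x)
      = ENNReal.ofReal q * (ENNReal.ofReal s * ENNReal.ofReal t * x) := by
  rw [← ENNReal.ofReal_mul ha, ← mul_assoc, ← ENNReal.ofReal_mul (mul_nonneg ha hb), h,
    ENNReal.ofReal_mul hq, ENNReal.ofReal_mul hs, mul_assoc]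

/-- If `w` has law `Beta(α, β)` and `v` is independent of `w`, with the hypergeometric law, then
`w / (1 - z * (1 - w) * v)` has the hypergeometric law again. -/
theorem lintegral_hypLaw_stationary {α β z : ℝ} (hα : 0 < α) (hβ : 0 < β) (hz0 : 0 ≤ z)
    (hz1 : z < 1) {f : ℝ → ℝ≥0∞} (hf : Measurable f) :
    ∫⁻ v, ∫⁻ w : Set.Ioo (0 : ℝ) 1, f (w / (1 - z * (1 - w) * v)) ∂(siteLaw α β) ∂(hypLaw α β z)
      = ∫⁻ u, f u ∂(hypLaw α β z) := by
  have hb := beta_pos hα hβ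
  have hK := eulerInt_pos hα hβ hz0 hz1
  have := isProbabilityMeasure_siteLaw hα hβ
  have hmeas : Measurable fun v : ℝ =>
      ∫⁻ w : Set.Ioo (0 : ℝ) 1, f (w / (1 - z * (1 - w) * v)) ∂(siteLaw α β) := by
    refine Measurable.lintegral_prod_right' (f := fun p : ℝ × Set.Ioo (0 : ℝ) 1 =>
      f (p.2 / (1 - z * (1 - p.2) * p.1))) (hf.comp ?_)
    fun_prop
  rw [lintegral_hypLaw α β z hmeas, lintegral_hypLaw α β z hf]
  -- Substituting `y = w / (1 - z * v * (1 - w))` produces the factor `(1 - z * v) ^ α`, which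
  -- cancels `(1 - v * z) ^ (-α)` in the density of `v`. Only the Beta weights of `v` and `y` and
  -- the kernel `(1 - z * y * v) ^ (-(α + β))` remain; integrating out `v` by `lintegral_beta_rpow`
  -- recreates the factor `(1 - z * y) ^ (-α)`.
  set q : ℝ → ℝ → ℝ≥0∞ := fun v y => ENNReal.ofReal (v ^ (α - 1) * (1 - v) ^ (β - 1) *
    (1 - z * y * v) ^ (-(α + β))) with hq
  set r : ℝ → ℝ≥0∞ := fun y => ENNReal.ofReal ((eulerInt α β z)⁻¹ * (1 / beta α β)) *
    ENNReal.ofReal (y ^ (α - 1) * (1 - y) ^ (β - 1)) * f y with hr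
  have hrm : Measurable r := by fun_prop
  calc _ = ∫⁻ v in Set.Ioo (0 : ℝ) 1, ∫⁻ y in Set.Ioo (0 : ℝ) 1, q v y * r y := by
        refine setLIntegral_congr_fun measurableSet_Ioo fun v hv => ?_
        have h1 : 0 < 1 - v := sub_pos.2 hv.2
        have h2 : 0 < 1 - z * v := by nlinarith [hv.1, hv.2]
        have h5 := hv.1
        rw [lintegral_siteLaw' (g := fun w => f (w / (1 - z * v * (1 - w))))
          (hf.comp (by fun_prop)) (fun w => by rw [mul_right_comm]),
          lintegral_beta_moebius (by positivity) (by linarith), hypDensity_eq hα hβ,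
          ← mul_assoc, ← lintegral_const_mul' _ _
            (ENNReal.mul_ne_top ENNReal.ofReal_ne_top ENNReal.ofReal_ne_top)]
        refine setLIntegral_congr_fun measurableSet_Ioo fun y hy => ?_
        have h3 : 0 < 1 - y := sub_pos.2 hy.2
        have h4 : 0 < 1 - z * y * v := by
          have : z * y * v < 1 := by
            have : z * y < 1 := by nlinarith [hy.1, hy.2]
            nlinarith [hv.1, hv.2, mul_nonneg hz0 hy.1.le]
          linarith
        have h6 := hy.1
        have h7 : 0 < 1 - z * v * y := by rw [mul_right_comm]; exact h4
        rw [mul_comm v z]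
        refine ofReal_mul_mul_congr _ (by positivity) (by positivity) (by positivity)
          (by positivity) ?_
        rw [mul_right_comm z v y, Real.rpow_neg h2.le]
        have := Real.rpow_pos_of_pos h2 α
        generalize (1 - z * v) ^ α = Q at *
        field_simp
    _ = ∫⁻ y in Set.Ioo (0 : ℝ) 1, ∫⁻ v in Set.Ioo (0 : ℝ) 1, q v y * r y := by
        refine lintegral_lintegral_swap (Measurable.aemeasurable ?_)
        simp only [hq, Function.uncurry_def]
        fun_prop
    _ = _ := by
        refine setLIntegral_congr_fun measurableSet_Ioo fun y hy => ?_
        have hzy0 : 0 ≤ z * y := mul_nonneg hz0 hy.1.le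
        have hzy1 : z * y < 1 := by nlinarith [hy.1, hy.2]
        have h3 : 0 < 1 - y := sub_pos.2 hy.2
        have h4 : 0 < 1 - z * y := by linarith
        have h6 := hy.1
        rw [lintegral_mul_const _ (by fun_prop), lintegral_beta_rpow hα hβ hzy0 hzy1,
          hypDensity_eq hα hβ]
        simp only [hr]
        rw [← mul_assoc, ← mul_assoc, ← ENNReal.ofReal_mul (by positivity),
          ← ENNReal.ofReal_mul (by positivity), ← ENNReal.ofReal_mul (by positivity)]
        congr 2
        rw [mul_comm y z]
        field_simp

/-- At `z = 0` the Möbius map sends `(w, v)` to `w`, so stationarity says that the hypergeometric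
law is the law of `w`. -/
theorem hypLaw_zero {α β : ℝ} (hα : 0 < α) (hβ : 0 < β) :
    hypLaw α β 0 = (siteLaw α β).map Subtype.val := by
  have := isProbabilityMeasure_siteLaw hα hβ
  refine Measure.ext_of_lintegral _ fun f hf => ?_
  rw [← lintegral_hypLaw_stationary hα hβ le_rfl zero_lt_one hf,
    lintegral_map hf measurable_subtype_coe]
  have := isProbabilityMeasure_hypLaw hα hβ le_rfl zero_lt_one
  simp

/-! ### The recursion for the generating function -/

/-- A passage takes at least one step, so one factor `l` comes out of every term. -/
theorem passGF_le (ω : Env) {l : ℝ≥0∞} (hl : l ≤ 1) : passGF ω l ≤ l := by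
  calc passGF ω l ≤ ∑' n, l * passP ω n := by
        refine ENNReal.tsum_le_tsum fun n => ?_
        cases n with
        | zero => simp [passP_zero]
        | succ n =>
          rw [pow_succ, mul_comm l]
          gcongr
          exact mul_le_of_le_one_left' (pow_le_one₀ zero_le hl)
    _ = l * passGF ω 1 := by rw [ENNReal.tsum_mul_left]; simp [passGF]
    _ ≤ l := mul_le_of_le_one_right' (passGF_one_le ω)

theorem passGF_ofReal_ne_top (ω : Env) {l : ℝ} (hl : l ≤ 1) :
    passGF ω (ENNReal.ofReal l) ≠ ∞ :=
  ((passGF_le ω (ENNReal.ofReal_le_one.2 hl)).trans_lt ENNReal.ofReal_lt_top).ne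

theorem measurable_phi {l : ℝ} (hl : 0 ≤ l) : Measurable fun ω => phi ω l := by
  simp_rw [phi_eq _ hl]
  exact (measurable_passGF _).ennreal_toReal

theorem phi_nonneg (ω : Env) {l : ℝ} (hl : 0 ≤ l) : 0 ≤ phi ω l := by
  rw [phi_eq ω hl]; exact ENNReal.toReal_nonneg

theorem phi_le (ω : Env) {l : ℝ} (hl : 0 ≤ l) (hl1 : l ≤ 1) : phi ω l ≤ l := by
  rw [phi_eq ω hl]
  exact ENNReal.toReal_le_of_le_ofReal hl (passGF_le ω (ENNReal.ofReal_le_one.2 hl1))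

theorem phi_rec (ω : Env) {l : ℝ} (hl : 0 ≤ l) (hl1 : l ≤ 1) :
    phi ω l = l * ω 0 + l * (1 - ω 0) * phi (shift (-1) ω) l * phi ω l := by
  have h1 := passGF_ofReal_ne_top ω hl1
  have h2 := passGF_ofReal_ne_top (shift (-1) ω) hl1
  have hw := (ω 0).2.1.le
  have hw' := sub_nonneg.2 (ω 0).2.2.le
  rw [phi_eq ω hl, phi_eq _ hl]
  conv_lhs => rw [passGF_eq]
  rw [ENNReal.toReal_add (by finiteness) (by finiteness)]
  simp [ENNReal.toReal_mul, ENNReal.toReal_ofReal, hl, hw, hw']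

theorem mul_le_phi (ω : Env) {l : ℝ} (hl : 0 ≤ l) (hl1 : l ≤ 1) : l * ω 0 ≤ phi ω l := by
  have h1 := phi_nonneg ω hl
  have h2 := phi_nonneg (shift (-1) ω) hl
  have h3 := sub_nonneg.2 (ω 0).2.2.le
  rw [phi_rec ω hl hl1]
  exact le_add_of_nonneg_right (mul_nonneg (mul_nonneg (mul_nonneg hl h3) h2) h1)

theorem phi_pos (ω : Env) {l : ℝ} (hl : 0 < l) (hl1 : l ≤ 1) : 0 < phi ω l :=
  (mul_pos hl (ω 0).2.1).trans_le (mul_le_phi ω hl.le hl1)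

theorem phi_eq_mul_Z (ω : Env) {l : ℝ} (hl : 0 < l) : phi ω l = l * Z l ω := by
  rw [Z]; field_simp

theorem measurable_Z {l : ℝ} (hl : 0 ≤ l) : Measurable (Z l) := (measurable_phi hl).const_mul _

theorem le_Z (ω : Env) {l : ℝ} (hl : 0 < l) (hl1 : l ≤ 1) : (ω 0 : ℝ) ≤ Z l ω := by
  have := mul_le_phi ω hl.le hl1
  rw [phi_eq_mul_Z ω hl] at this
  exact le_of_mul_le_mul_left this hl

theorem Z_pos (ω : Env) {l : ℝ} (hl : 0 < l) (hl1 : l ≤ 1) : 0 < Z l ω :=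
  (ω 0).2.1.trans_le (le_Z ω hl hl1)

theorem Z_le_one (ω : Env) {l : ℝ} (hl : 0 < l) (hl1 : l ≤ 1) : Z l ω ≤ 1 := by
  have := phi_le ω hl.le hl1
  rw [phi_eq_mul_Z ω hl] at this
  nlinarith

theorem moebius_denom_pos {z w u : ℝ} (hz0 : 0 ≤ z) (hz1 : z ≤ 1) (hw : w ∈ Set.Ioo (0 : ℝ) 1)
    (hu1 : u ≤ 1) : 0 < 1 - z * (1 - w) * u := by
  have h1 : z * (1 - w) ≤ 1 - w := mul_le_of_le_one_left (by linarith [hw.2]) hz1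
  have h2 : z * (1 - w) * u ≤ z * (1 - w) :=
    mul_le_of_le_one_right (mul_nonneg hz0 (by linarith [hw.2])) hu1
  linarith [hw.1]

theorem Z_eq (ω : Env) {l : ℝ} (hl : 0 < l) (hl1 : l ≤ 1) :
    Z l ω = ω 0 / (1 - l ^ 2 * (1 - ω 0) * Z l (shift (-1) ω)) := by
  have h1 := moebius_denom_pos (sq_nonneg l) (pow_le_one₀ hl.le hl1) (ω 0).2
    (Z_le_one (shift (-1) ω) hl hl1)
  rw [eq_div_iff h1.ne']
  have h := phi_rec ω hl.le hl1
  rw [phi_eq_mul_Z ω hl, phi_eq_mul_Z _ hl] at h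
  have h2 : l * (Z l ω * (1 - l ^ 2 * (1 - ω 0) * Z l (shift (-1) ω))) = l * ω 0 := by
    linear_combination h
  exact mul_left_cancel₀ hl.ne' h2

theorem tendsto_Z_zero (ω : Env) : Tendsto (fun l => Z l ω) (𝓝[>] 0) (𝓝 (ω 0 : ℝ)) := by
  have hev : ∀ᶠ l : ℝ in 𝓝[>] 0, l ∈ Set.Ioo (0 : ℝ) 1 := Ioo_mem_nhdsGT zero_lt_one
  have h0 : Tendsto (fun l : ℝ => l ^ 2) (𝓝[>] 0) (𝓝 0) := by
    have : Tendsto (fun l : ℝ => l ^ 2) (𝓝 0) (𝓝 (0 ^ 2)) := (continuous_pow 2).tendsto 0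
    rw [zero_pow two_ne_zero] at this
    exact this.mono_left nhdsWithin_le_nhds
  have h1 : Tendsto (fun l => l ^ 2 * (1 - ω 0) * Z l (shift (-1) ω)) (𝓝[>] 0) (𝓝 0) := by
    refine squeeze_zero' ?_ ?_ h0
    · filter_upwards [hev] with l hl
      have := (Z_pos (shift (-1) ω) hl.1 hl.2.le).le
      have := sub_nonneg.2 (ω 0).2.2.le
      positivity
    · filter_upwards [hev] with l hl
      have h2 := Z_le_one (shift (-1) ω) hl.1 hl.2.le
      have h3 := (Z_pos (shift (-1) ω) hl.1 hl.2.le).le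
      have h4 := (ω 0).2
      calc _ = l ^ 2 * ((1 - ω 0) * Z l (shift (-1) ω)) := by ring
        _ ≤ l ^ 2 := mul_le_of_le_one_right (sq_nonneg l) (by nlinarith [h4.1, h4.2])
  have h2 : Tendsto (fun l => (ω 0 : ℝ) / (1 - l ^ 2 * (1 - ω 0) * Z l (shift (-1) ω))) (𝓝[>] 0)
      (𝓝 ((ω 0 : ℝ) / (1 - 0))) :=
    tendsto_const_nhds.div (tendsto_const_nhds.sub h1) (by norm_num)
  rw [sub_zero, div_one] at h2
  refine h2.congr' ?_
  filter_upwards [hev] with l hl using (Z_eq ω hl.1 hl.2.le).symm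

/-! ### The law of `Z` -/

/-- The `N`-fold iteration of the recursion for `Z`, started from the value `v` at `-N`. -/
def iterZ (z : ℝ) : ℕ → Env → ℝ → ℝ
  | 0, _, v => v
  | N + 1, ω, v => ω 0 / (1 - z * (1 - ω 0) * iterZ z N (shift (-1) ω) v)

theorem measurable_iterZ (z : ℝ) (N : ℕ) :
    Measurable fun p : ℝ × Env => iterZ z N p.2 p.1 := by
  induction N with
  | zero => exact measurable_fst
  | succ N ih =>
    simp only [iterZ]
    have h1 : Measurable fun p : ℝ × Env => iterZ z N (shift (-1) p.2) p.1 :=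
      ih.comp (measurable_fst.prodMk ((measurable_shift _).comp measurable_snd))
    have h2 : Measurable fun p : ℝ × Env => (p.2 0 : ℝ) :=
      measurable_subtype_coe.comp ((measurable_pi_apply 0).comp measurable_snd)
    fun_prop

/-- Applied after a shift by `-1`, this shows that resampling the site `0` does not affect the inner
iterate. -/
theorem iterZ_congr (z : ℝ) (N : ℕ) : ∀ {ω ω' : Env} (v : ℝ), (∀ x ≤ 0, ω x = ω' x) →
    iterZ z N ω v = iterZ z N ω' v := by
  induction N with
  | zero => intros; rfl
  | succ N ih =>
    intro ω ω' v h
    simp only [iterZ]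
    rw [h 0 le_rfl, ih (ω := shift (-1) ω) (ω' := shift (-1) ω') v
      fun x hx => h (x + -1) (by linarith)]

theorem iterZ_mem {z : ℝ} (hz0 : 0 ≤ z) (hz1 : z ≤ 1) (N : ℕ) : ∀ (ω : Env) {v : ℝ},
    v ∈ Set.Icc (0 : ℝ) 1 → iterZ z N ω v ∈ Set.Icc (0 : ℝ) 1 := by
  induction N with
  | zero => intro ω v hv; exact hv
  | succ N ih =>
    intro ω v hv
    have h1 := ih (shift (-1) ω) hv
    have h2 := moebius_denom_pos hz0 hz1 (ω 0).2 h1.2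
    refine ⟨div_nonneg (ω 0).2.1.le h2.le, ?_⟩
    rw [iterZ, div_le_one h2]
    have h3 := (ω 0).2
    have h4 : z * (1 - ω 0) ≤ 1 - ω 0 := mul_le_of_le_one_left (by linarith [h3.2]) hz1
    have h5 : z * (1 - ω 0) * iterZ z N (shift (-1) ω) v ≤ z * (1 - ω 0) :=
      mul_le_of_le_one_right (mul_nonneg hz0 (by linarith [h3.2])) h1.2
    linarith

theorem Z_eq_iterZ {l : ℝ} (hl : 0 < l) (hl1 : l ≤ 1) (N : ℕ) :
    ∀ ω : Env, Z l ω = iterZ (l ^ 2) N ω (Z l (shift (-N) ω)) := by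
  induction N with
  | zero => intro ω; simp [iterZ, shift_zero]
  | succ N ih =>
    intro ω
    rw [iterZ, Z_eq ω hl hl1, ih (shift (-1) ω), shift_shift,
      show -(N : ℤ) + -1 = -((N + 1 : ℕ) : ℤ) by push_cast; ring]

/-- Each use of the recursion gains a factor `l` and looks one index to the right, so the range of
valid `j` shrinks by one per step. On the left the boundary value `0` costs nothing. -/
theorem abs_le_pow_of_max_principle {l : ℝ} (hl : 0 ≤ l) {N : ℕ} {d : ℕ → ℝ} {p : ℕ → ℝ}
    (hp : ∀ j, p j ∈ Set.Icc (0 : ℝ) 1) (h0 : d 0 = 0) (h1 : ∀ j ≤ N + 1, |d j| ≤ 1)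
    (h : ∀ j < N, d (j + 1) = l * p j * d j + l * (1 - p j) * d (j + 2)) :
    ∀ m ≤ N, ∀ j ≤ N + 1 - m, |d j| ≤ l ^ m := by
  intro m
  induction m with
  | zero => intro _ j hj; simpa using h1 j (by omega)
  | succ m ih =>
    intro hm j hj
    cases j with
    | zero => rw [h0, abs_zero]; positivity
    | succ j =>
      have ha := ih (by omega) j (by omega)
      have hb := ih (by omega) (j + 2) (by omega)
      have hpj := hp j
      have h2 : 0 ≤ 1 - p j := sub_nonneg.2 hpj.2
      rw [h j (by omega)]
      calc _ ≤ |l * p j * d j| + |l * (1 - p j) * d (j + 2)| := abs_add_le _ _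
        _ = l * p j * |d j| + l * (1 - p j) * |d (j + 2)| := by
            rw [abs_mul (l * p j), abs_mul (l * (1 - p j)), abs_of_nonneg (mul_nonneg hl hpj.1),
              abs_of_nonneg (mul_nonneg hl h2)]
        _ ≤ l * p j * l ^ m + l * (1 - p j) * l ^ m := by
            have := hpj.1
            gcongr
        _ = _ := by ring

/-- A single Möbius map need not be a contraction, so the recursion is linearised. The products `q v
j` play the role of the generating function of the passage from `1 - j` to `1`: they satisfy the
first step equation, which is linear, with `q v 0 = 1`. The difference of two solutions vanishes at
`0`, is at most `1`, and so is at most `l ^ N` at `j = 1`, where it equals `l` times the difference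
of the iterates. -/
theorem abs_iterZ_sub_le {l : ℝ} (hl : 0 < l) (hl1 : l ≤ 1) (N : ℕ) (ω : Env) {u v : ℝ}
    (hu : u ∈ Set.Icc (0 : ℝ) 1) (hv : v ∈ Set.Icc (0 : ℝ) 1) :
    |iterZ (l ^ 2) N ω u - iterZ (l ^ 2) N ω v| ≤ l ^ N / l := by
  set f : ℝ → ℕ → ℝ := fun v j => l * iterZ (l ^ 2) (N - j) (shift (-j) ω) v with hf
  set q : ℝ → ℕ → ℝ := fun v j => ∏ i ∈ Finset.range j, f v i with hq
  have hz1 : l ^ 2 ≤ 1 := pow_le_one₀ hl.le hl1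
  have hfm : ∀ v ∈ Set.Icc (0 : ℝ) 1, ∀ j, f v j ∈ Set.Icc (0 : ℝ) 1 := by
    intro v hv j
    have h := iterZ_mem (sq_nonneg l) hz1 (N - j) (shift (-j) ω) hv
    exact ⟨mul_nonneg hl.le h.1, mul_le_one₀ hl1 h.1 h.2⟩
  have hqm : ∀ v ∈ Set.Icc (0 : ℝ) 1, ∀ j, q v j ∈ Set.Icc (0 : ℝ) 1 := fun v hv j =>
    ⟨Finset.prod_nonneg fun i _ => (hfm v hv i).1,
      Finset.prod_le_one (fun i _ => (hfm v hv i).1) fun i _ => (hfm v hv i).2⟩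
  have hrec : ∀ v ∈ Set.Icc (0 : ℝ) 1, ∀ j < N, q v (j + 1) = l * (ω (-j) : ℝ) * q v j
      + l * (1 - (ω (-j) : ℝ)) * q v (j + 2) := by
    intro v hv j hj
    have h1 := iterZ_mem (sq_nonneg l) hz1 (N - (j + 1)) (shift (-(j + 1 : ℕ)) ω) hv
    have h2 := moebius_denom_pos (sq_nonneg l) hz1 (ω (-j)).2 h1.2
    have e1 : f v j = l * ((ω (-j) : ℝ) / (1 - l ^ 2 * (1 - (ω (-j) : ℝ)) *
        iterZ (l ^ 2) (N - (j + 1)) (shift (-(j + 1 : ℕ)) ω) v)) := by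
      simp only [hf]
      rw [show N - j = (N - (j + 1)) + 1 by omega, iterZ, shift_shift,
        show -1 + -(j : ℤ) = -((j + 1 : ℕ) : ℤ) by push_cast; ring]
      simp only [shift, zero_add]
    have e2 : f v j = l * (ω (-j) : ℝ) + l * (1 - (ω (-j) : ℝ)) * f v (j + 1) * f v j := by
      rw [e1]
      simp only [hf]
      field_simp
      ring
    simp only [hq, Finset.prod_range_succ]
    linear_combination (∏ i ∈ Finset.range j, f v i) * e2
  have key := abs_le_pow_of_max_principle hl.le (N := N) (d := fun j => q u j - q v j)
    (p := fun j => (ω (-j) : ℝ)) (fun j => ⟨(ω (-j)).2.1.le, (ω (-j)).2.2.le⟩) (by simp [hq])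
    (fun j _ => by
      have h1 := hqm u hu j
      have h2 := hqm v hv j
      rw [abs_le]
      constructor <;> linarith [h1.1, h1.2, h2.1, h2.2])
    (fun j hj => by
      rw [hrec u hu j hj, hrec v hv j hj]
      ring) N le_rfl 1 (by omega)
  have e : q u 1 - q v 1 = l * (iterZ (l ^ 2) N ω u - iterZ (l ^ 2) N ω v) := by
    simp [hq, hf, shift_zero, mul_sub]
  rw [e, abs_mul, abs_of_pos hl] at key
  rw [le_div_iff₀ hl, mul_comm]
  exact key

/-- The outermost Möbius map uses the site `0`, which can be resampled independently of the inner
iterate; the inner iterate has the law of `iterZ z N` by shift invariance. Each induction step then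
uses stationarity once. -/
theorem lintegral_iterZ {α β z : ℝ} (hα : 0 < α) (hβ : 0 < β) (hz0 : 0 ≤ z) (hz1 : z < 1)
    (N : ℕ) : ∀ {f : ℝ → ℝ≥0∞}, Measurable f →
    ∫⁻ v, ∫⁻ ω, f (iterZ z N ω v) ∂(envLaw α β hα hβ) ∂(hypLaw α β z)
      = ∫⁻ u, f u ∂(hypLaw α β z) := by
  have := isProbabilityMeasure_siteLaw hα hβ
  have := isProbabilityMeasure_envLaw hα hβ
  induction N with
  | zero => intro f hf; simp [iterZ]
  | succ N ih =>
    intro f hf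
    set g : ℝ → ℝ≥0∞ := fun v =>
      ∫⁻ w : Set.Ioo (0 : ℝ) 1, f (w / (1 - z * (1 - w) * v)) ∂(siteLaw α β) with hg
    have hgm : Measurable g := by
      refine Measurable.lintegral_prod_right' (f := fun p : ℝ × Set.Ioo (0 : ℝ) 1 =>
        f (p.2 / (1 - z * (1 - p.2) * p.1))) (hf.comp ?_)
      fun_prop
    rw [← lintegral_hypLaw_stationary hα hβ hz0 hz1 hf, ← ih hgm]
    refine lintegral_congr fun v => ?_
    have hiter : ∀ n, Measurable fun ω => iterZ z n ω v := fun n =>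
      (measurable_iterZ z n).comp (measurable_const.prodMk measurable_id)
    rw [← (measurePreserving_update hα hβ).lintegral_comp
        (f := fun ω => f (iterZ z (N + 1) ω v)) (hf.comp (hiter (N + 1))),
      ← (measurePreserving_shift hα hβ (-1)).lintegral_comp
        (f := fun ω => g (iterZ z N ω v)) (hgm.comp (hiter N)),
      lintegral_prod_symm' (fun p : Set.Ioo (0 : ℝ) 1 × Env =>
        f (iterZ z (N + 1) (Function.update p.2 0 p.1) v)) ((hf.comp (hiter (N + 1))).comp measurable_update_env)]
    refine lintegral_congr fun ω => lintegral_congr fun w => ?_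
    simp only [iterZ, Function.update_self]
    rw [iterZ_congr z N v (ω := shift (-1) (Function.update ω 0 w)) (ω' := shift (-1) ω)]
    intro x hx
    exact Function.update_of_ne (by linarith) _ _

/-- With an independent hypergeometric initial value every iterate has the hypergeometric law, and
the iterates converge pointwise to `Z l`, whatever the initial value in `[0, 1]`. Bounded continuous
test functions identify the limit law. -/
theorem hasLaw_Z {α β : ℝ} (hα : 0 < α) (hβ : 0 < β) {l : ℝ} (hl : 0 < l) (hl1 : l < 1) :
    HasLaw (Z l) (hypLaw α β (l ^ 2)) (envLaw α β hα hβ) := by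
  have hz0 := sq_nonneg l
  have hz1 : l ^ 2 < 1 := pow_lt_one₀ hl.le hl1 two_ne_zero
  have := isProbabilityMeasure_envLaw hα hβ
  have := isProbabilityMeasure_hypLaw hα hβ hz0 hz1
  refine ⟨(measurable_Z hl.le).aemeasurable, ?_⟩
  have : IsProbabilityMeasure ((envLaw α β hα hβ).map (Z l)) :=
    Measure.isProbabilityMeasure_map (measurable_Z hl.le).aemeasurable
  refine ext_of_forall_lintegral_eq_of_IsFiniteMeasure fun f => ?_
  have hfm : Measurable fun u => (f u : ℝ≥0∞) := f.continuous.measurable.coe_nnreal_ennreal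
  rw [lintegral_map hfm (measurable_Z hl.le)]
  have h1 : ∀ N, ∫⁻ p, (f (iterZ (l ^ 2) N p.2 p.1) : ℝ≥0∞)
      ∂((hypLaw α β (l ^ 2)).prod (envLaw α β hα hβ)) = ∫⁻ u, f u ∂(hypLaw α β (l ^ 2)) := by
    intro N
    rw [lintegral_prod (fun p : ℝ × Env => (f (iterZ (l ^ 2) N p.2 p.1) : ℝ≥0∞))
      (hfm.comp (measurable_iterZ _ N)).aemeasurable]
    exact lintegral_iterZ hα hβ hz0 hz1 N hfm
  have h2 : Tendsto (fun N => ∫⁻ p, (f (iterZ (l ^ 2) N p.2 p.1) : ℝ≥0∞)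
      ∂((hypLaw α β (l ^ 2)).prod (envLaw α β hα hβ))) atTop
      (𝓝 (∫⁻ p, (f (Z l p.2) : ℝ≥0∞) ∂((hypLaw α β (l ^ 2)).prod (envLaw α β hα hβ)))) := by
    refine tendsto_lintegral_of_dominated_convergence (fun _ => (nndist f 0 : ℝ≥0∞))
      (fun N => hfm.comp (measurable_iterZ _ N)) (fun N => Eventually.of_forall fun p => ?_)
      (by simp) ?_
    · exact ENNReal.coe_le_coe.2 (BoundedContinuousFunction.NNReal.upper_bound f _)
    · have hae : ∀ᵐ p ∂((hypLaw α β (l ^ 2)).prod (envLaw α β hα hβ)), p.1 ∈ Set.Ioo (0 : ℝ) 1 :=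
        Measure.quasiMeasurePreserving_fst.ae (ae_hypLaw_mem α β (l ^ 2))
      filter_upwards [hae] with p hp
      have hlim : Tendsto (fun N => iterZ (l ^ 2) N p.2 p.1) atTop (𝓝 (Z l p.2)) := by
        rw [tendsto_iff_norm_sub_tendsto_zero]
        have h0 : Tendsto (fun N : ℕ => l ^ N / l) atTop (𝓝 (0 / l)) :=
          (tendsto_pow_atTop_nhds_zero_of_lt_one hl.le hl1).div_const l
        rw [zero_div] at h0
        refine squeeze_zero (fun _ => norm_nonneg _) (fun N => ?_) h0
        rw [Real.norm_eq_abs, Z_eq_iterZ hl hl1.le N p.2]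
        exact abs_iterZ_sub_le hl hl1.le N p.2 ⟨hp.1.le, hp.2.le⟩
          ⟨(Z_pos _ hl hl1.le).le, Z_le_one _ hl hl1.le⟩
      exact ENNReal.tendsto_coe.2 ((f.continuous.tendsto _).comp hlim)
  simp_rw [h1] at h2
  have h3 := tendsto_nhds_unique h2 tendsto_const_nhds
  rw [← h3, lintegral_prod (fun p : ℝ × Env => (f (Z l p.2) : ℝ≥0∞))
    (hfm.comp ((measurable_Z hl.le).comp measurable_snd)).aemeasurable]
  simp

theorem hasLaw_env_zero {α β : ℝ} (hα : 0 < α) (hβ : 0 < β) :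
    HasLaw (fun ω : Env => (ω 0 : ℝ)) (hypLaw α β 0) (envLaw α β hα hβ) := by
  have h := measurePreserving_eval_env hα hβ 0
  refine ⟨(measurable_subtype_coe.comp h.measurable).aemeasurable, ?_⟩
  rw [hypLaw_zero hα hβ, ← h.map_eq, Measure.map_map measurable_subtype_coe h.measurable]
  rfl

/-! ### The hypergeometric law at the endpoint `1` -/

theorem integral_one_sub_rpow {β z : ℝ} (hβ : 0 < β) (hz1 : z < 1) :
    ∫ u in Set.Ioo z 1, (1 - u) ^ (β - 1) = (1 - z) ^ β / β := by
  rw [← integral_Ioc_eq_integral_Ioo, ← intervalIntegral.integral_of_le hz1.le,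
    intervalIntegral.integral_comp_sub_left (fun x => x ^ (β - 1)) 1, sub_self,
    integral_rpow (Or.inl (by linarith)), sub_add_cancel, Real.zero_rpow hβ.ne', sub_zero]

theorem integrableOn_one_sub_rpow {β z : ℝ} (hβ : 0 < β) (hz0 : 0 ≤ z) :
    IntegrableOn (fun u : ℝ => (1 - u) ^ (β - 1)) (Set.Ioo z 1) := by
  have h := (integrableOn_beta one_pos hβ).mono_set (Set.Ioo_subset_Ioo_left hz0 :
    Set.Ioo z 1 ⊆ Set.Ioo 0 1)
  simpa using h

/-- Only `u ∈ (z, 1)` is kept, where `1 - u * z ≤ 1 - z ^ 2 ≤ 2 * (1 - z)` and `u ^ (α - 1) ≥ u ^ α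
≥ (1 / 2) ^ α`. The resulting power `(1 - z) ^ (β - α)` blows up as `z ↑ 1` exactly because `β < α`.
-/
theorem le_eulerInt {α β z : ℝ} (hα : 0 < α) (hβ : 0 < β) (hz0 : 1 / 2 ≤ z) (hz1 : z < 1) :
    (1 / 2) ^ α * 2 ^ (-α) / β * (1 - z) ^ (β - α) ≤ eulerInt α β z := by
  have hz : 0 < 1 - z := sub_pos.2 hz1
  have hz0' : 0 ≤ z := by linarith
  have hint := integrableOn_euler hα hβ hz0' hz1
  calc _ = ∫ u in Set.Ioo z 1, (1 / 2) ^ α * (2 * (1 - z)) ^ (-α) * (1 - u) ^ (β - 1) := by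
        rw [integral_const_mul, integral_one_sub_rpow hβ hz1,
          Real.mul_rpow two_pos.le hz.le, sub_eq_add_neg β α, Real.rpow_add hz]
        ring
    _ ≤ ∫ u in Set.Ioo z 1, u ^ (α - 1) * (1 - u) ^ (β - 1) * (1 - u * z) ^ (-α) := by
        refine setIntegral_mono_on ((integrableOn_one_sub_rpow hβ hz0').const_mul _)
          (hint.mono_set (Set.Ioo_subset_Ioo_left hz0')) measurableSet_Ioo fun u hu => ?_
        have hu0 : 0 < u := by linarith [hu.1]
        have h1 : 0 < 1 - u := sub_pos.2 hu.2
        have h2 : 0 < 1 - u * z := by nlinarith [hu.2]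
        have h3 : (1 / 2 : ℝ) ^ α ≤ u ^ (α - 1) := by
          calc (1 / 2 : ℝ) ^ α ≤ u ^ α :=
                Real.rpow_le_rpow (by norm_num) (by linarith [hu.1]) hα.le
            _ ≤ u ^ (α - 1) := Real.rpow_le_rpow_of_exponent_ge hu0 hu.2.le (by linarith)
        have h4 : (2 * (1 - z)) ^ (-α) ≤ (1 - u * z) ^ (-α) :=
          Real.rpow_le_rpow_of_nonpos h2 (by nlinarith [hu.1, hu.2]) (by linarith)
        calc _ ≤ u ^ (α - 1) * (1 - u * z) ^ (-α) * (1 - u) ^ (β - 1) := by gcongr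
          _ = _ := by ring
    _ ≤ _ := by
        refine setIntegral_mono_set hint ?_ (Set.Ioo_subset_Ioo_left hz0').eventuallyLE
        filter_upwards [ae_restrict_mem measurableSet_Ioo] with u hu
        have h1 : 0 < 1 - u := sub_pos.2 hu.2
        have h2 : 0 < 1 - u * z := by nlinarith [hu.2, hu.1]
        have h3 := hu.1
        simp only [Pi.zero_apply]
        positivity

theorem tendsto_eulerInt {α β : ℝ} (hβ : 0 < β) (hαβ : β < α) :
    Tendsto (eulerInt α β) (𝓝[<] 1) atTop := by
  have hα := hβ.trans hαβ
  have h1 : Tendsto (fun z : ℝ => 1 - z) (𝓝[<] 1) (𝓝[>] 0) := by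
    refine tendsto_nhdsWithin_iff.2 ⟨?_, ?_⟩
    · have : Tendsto (fun z : ℝ => 1 - z) (𝓝 1) (𝓝 (1 - 1)) := (by fun_prop : Continuous
        fun z : ℝ => 1 - z).tendsto 1
      rw [sub_self] at this
      exact this.mono_left nhdsWithin_le_nhds
    · filter_upwards [self_mem_nhdsWithin] with z hz using sub_pos.2 (Set.mem_Iio.1 hz)
  have h2 := ((tendsto_rpow_neg_nhdsGT_zero (sub_neg.2 hαβ)).comp h1).const_mul_atTop
    (show 0 < (1 / 2 : ℝ) ^ α * 2 ^ (-α) / β by positivity)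
  refine tendsto_atTop_mono' _ ?_ h2
  filter_upwards [Ico_mem_nhdsLT (show (1 / 2 : ℝ) < 1 by norm_num)] with z hz
  exact le_eulerInt hα hβ hz.1 hz.2

/-- For `u ≤ 1 - δ` one has `1 - u * z ≥ δ`, so the unnormalised mass stays bounded while the
normalising integral diverges. -/
theorem hypLaw_Iic_le {α β z δ : ℝ} (hα : 0 < α) (hβ : 0 < β) (hz0 : 0 ≤ z) (hz1 : z < 1)
    (hδ : 0 < δ) : (hypLaw α β z).real (Set.Iic (1 - δ))
      ≤ (eulerInt α β z)⁻¹ * (δ ^ (-α) * beta α β) := by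
  have hpos := eulerInt_pos hα hβ hz0 hz1
  have hb := beta_pos hα hβ
  refine ENNReal.toReal_le_of_le_ofReal (by positivity) ?_
  rw [← lintegral_indicator_one measurableSet_Iic,
    lintegral_hypLaw _ _ _ (measurable_one.indicator measurableSet_Iic)]
  calc _ ≤ ∫⁻ u in Set.Ioo (0 : ℝ) 1, ENNReal.ofReal ((eulerInt α β z)⁻¹ * δ ^ (-α)) *
        ENNReal.ofReal (u ^ (α - 1) * (1 - u) ^ (β - 1)) := by
        refine setLIntegral_mono' measurableSet_Ioo fun u hu => ?_
        by_cases hu2 : u ∈ Set.Iic (1 - δ)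
        · have h1 : 0 < 1 - u := sub_pos.2 hu.2
          have h2 : δ ≤ 1 - u * z := by nlinarith [hu.1, hu.2, hu2.out]
          have h3 := hu.1
          rw [Set.indicator_of_mem hu2, Pi.one_apply, mul_one, hypDensity_eq hα hβ,
            ← ENNReal.ofReal_mul (by positivity)]
          refine ENNReal.ofReal_le_ofReal ?_
          have h4 : (1 - u * z) ^ (-α) ≤ δ ^ (-α) :=
            Real.rpow_le_rpow_of_nonpos hδ h2 (by linarith)
          calc _ ≤ (eulerInt α β z)⁻¹ * (u ^ (α - 1) * (1 - u) ^ (β - 1) * δ ^ (-α)) := by gcongr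
            _ = _ := by ring
        · rw [Set.indicator_of_notMem hu2, mul_zero]
          exact zero_le
    _ = _ := by
        rw [lintegral_const_mul' _ _ ENNReal.ofReal_ne_top, lintegral_beta hα hβ,
          ← ENNReal.ofReal_mul (by positivity), mul_assoc]

/-- The hypergeometric law `h⁽¹⁾(α, β; z)` converges weakly to `δ₁` as `z ↑ 1`. -/
theorem tendsto_hypLaw {α β : ℝ} (hβ : 0 < β) (hαβ : β < α) (f : BoundedContinuousFunction ℝ ℝ) :
    Tendsto (fun z => ∫ u, f u ∂(hypLaw α β z)) (𝓝[<] 1) (𝓝 (f 1)) := by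
  have hα := hβ.trans hαβ
  rw [Metric.tendsto_nhds]
  intro ε hε
  obtain ⟨δ, hδ, hfδ⟩ := Metric.continuousAt_iff.1 (f.continuous.continuousAt (x := 1)) (ε / 2)
    (half_pos hε)
  have hlim : Tendsto (fun z => 2 * ‖f‖ * ((eulerInt α β z)⁻¹ * (δ ^ (-α) * beta α β))) (𝓝[<] 1)
      (𝓝 (2 * ‖f‖ * (0 * (δ ^ (-α) * beta α β)))) :=
    ((tendsto_inv_atTop_zero.comp (tendsto_eulerInt hβ hαβ)).mul_const _).const_mul _
  rw [zero_mul, mul_zero] at hlim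
  filter_upwards [hlim.eventually_lt_const (half_pos hε),
    Ico_mem_nhdsLT (zero_lt_one (α := ℝ))] with z hz hz01
  have := isProbabilityMeasure_hypLaw hα hβ hz01.1 hz01.2
  have hint : Integrable f (hypLaw α β z) := f.integrable _
  have e : ∫ u, f u ∂(hypLaw α β z) - f 1 = ∫ u, (f u - f 1) ∂(hypLaw α β z) := by
    rw [integral_sub hint (integrable_const _), integral_const]
    simp
  have hind : Integrable ((Set.Iic (1 - δ)).indicator fun _ => 2 * ‖f‖) (hypLaw α β z) :=
    (integrable_const _).indicator measurableSet_Iic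
  have hbd : Integrable (fun u => ε / 2 + (Set.Iic (1 - δ)).indicator (fun _ => 2 * ‖f‖) u)
      (hypLaw α β z) := (integrable_const _).add hind
  rw [Real.dist_eq, e, ← Real.norm_eq_abs]
  calc ‖∫ u, (f u - f 1) ∂(hypLaw α β z)‖
      ≤ ∫ u, (ε / 2 + (Set.Iic (1 - δ)).indicator (fun _ => 2 * ‖f‖) u) ∂(hypLaw α β z) := by
        refine norm_integral_le_of_norm_le hbd ?_
        filter_upwards [ae_hypLaw_mem α β z] with u hu
        by_cases hu2 : u ∈ Set.Iic (1 - δ)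
        · rw [Set.indicator_of_mem hu2]
          have h1 := f.norm_coe_le_norm u
          have h2 := f.norm_coe_le_norm 1
          have h3 := norm_sub_le (f u) (f 1)
          linarith
        · rw [Set.indicator_of_notMem hu2, add_zero]
          have h1 : dist u 1 < δ := by
            rw [Real.dist_eq, abs_sub_comm, abs_of_pos (sub_pos.2 hu.2)]
            have := not_le.1 fun h => hu2 (Set.mem_Iic.2 h)
            linarith
          exact (hfδ h1).le
    _ = ε / 2 + 2 * ‖f‖ * (hypLaw α β z).real (Set.Iic (1 - δ)) := by
        rw [integral_add (integrable_const _) hind,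
          integral_indicator_const _ measurableSet_Iic]
        simp [mul_comm]
    _ ≤ ε / 2 + 2 * ‖f‖ * ((eulerInt α β z)⁻¹ * (δ ^ (-α) * beta α β)) := by
        gcongr
        exact hypLaw_Iic_le hα hβ hz01.1 hz01.2 hδ
    _ < ε := by linarith

/-! ### Almost sure finiteness of the first passage times. -/

theorem phi_mono (ω : Env) {l l' : ℝ} (hl : 0 ≤ l) (h : l ≤ l') (h1 : l' ≤ 1) :
    phi ω l ≤ phi ω l' := by
  rw [phi_eq ω hl, phi_eq ω (hl.trans h)]
  exact ENNReal.toReal_mono (passGF_ofReal_ne_top ω h1)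
    (passGF_mono ω (ENNReal.ofReal_le_ofReal h))

theorem integrable_phi {α β : ℝ} (hα : 0 < α) (hβ : 0 < β) {l : ℝ} (hl : 0 ≤ l) (hl1 : l ≤ 1) :
    Integrable (fun ω => phi ω l) (envLaw α β hα hβ) := by
  have := isProbabilityMeasure_envLaw hα hβ
  refine Integrable.of_bound (measurable_phi hl).aestronglyMeasurable 1
    (Eventually.of_forall fun ω => ?_)
  rw [Real.norm_of_nonneg (phi_nonneg ω hl)]
  exact (phi_le ω hl hl1).trans hl1

/-- Since `φ(ω, 1) ≥ φ(ω, l) = l * Z l ω` and the law of `Z l` tends to `δ₁` as `l ↑ 1`, the mean of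
`φ(ω, 1)` is at least `1`; but `φ(ω, 1) ≤ 1`. -/
theorem ae_phi_one {α β : ℝ} (hβ : 0 < β) (hαβ : β < α) :
    ∀ᵐ ω ∂(envLaw α β (hβ.trans hαβ) hβ), phi ω 1 = 1 := by
  have hα := hβ.trans hαβ
  have := isProbabilityMeasure_envLaw hα hβ
  -- Clamping to `[0, 1]` makes the identity a bounded test function without changing the values of
  -- `Z`.
  let c : BoundedContinuousFunction ℝ ℝ := BoundedContinuousFunction.ofNormedAddCommGroup
    (fun u : ℝ => max 0 (min u 1)) (by fun_prop) 1 fun u => by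
      rw [Real.norm_of_nonneg (le_max_left _ _)]
      exact max_le zero_le_one (min_le_right _ _)
  have hc : ∀ u ∈ Set.Icc (0 : ℝ) 1, c u = u := fun u hu => by
    change max 0 (min u 1) = u
    rw [min_eq_left hu.2, max_eq_right hu.1]
  have h2 : Tendsto (fun l : ℝ => l ^ 2) (𝓝[<] 1) (𝓝[<] 1) := by
    refine tendsto_nhdsWithin_iff.2 ⟨?_, ?_⟩
    · have : Tendsto (fun l : ℝ => l ^ 2) (𝓝 1) (𝓝 (1 ^ 2)) := (continuous_pow 2).tendsto 1
      rw [one_pow] at this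
      exact this.mono_left nhdsWithin_le_nhds
    · filter_upwards [Ioo_mem_nhdsLT (zero_lt_one (α := ℝ))] with l hl
      exact pow_lt_one₀ hl.1.le hl.2 two_ne_zero
  have h3 : Tendsto (fun l : ℝ => l * ∫ u, c u ∂(hypLaw α β (l ^ 2))) (𝓝[<] 1) (𝓝 (1 * c 1)) :=
    (tendsto_id.mono_left nhdsWithin_le_nhds).mul ((tendsto_hypLaw hβ hαβ c).comp h2)
  rw [hc 1 (by simp), mul_one] at h3
  have h4 : 1 ≤ ∫ ω, phi ω 1 ∂(envLaw α β hα hβ) := by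
    refine le_of_tendsto h3 ?_
    filter_upwards [Ioo_mem_nhdsLT (zero_lt_one (α := ℝ))] with l hl
    rw [← (hasLaw_Z hα hβ hl.1 hl.2).integral_comp c.continuous.measurable.aestronglyMeasurable,
      ← integral_const_mul]
    refine integral_mono_of_nonneg ?_ (integrable_phi hα hβ zero_le_one le_rfl) ?_
    · filter_upwards with ω
      exact mul_nonneg hl.1.le (le_max_left _ _)
    · filter_upwards with ω
      rw [Function.comp, hc _ ⟨(Z_pos ω hl.1 hl.2.le).le, Z_le_one ω hl.1 hl.2.le⟩,
        ← phi_eq_mul_Z ω hl.1]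
      exact phi_mono ω hl.1.le hl.2.le le_rfl
  have hint := integrable_phi hα hβ zero_le_one (le_refl (1 : ℝ))
  have h5 : ∫ ω, (1 - phi ω 1) ∂(envLaw α β hα hβ) = 0 := by
    refine le_antisymm ?_ (integral_nonneg fun ω => sub_nonneg.2 (phi_le ω zero_le_one le_rfl))
    rw [integral_sub (integrable_const _) hint]
    simpa using h4
  rw [integral_eq_zero_iff_of_nonneg (fun ω => sub_nonneg.2 (phi_le ω zero_le_one le_rfl))
    ((integrable_const _).sub hint)] at h5
  filter_upwards [h5] with ω hω
  simp only [Pi.zero_apply] at hω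
  linarith

theorem ae_forall_passGF_one {α β : ℝ} (hβ : 0 < β) (hαβ : β < α) :
    ∀ᵐ ω ∂(envLaw α β (hβ.trans hαβ) hβ), ∀ i : ℤ, passGF (shift i ω) 1 = 1 := by
  rw [ae_all_iff]
  intro i
  refine (measurePreserving_shift (hβ.trans hαβ) hβ i).quasiMeasurePreserving.ae
    (p := fun ω => passGF ω 1 = 1) ?_
  filter_upwards [ae_phi_one hβ hαβ] with ω hω
  rw [phi_eq ω zero_le_one, ENNReal.ofReal_one, ENNReal.toReal_eq_one_iff] at hω
  exact hω

/-! ### The expectation of `log φ` -/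

theorem integrable_log_env {α β : ℝ} (hα : 0 < α) (hβ : 0 < β) (x : ℤ) :
    Integrable (fun ω : Env => Real.log (ω x)) (envLaw α β hα hβ) :=
  (measurePreserving_eval_env hα hβ x).integrable_comp_of_integrable (integrable_log_siteLaw hα hβ)

theorem integrable_log_one_sub_env {α β : ℝ} (hα : 0 < α) (hβ : 0 < β) (x : ℤ) :
    Integrable (fun ω : Env => Real.log (1 - ω x)) (envLaw α β hα hβ) :=
  (measurePreserving_eval_env hα hβ x).integrable_comp_of_integrable
    (integrable_log_one_sub_siteLaw hα hβ)

/-- Follows from `ω 0 ≤ Z ≤ 1`. The bound is integrable and independent of `l`, and dominates all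
later limits of `log φ`. -/
theorem abs_log_Z_le (ω : Env) {l : ℝ} (hl : 0 < l) (hl1 : l ≤ 1) :
    |Real.log (Z l ω)| ≤ |Real.log (ω 0)| := by
  rw [abs_of_nonpos (Real.log_nonpos (Z_pos ω hl hl1).le (Z_le_one ω hl hl1)),
    abs_of_nonpos (Real.log_nonpos (ω 0).2.1.le (ω 0).2.2.le), neg_le_neg_iff]
  exact Real.log_le_log (ω 0).2.1 (le_Z ω hl hl1)

theorem integrable_log_Z {α β : ℝ} (hα : 0 < α) (hβ : 0 < β) {l : ℝ} (hl : 0 < l) (hl1 : l ≤ 1) :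
    Integrable (fun ω => Real.log (Z l ω)) (envLaw α β hα hβ) := by
  refine Integrable.mono (integrable_log_env hα hβ 0)
    (Real.measurable_log.comp (measurable_Z hl.le)).aestronglyMeasurable
    (Eventually.of_forall fun ω => ?_)
  exact abs_log_Z_le ω hl hl1

theorem log_phi_eq (ω : Env) {l : ℝ} (hl : 0 < l) (hl1 : l ≤ 1) :
    Real.log (phi ω l) = Real.log l + Real.log (Z l ω) := by
  rw [phi_eq_mul_Z ω hl, Real.log_mul hl.ne' (Z_pos ω hl hl1).ne']

theorem integrable_log_phi {α β : ℝ} (hα : 0 < α) (hβ : 0 < β) {l : ℝ} (hl : 0 < l)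
    (hl1 : l ≤ 1) : Integrable (fun ω => Real.log (phi ω l)) (envLaw α β hα hβ) := by
  have := isProbabilityMeasure_envLaw hα hβ
  simp_rw [log_phi_eq _ hl hl1]
  exact (integrable_const _).add (integrable_log_Z hα hβ hl hl1)

/-- The quenched Lyapunov exponent `E[log φ(ω, l)]`. -/
def lyap (α β : ℝ) (hα : 0 < α) (hβ : 0 < β) (l : ℝ) : ℝ :=
  ∫ ω, Real.log (phi ω l) ∂(envLaw α β hα hβ)

theorem lyap_eq {α β : ℝ} (hα : 0 < α) (hβ : 0 < β) {l : ℝ} (hl : 0 < l) (hl1 : l ≤ 1) :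
    lyap α β hα hβ l = Real.log l + ∫ ω, Real.log (Z l ω) ∂(envLaw α β hα hβ) := by
  have := isProbabilityMeasure_envLaw hα hβ
  rw [lyap]
  simp_rw [log_phi_eq _ hl hl1]
  rw [integral_add (integrable_const _) (integrable_log_Z hα hβ hl hl1)]
  simp

theorem integrable_log_hypDensity {α β : ℝ} (hα : 0 < α) (hβ : 0 < β) {l : ℝ} (hl : 0 < l)
    (hl1 : l < 1) :
    IntegrableOn (fun u => Real.log u * hypDensity α β (l ^ 2) u) (Set.Ioo 0 1) ∧
      ∫ ω, Real.log (Z l ω) ∂(envLaw α β hα hβ)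
        = ∫ u in Set.Ioo (0 : ℝ) 1, Real.log u * hypDensity α β (l ^ 2) u := by
  have hz1 : l ^ 2 < 1 := pow_lt_one₀ hl.le hl1 two_ne_zero
  have hlaw := hasLaw_Z hα hβ hl hl1
  have hm := (measurable_hypDensity α β (l ^ 2)).ennreal_ofReal
  have hfin : ∀ᵐ u ∂(volume.restrict (Set.Ioo (0 : ℝ) 1)),
      ENNReal.ofReal (hypDensity α β (l ^ 2) u) < ∞ :=
    Eventually.of_forall fun _ => ENNReal.ofReal_lt_top
  have hcongr : (fun u => (ENNReal.ofReal (hypDensity α β (l ^ 2) u)).toReal • Real.log u)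
      =ᵐ[volume.restrict (Set.Ioo (0 : ℝ) 1)] fun u => Real.log u * hypDensity α β (l ^ 2) u := by
    filter_upwards [ae_restrict_mem measurableSet_Ioo] with u hu
    rw [ENNReal.toReal_ofReal (hypDensity_nonneg hα hβ (sq_nonneg l) hz1 hu), smul_eq_mul, mul_comm]
  constructor
  · have h1 : Integrable Real.log (hypLaw α β (l ^ 2)) := by
      rw [← hlaw.map_eq, integrable_map_measure Real.measurable_log.aestronglyMeasurable
        hlaw.aemeasurable]
      exact integrable_log_Z hα hβ hl hl1.le
    rw [hypLaw, integrable_withDensity_iff_integrable_smul' hm hfin] at h1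
    exact h1.congr hcongr
  · have h1 := hlaw.integral_comp Real.measurable_log.aestronglyMeasurable
    rw [Function.comp_def] at h1
    rw [h1, hypLaw, integral_withDensity_eq_integral_toReal_smul hm hfin]
    exact integral_congr_ae hcongr

theorem lyap_eq_hypDensity {α β : ℝ} (hα : 0 < α) (hβ : 0 < β) {l : ℝ} (hl : 0 < l)
    (hl1 : l < 1) : lyap α β hα hβ l
      = Real.log l + ∫ u in (0 : ℝ)..1, Real.log u * hypDensity α β (l ^ 2) u := by
  rw [lyap_eq hα hβ hl hl1.le, (integrable_log_hypDensity hα hβ hl hl1).2,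
    intervalIntegral.integral_of_le zero_le_one, integral_Ioc_eq_integral_Ioo]

theorem lyap_one {α β : ℝ} (hβ : 0 < β) (hαβ : β < α) : lyap α β (hβ.trans hαβ) hβ 1 = 0 := by
  rw [lyap]
  refine integral_eq_zero_of_ae ?_
  filter_upwards [ae_phi_one hβ hαβ] with ω hω
  simp [hω]

theorem continuousOn_phi (ω : Env) : ContinuousOn (fun l => phi ω l) (Set.Icc 0 1) := by
  have h1 : ∀ n, passP ω n ≠ ∞ := fun n => by
    have h : passP ω n * 1 ^ n ≤ passGF ω 1 := ENNReal.le_tsum n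
    rw [one_pow, mul_one] at h
    exact ((h.trans (passGF_one_le ω)).trans_lt ENNReal.one_lt_top).ne
  have h2 : ContinuousOn (fun l : ℝ => ∑' n, (passP ω n).toReal * l ^ n) (Set.Icc 0 1) := by
    refine continuousOn_tsum (u := fun n => (passP ω n).toReal)
      (fun n => by fun_prop) (ENNReal.summable_toReal ?_) fun n l hl => ?_
    · have := ((passGF_one_le ω).trans_lt ENNReal.one_lt_top).ne
      simpa [passGF] using this
    · have h3 := pow_nonneg hl.1 n
      rw [Real.norm_of_nonneg (mul_nonneg ENNReal.toReal_nonneg h3)]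
      exact mul_le_of_le_one_right ENNReal.toReal_nonneg (pow_le_one₀ hl.1 hl.2)
  refine h2.congr fun l hl => ?_
  simp only []
  rw [phi_eq ω hl.1, passGF, ENNReal.tsum_toReal_eq fun n =>
    ENNReal.mul_ne_top (h1 n) (ENNReal.pow_ne_top ENNReal.ofReal_ne_top)]
  refine tsum_congr fun n => ?_
  rw [ENNReal.toReal_mul, ENNReal.toReal_pow, ENNReal.toReal_ofReal hl.1]

theorem continuousOn_lyap {α β : ℝ} (hα : 0 < α) (hβ : 0 < β) :
    ContinuousOn (lyap α β hα hβ) (Set.Ioc 0 1) := by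
  have := isProbabilityMeasure_envLaw hα hβ
  intro l₀ hl₀
  -- Staying above `l₀ / 2` keeps `log l` bounded in the domination.
  have hev : ∀ᶠ l in 𝓝[Set.Ioc 0 1] l₀, l ∈ Set.Ioc 0 1 ∧ l₀ / 2 < l :=
    (eventually_mem_nhdsWithin).and (nhdsWithin_le_nhds (lt_mem_nhds (half_lt_self hl₀.1)))
  refine continuousWithinAt_of_dominated
    (bound := fun ω => |Real.log (l₀ / 2)| + |Real.log (ω 0)|) ?_ ?_ ?_ ?_
  · filter_upwards [hev] with l hl
    exact (integrable_log_phi hα hβ hl.1.1 hl.1.2).aestronglyMeasurable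
  · filter_upwards [hev] with l hl
    filter_upwards with ω
    rw [log_phi_eq ω hl.1.1 hl.1.2, Real.norm_eq_abs]
    refine (abs_add_le _ _).trans (add_le_add ?_ (abs_log_Z_le ω hl.1.1 hl.1.2))
    have h1 : l₀ / 2 ≤ 1 := by linarith [hl₀.2, hl₀.1]
    rw [abs_of_nonpos (Real.log_nonpos hl.1.1.le hl.1.2),
      abs_of_nonpos (Real.log_nonpos (half_pos hl₀.1).le h1), neg_le_neg_iff]
    exact Real.log_le_log (half_pos hl₀.1) hl.2.le
  · exact (integrable_const _).add (integrable_log_env hα hβ 0).abs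
  · filter_upwards with ω
    exact (((continuousOn_phi ω).mono Set.Ioc_subset_Icc_self) l₀ hl₀).log
      (phi_pos ω hl₀.1 hl₀.2).ne'

/-- The explicit integral is available for `l < 1` only. The value at `l = 1` adds nothing to the
supremum, because `lyap` is continuous up to `1`. -/
theorem legendre_lyap_eq {α β : ℝ} (hα : 0 < α) (hβ : 0 < β) (x : ℝ) :
    legendre (Set.Ioc 0 1) (lyap α β hα hβ) x
      = legendre (Set.Ioo 0 1) (fun l => Real.log l +
          ∫ u in (0 : ℝ)..1, Real.log u * hypDensity α β (l ^ 2) u) x := by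
  have h1 : legendre (Set.Ioo 0 1) (fun l => Real.log l +
      ∫ u in (0 : ℝ)..1, Real.log u * hypDensity α β (l ^ 2) u) x
      = legendre (Set.Ioo 0 1) (lyap α β hα hβ) x := by
    refine biSup_congr fun l hl => ?_
    rw [lyap_eq_hypDensity hα hβ hl.1 hl.2]
  rw [h1]
  refine le_antisymm (iSup₂_le fun l hl => ?_) (biSup_mono fun l hl => ⟨hl.1, hl.2.le⟩)
  rcases hl.2.lt_or_eq with hl1 | rfl
  · exact le_iSup₂_of_le l ⟨hl.1, hl1⟩ le_rfl
  · have hc : ContinuousWithinAt (fun l => x * Real.log l - lyap α β hα hβ l) (Set.Ioo 0 1) 1 :=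
      (((Real.continuousAt_log one_ne_zero).continuousWithinAt.const_mul x).sub
        ((continuousOn_lyap hα hβ) 1 hl)).mono Set.Ioo_subset_Ioc_self
    have hne : (𝓝[Set.Ioo (0 : ℝ) 1] 1).NeBot := by
      rw [← mem_closure_iff_nhdsWithin_neBot, closure_Ioo (by norm_num)]
      simp
    refine le_of_tendsto (continuous_coe_real_ereal.continuousAt.tendsto.comp hc) ?_
    filter_upwards [self_mem_nhdsWithin] with l hl
    exact le_iSup₂_of_le (f := fun l (_ : l ∈ Set.Ioo (0 : ℝ) 1) =>
      ((x * Real.log l - lyap α β hα hβ l : ℝ) : EReal)) l hl le_rfl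

/-! ### Sums of independent bounded variables -/

/-- The expectation of `g` under the law of a sum of `k` independent variables with values in
`{0, …, M}` and weights `b 0, …, b (k - 1)`. -/
def sumE (M : ℕ) (b : ℕ → ℕ → ℝ) : ℕ → (ℕ → ℝ) → ℝ
  | 0, g => g 0
  | k + 1, g => ∑ m ∈ Finset.range (M + 1), b k m * sumE M b k fun n => g (n + m)

section sumE

variable {M : ℕ} {b : ℕ → ℕ → ℝ}

theorem sumE_mono (hb : ∀ i m, 0 ≤ b i m) (k : ℕ) : ∀ {f g : ℕ → ℝ}, (∀ n, f n ≤ g n) →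
    sumE M b k f ≤ sumE M b k g := by
  induction k with
  | zero => intro f g h; exact h 0
  | succ k ih =>
    intro f g h
    exact Finset.sum_le_sum fun m _ => mul_le_mul_of_nonneg_left (ih fun n => h (n + m)) (hb k m)

theorem sumE_const (h1 : ∀ i, ∑ m ∈ Finset.range (M + 1), b i m = 1) (c : ℝ) (k : ℕ) :
    sumE M b k (fun _ => c) = c := by
  induction k with
  | zero => rfl
  | succ k ih => rw [sumE, ih, ← Finset.sum_mul, h1, one_mul]

theorem sumE_const_mul (c : ℝ) (k : ℕ) : ∀ g : ℕ → ℝ,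
    sumE M b k (fun n => c * g n) = c * sumE M b k g := by
  induction k with
  | zero => intro g; rfl
  | succ k ih =>
    intro g
    simp only [sumE]
    rw [Finset.mul_sum]
    refine Finset.sum_congr rfl fun m _ => ?_
    rw [ih fun n => g (n + m)]
    ring

theorem sumE_sub (k : ℕ) : ∀ f g : ℕ → ℝ,
    sumE M b k (fun n => f n - g n) = sumE M b k f - sumE M b k g := by
  induction k with
  | zero => intro f g; rfl
  | succ k ih =>
    intro f g
    simp only [sumE]
    rw [← Finset.sum_sub_distrib]
    refine Finset.sum_congr rfl fun m _ => ?_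
    rw [ih (fun n => f (n + m)) fun n => g (n + m)]
    ring

/-- The second moment about `c` is a variance plus a squared bias, and each variable, having values
in `[0, M]`, adds at most `M ^ 2` to the variance. -/
theorem sumE_sq_le (hb : ∀ i m, 0 ≤ b i m) (h1 : ∀ i, ∑ m ∈ Finset.range (M + 1), b i m = 1)
    (k : ℕ) : ∀ c : ℝ, sumE M b k (fun n => ((n : ℝ) - c) ^ 2) ≤ k * (M : ℝ) ^ 2 +
      (∑ i ∈ Finset.range k, ∑ m ∈ Finset.range (M + 1), (m : ℝ) * b i m - c) ^ 2 := by
  induction k with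
  | zero => intro c; simp [sumE]
  | succ k ih =>
    intro c
    set μ := ∑ i ∈ Finset.range k, ∑ m ∈ Finset.range (M + 1), (m : ℝ) * b i m with hμ
    set e := ∑ m ∈ Finset.range (M + 1), (m : ℝ) * b k m with he
    have he0 : 0 ≤ e := Finset.sum_nonneg fun m _ => mul_nonneg (Nat.cast_nonneg m) (hb k m)
    have heM : e ≤ M := by
      calc e ≤ ∑ m ∈ Finset.range (M + 1), (M : ℝ) * b k m := by
            refine Finset.sum_le_sum fun m hm => mul_le_mul_of_nonneg_right ?_ (hb k m)
            exact_mod_cast Nat.lt_succ_iff.1 (Finset.mem_range.1 hm)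
        _ = M := by rw [← Finset.mul_sum, h1, mul_one]
    rw [Finset.sum_range_succ, ← hμ, ← he]
    calc sumE M b (k + 1) (fun n => ((n : ℝ) - c) ^ 2)
        = ∑ m ∈ Finset.range (M + 1), b k m * sumE M b k fun n => ((n : ℝ) - (c - m)) ^ 2 := by
          rw [sumE]
          refine Finset.sum_congr rfl fun m _ => ?_
          congr 2
          funext n
          push_cast
          ring
      -- The bias for `c - m` is `(μ + e - c) + (m - e)`; its cross term is kept, since it averages
      -- to zero over `m`.
      _ ≤ ∑ m ∈ Finset.range (M + 1), b k m * (k * (M : ℝ) ^ 2 + (M : ℝ) ^ 2 + (μ + e - c) ^ 2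
            + 2 * (μ + e - c) * (m - e)) := by
          refine Finset.sum_le_sum fun m hm => mul_le_mul_of_nonneg_left ?_ (hb k m)
          have hm' : (m : ℝ) ≤ M := by
            exact_mod_cast Nat.lt_succ_iff.1 (Finset.mem_range.1 hm)
          have hm0 : (0 : ℝ) ≤ m := Nat.cast_nonneg m
          have h2 : ((m : ℝ) - e) ^ 2 ≤ (M : ℝ) ^ 2 := by
            rw [sq_le_sq, abs_of_nonneg (Nat.cast_nonneg M : (0 : ℝ) ≤ M), abs_le]
            constructor <;> linarith
          have := ih (c - m)
          nlinarith
      _ = (∑ m ∈ Finset.range (M + 1), b k m) *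
            (k * (M : ℝ) ^ 2 + (M : ℝ) ^ 2 + (μ + e - c) ^ 2 - 2 * (μ + e - c) * e)
            + 2 * (μ + e - c) * e := by
          have e2 : ∑ m ∈ Finset.range (M + 1), 2 * (μ + e - c) * ((m : ℝ) * b k m)
              = 2 * (μ + e - c) * e := (Finset.mul_sum _ _ _).symm
          rw [Finset.sum_mul]
          refine Eq.trans ?_ (congrArg (_ + ·) e2)
          rw [← Finset.sum_add_distrib]
          refine Finset.sum_congr rfl fun m _ => ?_
          ring
      _ = _ := by
          rw [h1]
          push_cast
          ring

/-- Chebyshev's inequality. -/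
theorem le_sumE_indicator (hb : ∀ i m, 0 ≤ b i m)
    (h1 : ∀ i, ∑ m ∈ Finset.range (M + 1), b i m = 1) (k : ℕ) (c : ℝ) {r : ℝ} (hr : 0 < r) :
    1 - (k * (M : ℝ) ^ 2 +
      (∑ i ∈ Finset.range k, ∑ m ∈ Finset.range (M + 1), (m : ℝ) * b i m - c) ^ 2) / r ^ 2
      ≤ sumE M b k fun n => {n : ℕ | |(n : ℝ) - c| < r}.indicator 1 n := by
  have hr2 : 0 < r ^ 2 := by positivity
  calc _ ≤ 1 - (r ^ 2)⁻¹ * sumE M b k (fun n => ((n : ℝ) - c) ^ 2) := by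
        rw [div_eq_inv_mul]
        have := sumE_sq_le hb h1 k c
        gcongr
    _ = sumE M b k fun n => 1 - (r ^ 2)⁻¹ * ((n : ℝ) - c) ^ 2 := by
        rw [sumE_sub k (fun _ => 1) fun n => (r ^ 2)⁻¹ * ((n : ℝ) - c) ^ 2, sumE_const h1,
          sumE_const_mul _ k fun n => ((n : ℝ) - c) ^ 2]
    _ ≤ _ := by
        refine sumE_mono hb k fun n => ?_
        by_cases hn : |(n : ℝ) - c| < r
        · rw [Set.indicator_of_mem (show n ∈ {n : ℕ | |(n : ℝ) - c| < r} from hn), Pi.one_apply]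
          have : 0 ≤ (r ^ 2)⁻¹ * ((n : ℝ) - c) ^ 2 := by positivity
          linarith
        · rw [Set.indicator_of_notMem (show n ∉ {n : ℕ | |(n : ℝ) - c| < r} from hn), sub_nonpos,
            ← div_eq_inv_mul, one_le_div hr2, ← sq_abs ((n : ℝ) - c)]
          exact pow_le_pow_left₀ hr.le (not_lt.1 hn) 2

end sumE

/-! ### Truncated first passage times -/

/-- The probability of a first passage from `0` to `1` at time `n`, as a real number. -/
def passR (ω : Env) (n : ℕ) : ℝ := (passP ω n).toReal

theorem passP_le_one (ω : Env) (n : ℕ) : passP ω n ≤ 1 := by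
  have h : passP ω n * 1 ^ n ≤ passGF ω 1 := ENNReal.le_tsum n
  rw [one_pow, mul_one] at h
  exact h.trans (passGF_one_le ω)

theorem ofReal_passR (ω : Env) (n : ℕ) : ENNReal.ofReal (passR ω n) = passP ω n :=
  ENNReal.ofReal_toReal ((passP_le_one ω n).trans_lt ENNReal.one_lt_top).ne

theorem passR_nonneg (ω : Env) (n : ℕ) : 0 ≤ passR ω n := ENNReal.toReal_nonneg

theorem measurable_passR (n : ℕ) : Measurable fun ω => passR ω n :=
  (measurable_passP n).ennreal_toReal

theorem passR_one (ω : Env) : passR ω 1 = ω 0 := by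
  have h : passP ω 1 = ENNReal.ofReal (ω 0) := by
    rw [passP, hitP_succ_of_ne _ (by norm_num)]
    simp [hitP]
  rw [passR, h, ENNReal.toReal_ofReal (ω 0).2.1.le]

theorem sum_passR_le_one (ω : Env) (s : Finset ℕ) : ∑ n ∈ s, passR ω n ≤ 1 := by
  have h : ∑ n ∈ s, passP ω n ≤ 1 := by
    refine le_trans ?_ (passGF_one_le ω)
    simpa [passGF] using ENNReal.sum_le_tsum (f := fun n => passP ω n * 1 ^ n) s
  simp_rw [passR]
  rw [← ENNReal.toReal_sum fun n _ => ((passP_le_one ω n).trans_lt ENNReal.one_lt_top).ne]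
  exact ENNReal.toReal_le_of_le_ofReal zero_le_one (by simpa using h)

theorem passR_congr {ω ω' : Env} {N n : ℕ} (hn : n ≤ N)
    (h : ∀ x ∈ Set.Icc (-N : ℤ) 0, ω x = ω' x) : passR ω n = passR ω' n := by
  rw [passR, passR, passP, passP, hitP_congr 1 n 0 zero_le_one]
  intro y h1 h2
  exact h y ⟨by omega, by omega⟩

/-- The walk may bounce between `0` and `-1` before it jumps to `1`. -/
theorem le_passR_odd (ω : Env) (r : ℕ) :
    ((1 - ω 0) * ω (-1)) ^ r * ω 0 ≤ passR ω (2 * r + 1) := by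
  induction r with
  | zero => simp [passR_one]
  | succ r ih =>
    have h1 := (ω 0).2
    have h2 := (ω (-1)).2
    have h3 : ENNReal.ofReal (1 - ω 0) * (ENNReal.ofReal (ω (-1)) * passP ω (2 * r + 1))
        ≤ passP ω (2 * (r + 1) + 1) := by
      rw [passP, passP, show 2 * (r + 1) + 1 = (2 * r + 1 + 1) + 1 by ring,
        hitP_succ_of_ne ω (show (0 : ℤ) ≠ 1 by norm_num) (2 * r + 1 + 1),
        hitP_succ_of_ne ω (show (0 - 1 : ℤ) ≠ 1 by norm_num) (2 * r + 1), zero_sub,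
        neg_add_cancel]
      refine le_trans ?_ le_add_self
      gcongr
      exact le_self_add
    have h4 : (1 - ω 0) * ((ω (-1)) * passR ω (2 * r + 1)) ≤ passR ω (2 * (r + 1) + 1) := by
      have h5 := ENNReal.toReal_mono
        ((passP_le_one ω (2 * (r + 1) + 1)).trans_lt ENNReal.one_lt_top).ne h3
      rwa [ENNReal.toReal_mul, ENNReal.toReal_mul,
        ENNReal.toReal_ofReal (sub_nonneg.2 h1.2.le), ENNReal.toReal_ofReal h2.1.le] at h5
    refine le_trans ?_ h4
    have h6 : 0 ≤ (1 - ω 0) * (ω (-1) : ℝ) := mul_nonneg (sub_nonneg.2 h1.2.le) h2.1.le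
    calc _ = (1 - ω 0) * (ω (-1) : ℝ) * (((1 - ω 0) * ω (-1)) ^ r * ω 0) := by ring
      _ ≤ (1 - ω 0) * (ω (-1) : ℝ) * passR ω (2 * r + 1) := mul_le_mul_of_nonneg_left ih h6
      _ = _ := by ring

/-- The moment generating function of the first passage time from `0` to `1`, restricted to the
event that this time is at most `M`. -/
def truncS (M : ℕ) (ω : Env) (θ : ℝ) : ℝ :=
  ∑ n ∈ Finset.range (M + 1), passR ω n * Real.exp (θ * n)

theorem measurable_truncS (M : ℕ) (θ : ℝ) : Measurable fun ω => truncS M ω θ :=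
  Finset.measurable_sum _ fun n _ => (measurable_passR n).mul_const _

theorem truncS_congr {M : ℕ} {ω ω' : Env} (θ : ℝ)
    (h : ∀ x ∈ Set.Icc (-M : ℤ) 0, ω x = ω' x) : truncS M ω θ = truncS M ω' θ :=
  Finset.sum_congr rfl fun n hn => by
    rw [passR_congr (Nat.lt_succ_iff.1 (Finset.mem_range.1 hn)) h]

theorem passR_mul_exp_le_truncS {M n : ℕ} (hn : n ≤ M) (ω : Env) (θ : ℝ) :
    passR ω n * Real.exp (θ * n) ≤ truncS M ω θ :=
  Finset.single_le_sum (f := fun n : ℕ => passR ω n * Real.exp (θ * n))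
    (fun m _ => mul_nonneg (passR_nonneg ω m) (Real.exp_pos _).le)
    (Finset.mem_range.2 (Nat.lt_succ_iff.2 hn))

theorem mul_exp_le_truncS {M : ℕ} (hM : 1 ≤ M) (ω : Env) (θ : ℝ) :
    ω 0 * Real.exp θ ≤ truncS M ω θ := by
  simpa [passR_one] using passR_mul_exp_le_truncS hM ω θ

theorem truncS_pos {M : ℕ} (hM : 1 ≤ M) (ω : Env) (θ : ℝ) : 0 < truncS M ω θ :=
  (mul_pos (ω 0).2.1 (Real.exp_pos θ)).trans_le (mul_exp_le_truncS hM ω θ)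

theorem truncS_mono {M M' : ℕ} (h : M ≤ M') (ω : Env) (θ : ℝ) : truncS M ω θ ≤ truncS M' ω θ :=
  Finset.sum_le_sum_of_subset_of_nonneg (Finset.range_mono (by omega))
    fun n _ _ => mul_nonneg (passR_nonneg ω n) (Real.exp_pos _).le

theorem truncS_le (M : ℕ) (ω : Env) (θ : ℝ) : truncS M ω θ ≤ Real.exp (|θ| * M) := by
  calc truncS M ω θ ≤ ∑ n ∈ Finset.range (M + 1), passR ω n * Real.exp (|θ| * M) := by
        refine Finset.sum_le_sum fun n hn => mul_le_mul_of_nonneg_left ?_ (passR_nonneg ω n)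
        have hn' : (n : ℝ) ≤ M := by exact_mod_cast Nat.lt_succ_iff.1 (Finset.mem_range.1 hn)
        refine Real.exp_le_exp.2 ?_
        calc θ * n ≤ |θ| * n := by gcongr; exact le_abs_self θ
          _ ≤ |θ| * M := by gcongr
    _ ≤ 1 * Real.exp (|θ| * M) := by
        rw [← Finset.sum_mul]
        gcongr
        exact sum_passR_le_one ω _
    _ = _ := one_mul _

theorem log_env_add_le {M : ℕ} (hM : 1 ≤ M) (ω : Env) (θ : ℝ) :
    Real.log (ω 0) + θ ≤ Real.log (truncS M ω θ) := by
  rw [← Real.log_exp θ, ← Real.log_mul (ω 0).2.1.ne' (Real.exp_pos θ).ne', Real.log_exp]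
  exact Real.log_le_log (mul_pos (ω 0).2.1 (Real.exp_pos θ)) (mul_exp_le_truncS hM ω θ)

theorem log_truncS_le {M : ℕ} (hM : 1 ≤ M) (ω : Env) (θ : ℝ) :
    Real.log (truncS M ω θ) ≤ |θ| * M := by
  rw [← Real.log_exp (|θ| * M)]
  exact Real.log_le_log (truncS_pos hM ω θ) (truncS_le M ω θ)

theorem abs_log_truncS_le {M : ℕ} (hM : 1 ≤ M) (ω : Env) (θ : ℝ) :
    |Real.log (truncS M ω θ)| ≤ |Real.log (ω 0)| + |θ| * M := by
  have h1 := log_env_add_le hM ω θ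
  have h2 := log_truncS_le hM ω θ
  have h3 := neg_abs_le (Real.log (ω 0))
  have h4 := abs_nonneg (Real.log (ω 0))
  have h5 : |θ| * 1 ≤ |θ| * M := mul_le_mul_of_nonneg_left (by exact_mod_cast hM) (abs_nonneg θ)
  have h6 := neg_abs_le θ
  rw [abs_le]
  constructor <;> linarith

/-- The law of `H_k` dominates the law of a sum of truncated passage times, which is written as a
tilted sum. -/
theorem le_hitSum {M : ℕ} (hM : 1 ≤ M) (ω : Env) (θ : ℝ) (k : ℕ) : ∀ {g : ℕ → ℝ}, (∀ n, 0 ≤ g n) →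
    ENNReal.ofReal ((∏ i ∈ Finset.range k, truncS M (shift i ω) θ) *
      sumE M (fun i n => passR (shift i ω) n * Real.exp (θ * n) / truncS M (shift i ω) θ) k
        fun n => g n * Real.exp (-(θ * n))) ≤ hitSum ω k fun n => ENNReal.ofReal (g n) := by
  induction k with
  | zero => intro g hg; simp [sumE, hitSum_zero]
  | succ k ih =>
    intro g hg
    set b : ℕ → ℕ → ℝ := fun i n =>
      passR (shift i ω) n * Real.exp (θ * n) / truncS M (shift i ω) θ with hb
    have hb0 : ∀ i m, 0 ≤ b i m := fun i m => div_nonneg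
      (mul_nonneg (passR_nonneg _ m) (Real.exp_pos _).le) (truncS_pos hM _ θ).le
    have hP : 0 ≤ ∏ i ∈ Finset.range k, truncS M (shift i ω) θ :=
      Finset.prod_nonneg fun i _ => (truncS_pos hM _ θ).le
    have hS := (truncS_pos hM (shift k ω) θ).ne'
    rw [hitSum_succ]
    calc _ = ENNReal.ofReal (∑ m ∈ Finset.range (M + 1), passR (shift k ω) m *
          ((∏ i ∈ Finset.range k, truncS M (shift i ω) θ) *
            sumE M b k fun n => g (n + m) * Real.exp (-(θ * n)))) := by
          congr 1
          rw [sumE, Finset.prod_range_succ, Finset.mul_sum]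
          refine Finset.sum_congr rfl fun m _ => ?_
          -- The factor `exp (-(θ * m))` undoes the tilt of the last variable, whose normalisation
          -- cancels against the last factor of the product.
          have h1 : (fun n : ℕ => g (n + m) * Real.exp (-(θ * ((n + m : ℕ) : ℝ))))
              = fun n => Real.exp (-(θ * m)) * (g (n + m) * Real.exp (-(θ * n))) := by
            funext n
            push_cast
            rw [mul_add, neg_add, Real.exp_add]
            ring
          rw [h1, sumE_const_mul _ k fun n => g (n + m) * Real.exp (-(θ * n))]
          have h2 : Real.exp (θ * m) * Real.exp (-(θ * m)) = 1 := by
            rw [← Real.exp_add]; simp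
          simp only [hb]
          field_simp
          linear_combination ((∏ i ∈ Finset.range k, truncS M (shift i ω) θ) *
            passR (shift k ω) m * (sumE M b k fun n =>
            g (n + m) * Real.exp (-(θ * n)))) * h2
      _ = ∑ m ∈ Finset.range (M + 1), passP (shift k ω) m * ENNReal.ofReal
          ((∏ i ∈ Finset.range k, truncS M (shift i ω) θ) *
            sumE M b k fun n => g (n + m) * Real.exp (-(θ * n))) := by
          rw [ENNReal.ofReal_sum_of_nonneg]
          · refine Finset.sum_congr rfl fun m _ => ?_
            rw [ENNReal.ofReal_mul (passR_nonneg _ m), ofReal_passR]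
          · intro m _
            refine mul_nonneg (passR_nonneg _ m) (mul_nonneg hP ?_)
            have h3 : sumE M b k (fun n => 0 * (0 : ℝ)) ≤
                sumE M b k fun n => g (n + m) * Real.exp (-(θ * n)) :=
              sumE_mono hb0 k fun n => by
                rw [zero_mul]; exact mul_nonneg (hg _) (Real.exp_pos _).le
            rwa [sumE_const_mul 0 k (fun _ => 0), zero_mul] at h3
      _ ≤ ∑ m ∈ Finset.range (M + 1), passP (shift k ω) m *
          hitSum ω k fun n => ENNReal.ofReal (g (n + m)) := by
          gcongr with m _
          exact ih fun n => hg (n + m)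
      _ ≤ _ := ENNReal.sum_le_tsum _

/-! ### The large deviation upper bound -/

theorem exp_log_mul_nat {l : ℝ} (hl : 0 < l) (n : ℕ) : Real.exp (Real.log l * n) = l ^ n := by
  rw [mul_comm, Real.exp_nat_mul, Real.exp_log hl]

theorem hasSum_phi (ω : Env) {l : ℝ} (hl : 0 ≤ l) (hl1 : l ≤ 1) :
    HasSum (fun n => passR ω n * l ^ n) (phi ω l) := by
  have h1 : ∀ n, passP ω n * ENNReal.ofReal l ^ n ≠ ∞ := fun n =>
    ENNReal.mul_ne_top ((passP_le_one ω n).trans_lt ENNReal.one_lt_top).ne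
      (ENNReal.pow_ne_top ENNReal.ofReal_ne_top)
  have h2 : ∀ n, passR ω n * l ^ n = (passP ω n * ENNReal.ofReal l ^ n).toReal := fun n => by
    rw [ENNReal.toReal_mul, ENNReal.toReal_pow, ENNReal.toReal_ofReal hl, passR]
  simp_rw [h2]
  rw [phi_eq ω hl, passGF, ENNReal.tsum_toReal_eq h1]
  exact (ENNReal.summable_toReal (passGF_ofReal_ne_top ω hl1)).hasSum

theorem tendsto_truncS (ω : Env) {l : ℝ} (hl : 0 < l) (hl1 : l ≤ 1) :
    Tendsto (fun M => truncS M ω (Real.log l)) atTop (𝓝 (phi ω l)) := by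
  simp only [truncS, exp_log_mul_nat hl]
  exact (tendsto_add_atTop_iff_nat 1).2 (hasSum_phi ω hl.le hl1).tendsto_sum_nat

/-- The passages longer than `M` have total probability at most `1` and weight at most `l ^ (M +
1)`. The majorant reads finitely many sites, whereas `phi` depends on the whole left half-line. -/
theorem phi_le_truncS_add (M : ℕ) (ω : Env) {l : ℝ} (hl : 0 < l) (hl1 : l ≤ 1) :
    phi ω l ≤ truncS M ω (Real.log l) + l ^ (M + 1) := by
  refine le_of_tendsto (hasSum_phi ω hl.le hl1).tendsto_sum_nat ?_
  filter_upwards [eventually_ge_atTop (M + 1)] with N hN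
  rw [← Finset.sum_range_add_sum_Ico _ hN]
  simp only [truncS, exp_log_mul_nat hl]
  gcongr
  calc _ ≤ ∑ n ∈ Finset.Ico (M + 1) N, passR ω n * l ^ (M + 1) := by
        refine Finset.sum_le_sum fun n hn => mul_le_mul_of_nonneg_left ?_ (passR_nonneg ω n)
        exact pow_le_pow_of_le_one hl.le hl1 (Finset.mem_Ico.1 hn).1
    _ ≤ 1 * l ^ (M + 1) := by
        rw [← Finset.sum_mul]
        gcongr
        exact sum_passR_le_one ω _
    _ = _ := one_mul _

theorem abs_log_truncS_add_le {M : ℕ} (hM : 1 ≤ M) (ω : Env) {l : ℝ} (hl : 0 < l) (hl1 : l ≤ 1) :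
    |Real.log (truncS M ω (Real.log l) + l ^ (M + 1))|
      ≤ |Real.log (ω 0)| + |Real.log l| + Real.log 2 := by
  have hpow : 0 < l ^ (M + 1) := by positivity
  have h1 := mul_exp_le_truncS hM ω (Real.log l)
  rw [Real.exp_log hl] at h1
  have h2 : truncS M ω (Real.log l) ≤ 1 := by
    simp only [truncS, exp_log_mul_nat hl]
    refine le_trans (Finset.sum_le_sum fun n _ => mul_le_of_le_one_right (passR_nonneg ω n)
      (pow_le_one₀ hl.le hl1)) (sum_passR_le_one ω _)
  have h3 : l ^ (M + 1) ≤ 1 := pow_le_one₀ hl.le hl1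
  have h0 : 0 < (ω 0 : ℝ) * l := mul_pos (ω 0).2.1 hl
  have h4 : Real.log (ω 0) + Real.log l ≤ Real.log (truncS M ω (Real.log l) + l ^ (M + 1)) := by
    rw [← Real.log_mul (ω 0).2.1.ne' hl.ne']
    exact Real.log_le_log h0 (by linarith)
  have h5 : Real.log (truncS M ω (Real.log l) + l ^ (M + 1)) ≤ Real.log 2 :=
    Real.log_le_log (by linarith) (by linarith)
  have h6 := neg_abs_le (Real.log (ω 0))
  have h7 := neg_abs_le (Real.log l)
  have h8 := Real.log_pos one_lt_two
  rw [abs_le]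
  constructor
  · linarith
  · linarith [abs_nonneg (Real.log (ω 0)), abs_nonneg (Real.log l)]

/-- The law of large numbers holds for the local majorants `U M`, whose means converge to `lyap` by
dominated convergence. Only this one-sided bound is needed. -/
theorem ae_sum_log_phi_le {α β : ℝ} (hα : 0 < α) (hβ : 0 < β) {l : ℝ} (hl : 0 < l) (hl1 : l < 1) :
    ∀ᵐ ω ∂(envLaw α β hα hβ), ∀ c, lyap α β hα hβ l < c →
      ∀ᶠ k : ℕ in atTop, ∑ i ∈ Finset.range k, Real.log (phi (shift i ω) l) ≤ k * c := by
  have := isProbabilityMeasure_envLaw hα hβ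
  set U : ℕ → Env → ℝ := fun M ω => Real.log (truncS M ω (Real.log l) + l ^ (M + 1)) with hU
  have hUm : ∀ M, Measurable (U M) := fun M =>
    Real.measurable_log.comp ((measurable_truncS M (Real.log l)).add_const _)
  have hbound : Integrable (fun ω : Env => |Real.log (ω 0)| + |Real.log l| + Real.log 2)
      (envLaw α β hα hβ) :=
    ((integrable_log_env hα hβ 0).abs.add (integrable_const _)).add (integrable_const _)
  have hUi : ∀ M, Integrable (U (M + 1)) (envLaw α β hα hβ) := fun M =>
    hbound.mono' (hUm _).aestronglyMeasurable (Eventually.of_forall fun ω =>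
      abs_log_truncS_add_le (by omega) ω hl hl1.le)
  have hlim : Tendsto (fun M => ∫ ω, U (M + 1) ω ∂(envLaw α β hα hβ)) atTop
      (𝓝 (lyap α β hα hβ l)) := by
    refine tendsto_integral_of_dominated_convergence _
      (fun M => (hUm _).aestronglyMeasurable) hbound (fun M => Eventually.of_forall fun ω =>
        abs_log_truncS_add_le (by omega) ω hl hl1.le) (Eventually.of_forall fun ω => ?_)
    have h1 : Tendsto (fun M => truncS M ω (Real.log l) + l ^ (M + 1)) atTop
        (𝓝 (phi ω l + 0)) := (tendsto_truncS ω hl hl1.le).add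
      ((tendsto_add_atTop_iff_nat 1).2 (tendsto_pow_atTop_nhds_zero_of_lt_one hl.le hl1))
    rw [add_zero] at h1
    exact (tendsto_add_atTop_iff_nat (f := fun M => U M ω) 1).2
      (h1.log (phi_pos ω hl hl1.le).ne')
  have hslln : ∀ᵐ ω ∂(envLaw α β hα hβ), ∀ M : ℕ,
      Tendsto (fun k : ℕ => (∑ i ∈ Finset.range k, U (M + 1) (shift i ω)) / k) atTop
        (𝓝 (∫ ω, U (M + 1) ω ∂(envLaw α β hα hβ))) := by
    rw [ae_all_iff]
    intro M
    refine ae_tendsto_average_shift hα hβ (hUm _) (N := M + 1) (fun ω ω' h => ?_) (hUi M)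
    simp only [hU]
    rw [truncS_congr _ fun x hx => h x hx]
  filter_upwards [hslln] with ω hω c hc
  obtain ⟨M, hM⟩ := (hlim.eventually_lt_const hc).exists
  filter_upwards [(hω M).eventually_lt_const hM, eventually_gt_atTop 0] with k hk hk0
  have hk0' : (0 : ℝ) < k := by exact_mod_cast hk0
  rw [div_lt_iff₀ hk0'] at hk
  calc _ ≤ ∑ i ∈ Finset.range k, U (M + 1) (shift i ω) := by
        refine Finset.sum_le_sum fun i _ => Real.log_le_log (phi_pos _ hl hl1.le) ?_
        exact phi_le_truncS_add (M + 1) _ hl hl1.le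
    _ ≤ k * c := by linarith

theorem ereal_log_div_le {m : ℝ≥0∞} {k : ℕ} (hk : 0 < k) {a : ℝ}
    (h : m ≤ ENNReal.ofReal (Real.exp (k * a))) : ENNReal.log m / (k : EReal) ≤ a := by
  rw [EReal.div_le_iff_le_mul (by exact_mod_cast hk) (EReal.natCast_ne_top k)]
  refine (ENNReal.log_le_log h).trans ?_
  rw [ENNReal.log_ofReal_of_pos (Real.exp_pos _), Real.log_exp, EReal.coe_mul]
  rfl

theorem le_ereal_log_div {m : ℝ≥0∞} {k : ℕ} (hk : 0 < k) {a : ℝ}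
    (h : ENNReal.ofReal (Real.exp (k * a)) ≤ m) : (a : EReal) ≤ ENNReal.log m / (k : EReal) := by
  rw [EReal.le_div_iff_mul_le (by exact_mod_cast hk) (EReal.natCast_ne_top k)]
  refine le_trans ?_ (ENNReal.log_le_log h)
  rw [ENNReal.log_ofReal_of_pos (Real.exp_pos _), Real.log_exp, mul_comm, EReal.coe_mul]
  rfl

theorem prod_passGF_eq (ω : Env) {l : ℝ} (hl : 0 < l) (hl1 : l ≤ 1) (k : ℕ) :
    ∏ i ∈ Finset.range k, passGF (shift i ω) (ENNReal.ofReal l)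
      = ENNReal.ofReal (Real.exp (∑ i ∈ Finset.range k, Real.log (phi (shift i ω) l))) := by
  rw [Real.exp_sum, ENNReal.ofReal_prod_of_nonneg fun i _ => (Real.exp_pos _).le]
  refine Finset.prod_congr rfl fun i _ => ?_
  rw [Real.exp_log (phi_pos _ hl hl1), phi_eq _ hl.le,
    ENNReal.ofReal_toReal (passGF_ofReal_ne_top _ hl1)]

/-- The exponential Chebyshev inequality for the hitting times. -/
theorem hitLaw_Iic_le (ω : Env) (h : ∀ i : ℕ, passGF (shift i ω) 1 = 1) {k : ℕ} (hk : 0 < k)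
    {l : ℝ} (hl : 0 < l) (hl1 : l ≤ 1) (s : ℝ) :
    hitLaw ω k (Set.Iic s) ≤ ENNReal.ofReal (Real.exp (k * (-(s * Real.log l)) +
      ∑ i ∈ Finset.range k, Real.log (phi (shift i ω) l))) := by
  have hk' : (0 : ℝ) < k := by exact_mod_cast hk
  rw [Real.exp_add, ENNReal.ofReal_mul (Real.exp_pos _).le, ← prod_passGF_eq ω hl hl1,
    ← hitSum_pow, ← hitSum_const_mul, hitLaw_apply ω h k measurableSet_Iic]
  -- If `n ≤ s * k`, then `1 ≤ exp (-(k * s * log l)) * l ^ n`, because `log l ≤ 0`.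
  refine hitSum_mono ω k fun n => ?_
  by_cases hn : (n : ℝ) / k ∈ Set.Iic s
  · rw [Set.indicator_of_mem hn, Pi.one_apply, ← ENNReal.ofReal_pow hl.le,
      ← ENNReal.ofReal_mul (Real.exp_pos _).le, ← exp_log_mul_nat hl, ← Real.exp_add,
      ENNReal.one_le_ofReal, Real.one_le_exp_iff]
    have h1 : (n : ℝ) ≤ s * k := (div_le_iff₀ hk').1 (Set.mem_Iic.1 hn)
    have h2 := Real.log_nonpos hl.le hl1
    nlinarith
  · rw [Set.indicator_of_notMem hn]
    exact zero_le

theorem limsup_hitLaw_Iic_le {ω : Env} (h : ∀ i : ℕ, passGF (shift i ω) 1 = 1) {l Λ : ℝ}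
    (hl : 0 < l) (hl1 : l ≤ 1) (hc : ∀ c, Λ < c →
      ∀ᶠ k : ℕ in atTop, ∑ i ∈ Finset.range k, Real.log (phi (shift i ω) l) ≤ k * c) (s : ℝ) :
    limsup (fun k : ℕ => ENNReal.log (hitLaw ω k (Set.Iic s)) / (k : EReal)) atTop
      ≤ ((-(s * Real.log l - Λ) : ℝ) : EReal) := by
  refine EReal.le_of_forall_lt_iff_le.1 fun c hc' => ?_
  have hc2 : Λ < c + s * Real.log l := by
    have := EReal.coe_lt_coe_iff.1 hc'
    linarith
  refine limsup_le_of_le (by isBoundedDefault) ?_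
  filter_upwards [hc _ hc2, eventually_gt_atTop 0] with k hk hk0
  refine ereal_log_div_le hk0 ((hitLaw_Iic_le ω h hk0 hl hl1 s).trans ?_)
  refine ENNReal.ofReal_le_ofReal (Real.exp_le_exp.2 ?_)
  linarith

/-! ### Properties of the rate function -/

theorem lyap_le_log {α β : ℝ} (hα : 0 < α) (hβ : 0 < β) {l : ℝ} (hl : 0 < l) (hl1 : l ≤ 1) :
    lyap α β hα hβ l ≤ Real.log l := by
  rw [lyap_eq hα hβ hl hl1]
  have : ∫ ω, Real.log (Z l ω) ∂(envLaw α β hα hβ) ≤ 0 :=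
    integral_nonpos fun ω => Real.log_nonpos (Z_pos ω hl hl1).le (Z_le_one ω hl hl1)
  linarith

theorem log_sub_le_lyap {α β : ℝ} (hα : 0 < α) (hβ : 0 < β) {l : ℝ} (hl : 0 < l) (hl1 : l ≤ 1) :
    Real.log l - ∫ ω : Env, |Real.log (ω 0)| ∂(envLaw α β hα hβ) ≤ lyap α β hα hβ l := by
  rw [lyap_eq hα hβ hl hl1, sub_eq_add_neg, ← integral_neg]
  refine add_le_add le_rfl ?_
  have hi : Integrable (fun ω : Env => -|Real.log (ω 0)|) (envLaw α β hα hβ) :=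
    (integrable_log_env hα hβ 0).abs.neg
  refine integral_mono hi (integrable_log_Z hα hβ hl hl1)
    fun ω => ?_
  have h1 := abs_log_Z_le ω hl hl1
  have h2 := neg_abs_le (Real.log (Z l ω))
  change -|Real.log (ω 0)| ≤ Real.log (Z l ω)
  linarith

theorem le_legendre {D : Set ℝ} {g : ℝ → ℝ} {l : ℝ} (hl : l ∈ D) (x : ℝ) :
    ((x * Real.log l - g l : ℝ) : EReal) ≤ legendre D g x :=
  le_iSup₂_of_le (f := fun l (_ : l ∈ D) => ((x * Real.log l - g l : ℝ) : EReal)) l hl le_rfl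

/-- Here `l ≤ 1`, so each affine function in the supremum has slope `log l ≤ 0`. -/
theorem legendre_antitone (g : ℝ → ℝ) : Antitone (legendre (Set.Ioc 0 1) g) := by
  intro x y hxy
  refine iSup₂_le fun l hl => le_trans ?_ (le_legendre hl x)
  have := Real.log_nonpos hl.1.le hl.2
  refine EReal.coe_le_coe_iff.2 ?_
  nlinarith

theorem lowerSemicontinuous_legendre (D : Set ℝ) (g : ℝ → ℝ) :
    LowerSemicontinuous (legendre D g) :=
  lowerSemicontinuous_biSup fun l _ => Continuous.lowerSemicontinuous
    (continuous_coe_real_ereal.comp (by fun_prop))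

theorem legendre_nonneg {α β : ℝ} (hβ : 0 < β) (hαβ : β < α) (x : ℝ) :
    0 ≤ legendre (Set.Ioc 0 1) (lyap α β (hβ.trans hαβ) hβ) x := by
  have := le_legendre (D := Set.Ioc 0 1) (g := lyap α β (hβ.trans hαβ) hβ) (l := 1) (by simp) x
  simpa [lyap_one hβ hαβ] using this

/-- `H_k ≥ k`. In terms of exponents, `lyap l ≤ log l` gives `x * log l - lyap l ≥ (x - 1) * log l`,
which is unbounded as `l ↓ 0`; the `l` below makes it equal to `b`. -/
theorem legendre_eq_top {α β : ℝ} (hα : 0 < α) (hβ : 0 < β) {x : ℝ} (hx : x < 1) :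
    legendre (Set.Ioc 0 1) (lyap α β hα hβ) x = ⊤ := by
  rw [EReal.eq_top_iff_forall_lt]
  intro y
  set b := max 0 y + 1 with hb
  have hb0 : 0 ≤ b := by positivity
  have hx' : x - 1 < 0 := sub_neg.2 hx
  have hl : Real.exp (b / (x - 1)) ∈ Set.Ioc (0 : ℝ) 1 :=
    ⟨Real.exp_pos _, Real.exp_le_one_iff.2 (div_nonpos_of_nonneg_of_nonpos hb0 hx'.le)⟩
  refine lt_of_lt_of_le ?_ (le_legendre hl x)
  have h1 := lyap_le_log hα hβ hl.1 hl.2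
  rw [Real.log_exp] at h1 ⊢
  have h2 : (x - 1) * (b / (x - 1)) = b := by field_simp [hx'.ne]
  refine EReal.coe_lt_coe_iff.2 ?_
  have h3 := le_max_right 0 y
  linarith

/-- For `l` near `1` the term `-lyap l` is below `ε` by continuity and `lyap 1 = 0`. For `l < r` the
term is at most `(x - 1) * log r + C`, which is nonpositive for `x ≥ 1 + C / (-log r)`. -/
theorem exists_legendre_le {α β : ℝ} (hβ : 0 < β) (hαβ : β < α) {ε : ℝ} (hε : 0 < ε) :
    ∃ x₀ : ℝ, ∀ x ≥ x₀, legendre (Set.Ioc 0 1) (lyap α β (hβ.trans hαβ) hβ) x ≤ (ε : EReal) := by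
  have hα := hβ.trans hαβ
  set C := ∫ ω : Env, |Real.log (ω 0)| ∂(envLaw α β hα hβ) with hC
  have hC0 : 0 ≤ C := integral_nonneg fun _ => abs_nonneg _
  have hcont := continuousOn_lyap hα hβ 1 ⟨zero_lt_one, le_rfl⟩
  have hev := Metric.continuousWithinAt_iff.1 hcont ε hε
  obtain ⟨δ, hδ, hδε⟩ := hev
  rw [lyap_one hβ hαβ] at hδε
  set r := max (1 / 2) (1 - δ / 2) with hr
  have hr0 : 0 < r := lt_max_of_lt_left (by norm_num)
  have hr1 : r < 1 := max_lt (by norm_num) (by linarith)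
  have hlr := Real.log_neg hr0 hr1
  refine ⟨1 + C / (-Real.log r), fun x hx => iSup₂_le fun l hl => EReal.coe_le_coe_iff.2 ?_⟩
  have hCr : 0 ≤ C / (-Real.log r) := div_nonneg hC0 (by linarith)
  have hll := Real.log_nonpos hl.1.le hl.2
  by_cases h : r ≤ l
  · have h1 : dist l 1 < δ := by
      rw [Real.dist_eq, abs_sub_comm, abs_of_nonneg (sub_nonneg.2 hl.2)]
      have := (le_max_right (1 / 2) (1 - δ / 2)).trans h
      linarith
    have h2 := hδε hl h1
    rw [Real.dist_eq, sub_zero] at h2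
    have h3 := neg_abs_le (lyap α β hα hβ l)
    nlinarith
  · have h1 := log_sub_le_lyap hα hβ hl.1 hl.2
    have h2 : Real.log l ≤ Real.log r := Real.log_le_log hl.1 (not_le.1 h).le
    have h3 : C ≤ (x - 1) * (-Real.log r) := by
      rw [← div_le_iff₀ (by linarith)]
      linarith
    have h4 : (x - 1) * (-Real.log r) ≤ (x - 1) * (-Real.log l) := by
      have : 0 ≤ x - 1 := by linarith
      gcongr
    linarith

/-- The rate function is antitone, so its infimum over a closed `F` bounded above is its value at
`sSup F`, and `F` may be replaced by a left half-line. If `F` is unbounded above the infimum is `0`,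
and the trivial bound suffices. -/
theorem ldp_upper_bound {α β : ℝ} (hβ : 0 < β) (hαβ : β < α) {ω : Env}
    (h : ∀ i : ℕ, passGF (shift i ω) 1 = 1)
    (hω : ∀ l : ℚ, (l : ℝ) ∈ Set.Ioo (0 : ℝ) 1 → ∀ c, lyap α β (hβ.trans hαβ) hβ l < c →
      ∀ᶠ k : ℕ in atTop, ∑ i ∈ Finset.range k, Real.log (phi (shift i ω) l) ≤ k * c)
    {F : Set ℝ} (hF : IsClosed F) :
    limsup (fun k : ℕ => ENNReal.log (hitLaw ω k F) / (k : EReal)) atTop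
      ≤ -⨅ x ∈ F, legendre (Set.Ioc 0 1) (lyap α β (hβ.trans hαβ) hβ) x := by
  have hα := hβ.trans hαβ
  rcases F.eq_empty_or_nonempty with rfl | hne
  · refine limsup_le_of_le (by isBoundedDefault) ?_
    filter_upwards [eventually_gt_atTop 0] with k hk
    rw [measure_empty, ENNReal.log_zero, EReal.bot_div_of_pos_ne_top (by exact_mod_cast hk)
      (EReal.natCast_ne_top k)]
    exact bot_le
  by_cases hbdd : BddAbove F
  · set s := sSup F with hs
    have hsF : s ∈ F := hF.csSup_mem hne hbdd
    set B := limsup (fun k : ℕ => ENNReal.log (hitLaw ω k (Set.Iic s)) / (k : EReal)) atTop with hB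
    have h1 : limsup (fun k : ℕ => ENNReal.log (hitLaw ω k F) / (k : EReal)) atTop ≤ B := by
      refine limsup_le_limsup (Eventually.of_forall fun k => ?_) (by isBoundedDefault)
        (by isBoundedDefault)
      refine EReal.div_le_div_right_of_nonneg (EReal.coe_nonneg.2 (Nat.cast_nonneg k)) (ENNReal.log_le_log ?_)
      exact measure_mono fun x hx => le_csSup hbdd hx
    have h2 : legendre (Set.Ioc 0 1) (lyap α β hα hβ) s ≤ -B := by
      refine iSup₂_le fun l hl => ?_
      have hcont : ContinuousWithinAt (fun l => ((s * Real.log l - lyap α β hα hβ l : ℝ) : EReal))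
          (Set.Ioc 0 1) l :=
        continuous_coe_real_ereal.continuousAt.comp_continuousWithinAt
          (((Real.continuousAt_log hl.1.ne').continuousWithinAt.const_mul s).sub
            (continuousOn_lyap hα hβ l hl))
      -- The hypothesis covers rational parameters only, so that it excludes a single null set;
      -- continuity of `lyap` extends the bound to all `l`.
      have hdense : l ∈ closure (Set.Ioo (0 : ℝ) 1 ∩ Set.range ((↑) : ℚ → ℝ)) := by
        have h1 := closure_minimal (Dense.open_subset_closure_inter
          Rat.isDenseEmbedding_coe_real.dense (isOpen_Ioo (a := (0 : ℝ)) (b := 1))) isClosed_closure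
        rw [closure_Ioo zero_ne_one] at h1
        exact h1 ⟨hl.1.le, hl.2⟩
      have hne : (𝓝[Set.Ioo (0 : ℝ) 1 ∩ Set.range ((↑) : ℚ → ℝ)] l).NeBot :=
        mem_closure_iff_nhdsWithin_neBot.1 hdense
      have hsub : Set.Ioo (0 : ℝ) 1 ∩ Set.range ((↑) : ℚ → ℝ) ⊆ Set.Ioc 0 1 :=
        fun y hy => ⟨hy.1.1, hy.1.2.le⟩
      refine le_of_tendsto (hcont.mono hsub).tendsto ?_
      filter_upwards [self_mem_nhdsWithin] with y hy
      obtain ⟨hy1, q, rfl⟩ := hy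
      have := limsup_hitLaw_Iic_le h hy1.1 hy1.2.le (hω q hy1) s
      rw [EReal.coe_neg] at this
      exact EReal.le_neg_of_le_neg this
    exact h1.trans (EReal.le_neg_of_le_neg ((iInf₂_le s hsF).trans h2))
  · have h1 : limsup (fun k : ℕ => ENNReal.log (hitLaw ω k F) / (k : EReal)) atTop ≤ 0 := by
      refine limsup_le_of_le (by isBoundedDefault) ?_
      filter_upwards [eventually_gt_atTop 0] with k hk
      refine ereal_log_div_le hk (a := 0) ?_
      rw [hitLaw_apply ω h k hF.measurableSet]
      refine le_trans (hitSum_mono ω k (g := fun _ => 1) fun n => ?_) ?_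
      · exact Set.indicator_le_self' (fun _ _ => zero_le) _
      · simpa using hitSum_one_le ω k
    refine h1.trans ?_
    refine EReal.le_neg_of_le_neg ?_
    rw [neg_zero]
    refine EReal.le_of_forall_lt_iff_le.1 fun ε hε => ?_
    obtain ⟨x₀, hx₀⟩ := exists_legendre_le hβ hαβ (EReal.coe_pos.1 hε)
    obtain ⟨x, hx, hxx⟩ := not_bddAbove_iff.1 hbdd x₀
    exact (iInf₂_le x hx).trans (hx₀ x hxx.le)

/-! ### The truncated logarithmic moment generating function -/

/-- The mean of the passage time under the tilted law restricted to `{0, …, M}`. -/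
def tiltMean (M : ℕ) (ω : Env) (θ : ℝ) : ℝ :=
  ∑ n ∈ Finset.range (M + 1), (n : ℝ) * (passR ω n * Real.exp (θ * n) / truncS M ω θ)

theorem sum_tilt_eq_one {M : ℕ} (hM : 1 ≤ M) (ω : Env) (θ : ℝ) :
    ∑ n ∈ Finset.range (M + 1), passR ω n * Real.exp (θ * n) / truncS M ω θ = 1 := by
  rw [← Finset.sum_div]
  exact div_self (truncS_pos hM ω θ).ne'

theorem tilt_nonneg {M : ℕ} (hM : 1 ≤ M) (ω : Env) (θ : ℝ) (n : ℕ) :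
    0 ≤ passR ω n * Real.exp (θ * n) / truncS M ω θ :=
  div_nonneg (mul_nonneg (passR_nonneg ω n) (Real.exp_pos _).le) (truncS_pos hM ω θ).le

theorem abs_tiltMean_le {M : ℕ} (hM : 1 ≤ M) (ω : Env) (θ : ℝ) : |tiltMean M ω θ| ≤ M := by
  have h0 : 0 ≤ tiltMean M ω θ :=
    Finset.sum_nonneg fun n _ => mul_nonneg (Nat.cast_nonneg n) (tilt_nonneg hM ω θ n)
  rw [abs_of_nonneg h0]
  calc tiltMean M ω θ ≤ ∑ n ∈ Finset.range (M + 1),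
        (M : ℝ) * (passR ω n * Real.exp (θ * n) / truncS M ω θ) := by
        refine Finset.sum_le_sum fun n hn => mul_le_mul_of_nonneg_right ?_ (tilt_nonneg hM ω θ n)
        exact_mod_cast Nat.lt_succ_iff.1 (Finset.mem_range.1 hn)
    _ = M := by rw [← Finset.mul_sum, sum_tilt_eq_one hM, mul_one]

theorem measurable_tiltMean (M : ℕ) (θ : ℝ) : Measurable fun ω => tiltMean M ω θ :=
  Finset.measurable_sum _ fun n _ =>
    (((measurable_passR n).mul_const _).div (measurable_truncS M θ)).const_mul _

theorem tiltMean_congr {M : ℕ} {ω ω' : Env} (θ : ℝ)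
    (h : ∀ x ∈ Set.Icc (-M : ℤ) 0, ω x = ω' x) : tiltMean M ω θ = tiltMean M ω' θ :=
  Finset.sum_congr rfl fun n hn => by
    rw [passR_congr (Nat.lt_succ_iff.1 (Finset.mem_range.1 hn)) h, truncS_congr θ h]

theorem hasDerivAt_log_truncS {M : ℕ} (hM : 1 ≤ M) (ω : Env) (θ : ℝ) :
    HasDerivAt (fun θ => Real.log (truncS M ω θ)) (tiltMean M ω θ) θ := by
  have h1 : HasDerivAt (truncS M ω)
      (∑ n ∈ Finset.range (M + 1), passR ω n * (Real.exp (θ * n) * (1 * n))) θ := by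
    have h := HasDerivAt.fun_sum (u := Finset.range (M + 1))
      (A := fun (n : ℕ) (θ : ℝ) => passR ω n * Real.exp (θ * n)) (x := θ)
      fun n _ => (((hasDerivAt_id θ).mul_const (n : ℝ)).exp).const_mul (passR ω n)
    exact h
  convert h1.log (truncS_pos hM ω θ).ne' using 1
  rw [tiltMean, Finset.sum_div]
  refine Finset.sum_congr rfl fun n _ => ?_
  ring

section truncated

variable {α β : ℝ} (hα : 0 < α) (hβ : 0 < β)

/-- The truncated logarithmic moment generating function of the passage time. -/
def truncLyap (M : ℕ) (θ : ℝ) : ℝ := ∫ ω, Real.log (truncS M ω θ) ∂(envLaw α β hα hβ)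

theorem integrable_log_truncS {M : ℕ} (hM : 1 ≤ M) (θ : ℝ) :
    Integrable (fun ω => Real.log (truncS M ω θ)) (envLaw α β hα hβ) := by
  have := isProbabilityMeasure_envLaw hα hβ
  exact ((integrable_log_env hα hβ 0).abs.add (integrable_const _)).mono'
    (Real.measurable_log.comp (measurable_truncS M θ)).aestronglyMeasurable
    (Eventually.of_forall fun ω => abs_log_truncS_le hM ω θ)

theorem hasDerivAt_truncLyap {M : ℕ} (hM : 1 ≤ M) (θ : ℝ) :
    HasDerivAt (truncLyap hα hβ M) (∫ ω, tiltMean M ω θ ∂(envLaw α β hα hβ)) θ := by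
  have := isProbabilityMeasure_envLaw hα hβ
  exact (hasDerivAt_integral_of_dominated_loc_of_deriv_le (bound := fun _ => (M : ℝ))
    (F' := fun θ ω => tiltMean M ω θ) univ_mem
    (Eventually.of_forall fun θ => (integrable_log_truncS hα hβ hM θ).aestronglyMeasurable)
    (integrable_log_truncS hα hβ hM θ) (measurable_tiltMean M θ).aestronglyMeasurable
    (Eventually.of_forall fun ω θ _ => abs_tiltMean_le hM ω θ) (integrable_const _)
    (Eventually.of_forall fun ω θ _ => hasDerivAt_log_truncS hM ω θ)).2

theorem truncLyap_mono {M M' : ℕ} (hM : 1 ≤ M) (h : M ≤ M') (θ : ℝ) :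
    truncLyap hα hβ M θ ≤ truncLyap hα hβ M' θ :=
  integral_mono (integrable_log_truncS hα hβ hM θ) (integrable_log_truncS hα hβ (hM.trans h) θ)
    fun ω => Real.log_le_log (truncS_pos hM ω θ) (truncS_mono h ω θ)

/-- An immediate right jump bounds `truncLyap` below by a line of slope `1 < x`; bouncing `r` times
between `0` and `-1` gives a line of slope `2 * r + 1 > x`. Both bounds are uniform in `M ≥ 2 * r +
1`. -/
theorem exists_coercive_truncLyap {x : ℝ} (hx : 1 < x) :
    ∃ M₀ : ℕ, 1 ≤ M₀ ∧ ∃ a > 0, ∃ C : ℝ, ∀ M ≥ M₀, ∀ θ,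
      a * |θ| - C ≤ truncLyap hα hβ M θ - θ * x := by
  have := isProbabilityMeasure_envLaw hα hβ
  obtain ⟨r, hr⟩ := exists_nat_gt x
  have hi := integrable_log_env hα hβ 0
  have hi' : Integrable (fun ω : Env => (r : ℝ) * (Real.log (1 - ω 0) + Real.log (ω (-1)))
      + Real.log (ω 0)) (envLaw α β hα hβ) :=
    (((integrable_log_one_sub_env hα hβ 0).add (integrable_log_env hα hβ (-1))).const_mul
      (r : ℝ)).add hi
  set c := ∫ ω : Env, Real.log (ω 0) ∂(envLaw α β hα hβ) with hc
  set d := ∫ ω : Env, ((r : ℝ) * (Real.log (1 - ω 0) + Real.log (ω (-1)))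
    + Real.log (ω 0)) ∂(envLaw α β hα hβ) with hd
  have h1 : ∀ M : ℕ, 1 ≤ M → ∀ θ, c + θ ≤ truncLyap hα hβ M θ := fun M hM θ => by
    have : c + θ = ∫ ω : Env, (Real.log (ω 0) + θ) ∂(envLaw α β hα hβ) := by
      rw [integral_add hi (integrable_const _)]
      simp [hc]
    rw [this]
    exact integral_mono (hi.add (integrable_const _)) (integrable_log_truncS hα hβ hM θ)
      fun ω => log_env_add_le hM ω θ
  have h2 : ∀ M : ℕ, 2 * r + 1 ≤ M → ∀ θ, d + θ * (2 * r + 1) ≤ truncLyap hα hβ M θ :=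
    fun M hM θ => by
    have : d + θ * (2 * r + 1) = ∫ ω : Env, ((r : ℝ) * (Real.log (1 - ω 0) + Real.log (ω (-1)))
        + Real.log (ω 0) + θ * (2 * r + 1)) ∂(envLaw α β hα hβ) := by
      rw [integral_add hi' (integrable_const _)]
      simp [hd]
    rw [this]
    refine integral_mono (hi'.add (integrable_const _))
      (integrable_log_truncS hα hβ (by omega) θ) fun ω => ?_
    have p0 := (ω 0).2.1
    have p1 : 0 < 1 - (ω 0 : ℝ) := sub_pos.2 (ω 0).2.2
    have p2 := (ω (-1)).2.1
    have h3 : ((1 - ω 0) * ω (-1)) ^ r * ω 0 * Real.exp (θ * (2 * r + 1)) ≤ truncS M ω θ := by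
      refine le_trans ?_ (passR_mul_exp_le_truncS hM ω θ)
      push_cast
      exact mul_le_mul_of_nonneg_right (le_passR_odd ω r) (Real.exp_pos _).le
    have h4 := Real.log_le_log (by positivity) h3
    rw [Real.log_mul (by positivity) (Real.exp_pos _).ne', Real.log_exp,
      Real.log_mul (by positivity) p0.ne', Real.log_pow, Real.log_mul p1.ne' p2.ne'] at h4
    exact h4
  refine ⟨2 * r + 1, by omega, min (x - 1) (2 * r + 1 - x), ?_, max (-c) (-d), ?_⟩
  · exact lt_min (by linarith) (by linarith)
  · intro M hM θ
    have h3 := h1 M (by omega) θ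
    have h4 := h2 M hM θ
    rcases le_total θ 0 with hθ | hθ
    · rw [abs_of_nonpos hθ]
      have h5 := le_max_left (-c) (-d)
      have h6 := mul_le_mul_of_nonneg_right (min_le_left (x - 1) (2 * r + 1 - x)) (neg_nonneg.2 hθ)
      linarith
    · rw [abs_of_nonneg hθ]
      have h5 := le_max_right (-c) (-d)
      have h6 := mul_le_mul_of_nonneg_right (min_le_right (x - 1) (2 * r + 1 - x)) hθ
      linarith

theorem continuous_truncLyap {M : ℕ} (hM : 1 ≤ M) : Continuous (truncLyap hα hβ M) :=
  continuous_iff_continuousAt.2 fun θ => (hasDerivAt_truncLyap hα hβ hM θ).continuousAt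

/-- The coercive function `truncLyap M θ - θ * x` attains its minimum, where its derivative, the
tilted mean minus `x`, vanishes. -/
theorem exists_integral_tiltMean_eq {x a C : ℝ} {M : ℕ} (hM : 1 ≤ M) (ha : 0 < a)
    (h : ∀ θ, a * |θ| - C ≤ truncLyap hα hβ M θ - θ * x) :
    ∃ θ, ∫ ω, tiltMean M ω θ ∂(envLaw α β hα hβ) = x := by
  have hlim : Tendsto (fun θ => truncLyap hα hβ M θ - θ * x) (cocompact ℝ) atTop := by
    refine tendsto_atTop_mono h (tendsto_atTop_add_const_right _ _ ?_)
    exact (tendsto_norm_cocompact_atTop (E := ℝ)).const_mul_atTop ha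
  obtain ⟨θ, hθ⟩ := ((continuous_truncLyap hα hβ hM).sub
    (continuous_id.mul continuous_const)).exists_forall_le hlim
  have hd := (hasDerivAt_truncLyap hα hβ hM θ).sub ((hasDerivAt_id θ).mul_const x)
  have h0 := IsLocalMin.hasDerivAt_eq_zero (Eventually.of_forall hθ) hd
  exact ⟨θ, by linarith⟩

theorem tendsto_truncLyap {l : ℝ} (hl : 0 < l) (hl1 : l ≤ 1) :
    Tendsto (fun M => truncLyap hα hβ M (Real.log l)) atTop (𝓝 (lyap α β hα hβ l)) := by
  have := isProbabilityMeasure_envLaw hα hβ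
  refine (tendsto_add_atTop_iff_nat 1).1 ?_
  refine tendsto_integral_of_dominated_convergence
    (fun ω => |Real.log (ω 0)| + |Real.log l|)
    (fun M => (integrable_log_truncS hα hβ (by omega) _).aestronglyMeasurable)
    ((integrable_log_env hα hβ 0).abs.add (integrable_const _))
    (fun M => Eventually.of_forall fun ω => ?_) (Eventually.of_forall fun ω => ?_)
  · have h1 := log_env_add_le (M := M + 1) (by omega) ω (Real.log l)
    have h2 : Real.log (truncS (M + 1) ω (Real.log l)) ≤ 0 := by
      refine Real.log_nonpos (truncS_pos (by omega) ω _).le ?_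
      simp only [truncS, exp_log_mul_nat hl]
      exact le_trans (Finset.sum_le_sum fun n _ => mul_le_of_le_one_right (passR_nonneg ω n)
        (pow_le_one₀ hl.le hl1)) (sum_passR_le_one ω _)
    rw [Real.norm_eq_abs, abs_of_nonpos h2]
    linarith [neg_abs_le (Real.log (ω 0)), neg_abs_le (Real.log l)]
  · exact ((tendsto_add_atTop_iff_nat 1).2 (tendsto_truncS ω hl hl1)).log (phi_pos ω hl hl1).ne'

end truncated

/-! ### Infinite exponential moments, and removal of the truncation. -/

theorem passGF_le_of_truncS_le {ω : Env} {θ C : ℝ} (h : ∀ M, truncS M ω θ ≤ C) :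
    passGF ω (ENNReal.ofReal (Real.exp θ)) ≤ ENNReal.ofReal C := by
  have h1 : Tendsto (fun M => ENNReal.ofReal (truncS M ω θ)) atTop
      (𝓝 (passGF ω (ENNReal.ofReal (Real.exp θ)))) := by
    have h2 := (tendsto_add_atTop_iff_nat 1).2
      (ENNReal.tendsto_nat_tsum fun n => passP ω n * ENNReal.ofReal (Real.exp θ) ^ n)
    refine h2.congr fun M => ?_
    rw [truncS, ENNReal.ofReal_sum_of_nonneg fun n _ =>
      mul_nonneg (passR_nonneg ω n) (Real.exp_pos _).le]
    refine Finset.sum_congr rfl fun n _ => ?_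
    rw [ENNReal.ofReal_mul (passR_nonneg ω n), ofReal_passR, mul_comm θ, Real.exp_nat_mul,
      ENNReal.ofReal_pow (Real.exp_pos θ).le]
  exact le_of_tendsto' h1 fun M => ENNReal.ofReal_le_ofReal (h M)

theorem not_ae_lt_env {α β : ℝ} (hα : 0 < α) (hβ : 0 < β) {ε : ℝ} (hε : 0 < ε) (hε1 : ε < 1) :
    ¬ ∀ᵐ ω : Env ∂(envLaw α β hα hβ), ε < ω 0 := by
  intro h
  have hlaw := hasLaw_env_zero hα hβ
  have h1 : ∀ᵐ u ∂(hypLaw α β 0), ε < u := by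
    rw [← hlaw.map_eq]
    exact (ae_map_iff hlaw.aemeasurable measurableSet_Ioi).2 h
  have hm : Measurable fun u => ENNReal.ofReal (hypDensity α β 0 u) := by
    unfold hypDensity
    fun_prop
  rw [hypLaw, ae_withDensity_iff hm, ae_restrict_iff' measurableSet_Ioo] at h1
  have h2 : volume (Set.Ioo 0 ε) = 0 := by
    refine measure_mono_null (fun u hu => ?_) h1
    refine fun hu' => (hu' ⟨hu.1, hu.2.trans hε1⟩ ?_).not_gt hu.2
    have h3 := hu.1
    have h4 : 0 < 1 - u := by linarith [hu.2]
    have h5 := eulerInt_pos hα hβ (z := 0) le_rfl one_pos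
    rw [Ne, ENNReal.ofReal_eq_zero, not_le, hypDensity_eq hα hβ, mul_zero, sub_zero]
    positivity
  rw [Real.volume_Ioo, sub_zero, ENNReal.ofReal_eq_zero] at h2
  exact h2.not_gt hε

/-- As the shifted generating function is at least `1`, `passGF_eq` gives `G ≥ ℓ * ω 0 + ℓ * (1 - ω
0) * G` with `ℓ = exp θ`. A finite `G` forces `ℓ * (1 - ω 0) < 1`, which fails with positive
probability since the Beta law charges every neighbourhood of `0`. -/
theorem not_ae_passGF_lt_top {α β : ℝ} (hβ : 0 < β) (hαβ : β < α) {θ : ℝ} (hθ : 0 < θ) :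
    ¬ ∀ᵐ ω ∂(envLaw α β (hβ.trans hαβ) hβ), passGF ω (ENNReal.ofReal (Real.exp θ)) < ∞ := by
  intro h
  have hE : Real.exp (-θ) < 1 := by simpa using hθ
  have hE0 := Real.exp_pos (-θ)
  refine not_ae_lt_env (hβ.trans hαβ) hβ (ε := 1 - Real.exp (-θ)) (by linarith) (by linarith) ?_
  filter_upwards [h, ae_forall_passGF_one hβ hαβ] with ω hω h1
  set ℓ := Real.exp θ with hℓ
  have hℓ0 : 0 < ℓ := Real.exp_pos θ
  have hq : 0 ≤ 1 - (ω 0 : ℝ) := sub_nonneg.2 (ω 0).2.2.le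
  have h2 : (1 : ℝ≥0∞) ≤ passGF (shift (-1) ω) (ENNReal.ofReal ℓ) := by
    rw [← h1 (-1)]
    exact passGF_mono _ (ENNReal.one_le_ofReal.2 (Real.one_le_exp hθ.le))
  have h3 : ENNReal.ofReal (ℓ * ω 0) + ENNReal.ofReal (ℓ * (1 - ω 0)) *
      passGF ω (ENNReal.ofReal ℓ) ≤ passGF ω (ENNReal.ofReal ℓ) := by
    conv_rhs => rw [passGF_eq]
    rw [ENNReal.ofReal_mul hℓ0.le, ENNReal.ofReal_mul hℓ0.le]
    refine add_le_add le_rfl (mul_le_mul_left ?_ _)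
    exact le_mul_of_one_le_right zero_le h2
  rw [← ENNReal.ofReal_toReal hω.ne, ← ENNReal.ofReal_mul (mul_nonneg hℓ0.le hq),
    ← ENNReal.ofReal_add (mul_nonneg hℓ0.le (ω 0).2.1.le)
      (mul_nonneg (mul_nonneg hℓ0.le hq) ENNReal.toReal_nonneg),
    ENNReal.ofReal_le_ofReal_iff ENNReal.toReal_nonneg] at h3
  by_contra hc
  have h4 : 1 ≤ ℓ * (1 - ω 0) := by
    have : ℓ * Real.exp (-θ) = 1 := by rw [hℓ, ← Real.exp_add, add_neg_cancel, Real.exp_zero]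
    nlinarith
  have h5 := mul_le_mul_of_nonneg_right h4
    (ENNReal.toReal_nonneg (a := passGF ω (ENNReal.ofReal ℓ)))
  have h6 := mul_pos hℓ0 (ω 0).2.1
  linarith

/-- Otherwise the sublevel sets at height `b`, which are compact and decrease in `M`, have a common
point `θ`. If `θ ≤ 0`, letting `M → ∞` contradicts `b < -I x`. If `θ > 0`, the truncated exponents
are bounded, and monotone convergence makes `passGF ω (exp θ)` almost surely finite, which is
impossible. -/
theorem exists_lt_truncLyap {α β : ℝ} (hβ : 0 < β) (hαβ : β < α) {x a C b : ℝ} {M₀ : ℕ}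
    (hM₀ : 1 ≤ M₀) (ha : 0 < a)
    (h : ∀ M ≥ M₀, ∀ θ, a * |θ| - C ≤ truncLyap (hβ.trans hαβ) hβ M θ - θ * x)
    (hb : (b : EReal) < -legendre (Set.Ioc 0 1) (lyap α β (hβ.trans hαβ) hβ) x) :
    ∃ M ≥ M₀, ∀ θ, b < truncLyap (hβ.trans hαβ) hβ M θ - θ * x := by
  have hα := hβ.trans hαβ
  by_contra! hcon
  have hmono : ∀ {i j : ℕ}, i ≤ j → ∀ θ,
      truncLyap hα hβ (M₀ + i) θ ≤ truncLyap hα hβ (M₀ + j) θ := fun hij θ =>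
    truncLyap_mono hα hβ (by omega) (by omega) θ
  set K : ℕ → Set ℝ := fun i => {θ | truncLyap hα hβ (M₀ + i) θ - θ * x ≤ b} with hK
  have hKc : ∀ i, IsClosed (K i) := fun i => isClosed_le
    ((continuous_truncLyap hα hβ (by omega)).sub (continuous_id.mul continuous_const))
    continuous_const
  have hK0 : IsCompact (K 0) := by
    refine (isCompact_closedBall (0 : ℝ) ((b + C) / a)).of_isClosed_subset (hKc 0) fun θ hθ => ?_
    have h1 := (h (M₀ + 0) (by omega) θ).trans hθ
    rw [mem_closedBall_zero_iff, Real.norm_eq_abs, le_div_iff₀ ha]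
    linarith
  obtain ⟨θ, hθ⟩ := IsCompact.nonempty_iInter_of_sequence_nonempty_isCompact_isClosed K
    (fun i θ hθ => (sub_le_sub_right (hmono (Nat.le_succ i) θ) _).trans hθ)
    (fun i => hcon (M₀ + i) (by omega)) hK0 hKc
  have hθ' : ∀ i, truncLyap hα hβ (M₀ + i) θ - θ * x ≤ b := fun i => Set.mem_iInter.1 hθ i
  rcases le_or_gt θ 0 with hθ0 | hθ0
  · have h1 : Tendsto (fun i => truncLyap hα hβ (M₀ + i) θ) atTop
        (𝓝 (lyap α β hα hβ (Real.exp θ))) := by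
      have h2 := tendsto_truncLyap hα hβ (Real.exp_pos θ) (Real.exp_le_one_iff.2 hθ0)
      rw [Real.log_exp] at h2
      exact h2.comp (tendsto_atTop_mono (fun i => Nat.le_add_left i M₀) tendsto_id)
    have h2 : lyap α β hα hβ (Real.exp θ) - θ * x ≤ b :=
      le_of_tendsto' (h1.sub_const _) hθ'
    have h3 := le_legendre (D := Set.Ioc 0 1) (g := lyap α β hα hβ)
      ⟨Real.exp_pos θ, Real.exp_le_one_iff.2 hθ0⟩ x
    rw [Real.log_exp] at h3
    have h4 := h3.trans_lt (EReal.lt_neg_comm.1 hb)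
    rw [← EReal.coe_neg, EReal.coe_lt_coe_iff] at h4
    linarith
  · have hi := integrable_log_env hα hβ 0
    have := isProbabilityMeasure_envLaw hα hβ
    -- Subtracting the common lower bound makes the increasing sequence nonnegative, as monotone
    -- convergence for `lintegral` requires.
    set f : ℕ → Env → ℝ := fun i ω =>
      Real.log (truncS (M₀ + i) ω θ) - (Real.log (ω 0) + θ) with hf
    have hf0 : ∀ i ω, 0 ≤ f i ω := fun i ω => sub_nonneg.2 (log_env_add_le (by omega) ω θ)
    have hfi : ∀ i, Integrable (f i) (envLaw α β hα hβ) := fun i =>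
      (integrable_log_truncS hα hβ (by omega) θ).sub (hi.add (integrable_const θ))
    have hfm : ∀ i, Measurable fun ω => ENNReal.ofReal (f i ω) := fun i =>
      ((Real.measurable_log.comp (measurable_truncS _ θ)).sub
        ((Real.measurable_log.comp (measurable_subtype_coe.comp
          (measurable_pi_apply (0 : ℤ) : Measurable fun ω : Env => ω 0))).add_const
          θ)).ennreal_ofReal
    have hfmono : Monotone fun i ω => ENNReal.ofReal (f i ω) := fun i j hij ω =>
      ENNReal.ofReal_le_ofReal (sub_le_sub_right (Real.log_le_log (truncS_pos (by omega) ω θ)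
        (truncS_mono (by omega) ω θ)) _)
    set B := b + θ * x - ∫ ω : Env, (Real.log (ω 0) + θ) ∂(envLaw α β hα hβ) with hB
    have hbd : ∫⁻ ω, ⨆ i, ENNReal.ofReal (f i ω) ∂(envLaw α β hα hβ) ≤ ENNReal.ofReal B := by
      rw [lintegral_iSup hfm hfmono]
      refine iSup_le fun i => ?_
      rw [← ofReal_integral_eq_lintegral_ofReal (hfi i) (Eventually.of_forall (hf0 i))]
      refine ENNReal.ofReal_le_ofReal ?_
      have h1 : ∫ ω, f i ω ∂(envLaw α β hα hβ) = truncLyap hα hβ (M₀ + i) θ -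
          ∫ ω : Env, (Real.log (ω 0) + θ) ∂(envLaw α β hα hβ) :=
        integral_sub (integrable_log_truncS hα hβ (by omega) θ) (hi.add (integrable_const θ))
      linarith [hθ' i]
    refine not_ae_passGF_lt_top hβ hαβ hθ0 ?_
    filter_upwards [ae_lt_top (Measurable.iSup hfm) (hbd.trans_lt ENNReal.ofReal_lt_top).ne]
      with ω hω
    set s := (⨆ i, ENNReal.ofReal (f i ω)).toReal with hs
    refine (passGF_le_of_truncS_le (C := Real.exp (s + (Real.log (ω 0) + θ)))
      fun M => ?_).trans_lt ENNReal.ofReal_lt_top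
    refine (truncS_mono (Nat.le_add_left M M₀) ω θ).trans ?_
    rw [← Real.log_le_iff_le_exp (truncS_pos (by omega) ω θ), ← sub_le_iff_le_add]
    rw [hs, ← ENNReal.ofReal_le_iff_le_toReal hω.ne]
    exact le_iSup (fun i => ENNReal.ofReal (f i ω)) M

/-! ### The large deviation lower bound -/

/-- Under the tilted law the sum lies within `k * δ` of `k * x` with probability at least `1 / 2`,
and on that event undoing the tilt costs at most a factor `exp (-k * (θ * x + |θ| * δ))`. -/
theorem eventually_le_hitLaw_Ioo {ω : Env} (h : ∀ i : ℕ, passGF (shift i ω) 1 = 1) {M : ℕ}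
    (hM : 1 ≤ M) {θ x Λ δ b : ℝ} (hδ : 0 < δ)
    (h1 : Tendsto (fun k : ℕ => (∑ i ∈ Finset.range k, Real.log (truncS M (shift i ω) θ)) / k)
      atTop (𝓝 Λ))
    (h2 : Tendsto (fun k : ℕ => (∑ i ∈ Finset.range k, tiltMean M (shift i ω) θ) / k)
      atTop (𝓝 x)) (hb : b < Λ - θ * x - |θ| * δ) :
    ∀ᶠ k : ℕ in atTop,
      ENNReal.ofReal (Real.exp (k * b)) ≤ hitLaw ω k (Set.Ioo (x - δ) (x + δ)) := by
  have h3 : Tendsto (fun k : ℕ => (∑ i ∈ Finset.range k, Real.log (truncS M (shift i ω) θ)) / k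
      - (θ * x + |θ| * δ) + Real.log (1 / 2) / k) atTop (𝓝 (Λ - (θ * x + |θ| * δ) + 0)) :=
    (h1.sub_const _).add (tendsto_const_div_atTop_nhds_zero_nat _)
  have h4 : Tendsto (fun k : ℕ => ((M : ℝ) ^ 2 / k +
      ((∑ i ∈ Finset.range k, tiltMean M (shift i ω) θ) / k - x) ^ 2) / δ ^ 2) atTop
      (𝓝 ((0 + (x - x) ^ 2) / δ ^ 2)) :=
    ((tendsto_const_div_atTop_nhds_zero_nat _).add ((h2.sub_const x).pow 2)).div_const _
  have h5 : (0 + (x - x) ^ 2) / δ ^ 2 < 1 / 2 := by norm_num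
  filter_upwards [h3.eventually_const_lt (show b < _ by linarith),
    h4.eventually_lt_const h5, eventually_gt_atTop 0] with k hk3 hk4 hk0
  have hk : (0 : ℝ) < k := by exact_mod_cast hk0
  set S := ∑ i ∈ Finset.range k, Real.log (truncS M (shift i ω) θ) with hS
  set T := ∑ i ∈ Finset.range k, tiltMean M (shift i ω) θ with hT
  set g : ℕ → ℝ := {n : ℕ | |(n : ℝ) - k * x| < k * δ}.indicator 1 with hg
  have hg0 : ∀ n, 0 ≤ g n := fun n => Set.indicator_nonneg (fun _ _ => zero_le_one) n
  have hsub : (hitSum ω k fun n => ENNReal.ofReal (g n))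
      ≤ hitLaw ω k (Set.Ioo (x - δ) (x + δ)) := by
    rw [hitLaw_apply ω h k measurableSet_Ioo]
    refine hitSum_mono ω k fun n => ?_
    by_cases hn : |(n : ℝ) - k * x| < k * δ
    · have hn' : (n : ℝ) / k ∈ Set.Ioo (x - δ) (x + δ) := by
        rw [abs_lt] at hn
        refine ⟨(lt_div_iff₀ hk).2 ?_, (div_lt_iff₀ hk).2 ?_⟩ <;> linarith
      rw [Set.indicator_of_mem hn']
      simp [hg, hn]
    · simp [hg, hn]
  refine le_trans ?_ hsub
  refine le_trans ?_ (le_hitSum hM ω θ k hg0)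
  refine ENNReal.ofReal_le_ofReal ?_
  set w : ℕ → ℕ → ℝ := fun i n =>
    passR (shift i ω) n * Real.exp (θ * n) / truncS M (shift i ω) θ with hw
  have hw0 : ∀ i m, 0 ≤ w i m := fun i m => tilt_nonneg hM _ θ m
  have hprod : ∏ i ∈ Finset.range k, truncS M (shift i ω) θ = Real.exp S := by
    rw [hS, Real.exp_sum]
    exact Finset.prod_congr rfl fun i _ => (Real.exp_log (truncS_pos hM _ θ)).symm
  have hhalf : 1 / 2 ≤ sumE M w k g := by
    refine le_trans ?_ (le_sumE_indicator hw0 (fun i => sum_tilt_eq_one hM _ θ) k (k * x)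
      (mul_pos hk hδ))
    have h6 : (k * (M : ℝ) ^ 2 + (T - k * x) ^ 2) / (k * δ) ^ 2
        = ((M : ℝ) ^ 2 / k + (T / k - x) ^ 2) / δ ^ 2 := by
      field_simp
    change 1 / 2 ≤ 1 - (k * (M : ℝ) ^ 2 + (T - k * x) ^ 2) / (k * δ) ^ 2
    rw [h6]
    linarith
  have hlow : Real.exp (-(k * (θ * x + |θ| * δ))) * (1 / 2)
      ≤ sumE M w k fun n => g n * Real.exp (-(θ * n)) := by
    refine (mul_le_mul_of_nonneg_left hhalf (Real.exp_pos _).le).trans ?_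
    rw [← sumE_const_mul]
    refine sumE_mono hw0 k fun n => ?_
    by_cases hn : |(n : ℝ) - k * x| < k * δ
    · rw [mul_comm]
      refine mul_le_mul_of_nonneg_left (Real.exp_le_exp.2 ?_) (hg0 n)
      have h7 : θ * (n - k * x) ≤ |θ| * (k * δ) := (le_abs_self _).trans (by
        rw [abs_mul]
        exact mul_le_mul_of_nonneg_left hn.le (abs_nonneg θ))
      linarith
    · simp [hg, hn]
  rw [hprod]
  refine le_trans ?_ (mul_le_mul_of_nonneg_left hlow (Real.exp_pos S).le)
  rw [← mul_assoc, ← Real.exp_add, ← Real.exp_log (one_half_pos (α := ℝ)), ← Real.exp_add]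
  refine Real.exp_le_exp.2 ?_
  have h8 := mul_le_mul_of_nonneg_left hk3.le hk.le
  have h9 : k * (S / k - (θ * x + |θ| * δ) + Real.log (1 / 2) / k)
      = S + -(k * (θ * x + |θ| * δ)) + Real.log (1 / 2) := by
    field_simp
    ring
  linarith

theorem ae_le_liminf_hitLaw_Ioo {α β : ℝ} (hβ : 0 < β) (hαβ : β < α) {x : ℝ} (hx : 1 < x) :
    ∀ᵐ ω ∂(envLaw α β (hβ.trans hαβ) hβ), ∀ δ > 0,
      -legendre (Set.Ioc 0 1) (lyap α β (hβ.trans hαβ) hβ) x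
        ≤ liminf (fun k : ℕ => ENNReal.log (hitLaw ω k (Set.Ioo (x - δ) (x + δ))) / (k : EReal))
          atTop := by
  have hα := hβ.trans hαβ
  have := isProbabilityMeasure_envLaw hα hβ
  obtain ⟨M₀, hM₀, a, ha, C, hC⟩ := exists_coercive_truncLyap hα hβ hx
  have hex : ∀ i : ℕ, ∃ θ, ∫ ω, tiltMean (M₀ + i) ω θ ∂(envLaw α β hα hβ) = x := fun i =>
    exists_integral_tiltMean_eq hα hβ (by omega) ha (hC (M₀ + i) (by omega))
  choose θ hθ using hex
  have hl1 : ∀ᵐ ω ∂(envLaw α β hα hβ), ∀ i : ℕ, Tendsto (fun k : ℕ =>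
      (∑ j ∈ Finset.range k, Real.log (truncS (M₀ + i) (shift j ω) (θ i))) / k) atTop
      (𝓝 (truncLyap hα hβ (M₀ + i) (θ i))) := by
    refine ae_all_iff.2 fun i => ae_tendsto_average_shift hα hβ (N := M₀ + i)
      (g := fun ω => Real.log (truncS (M₀ + i) ω (θ i)))
      (Real.measurable_log.comp (measurable_truncS _ _)) (fun ω ω' h => ?_)
      (integrable_log_truncS hα hβ (by omega) _)
    exact congrArg Real.log (truncS_congr _ h)
  have hl2 : ∀ᵐ ω ∂(envLaw α β hα hβ), ∀ i : ℕ, Tendsto (fun k : ℕ =>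
      (∑ j ∈ Finset.range k, tiltMean (M₀ + i) (shift j ω) (θ i)) / k) atTop (𝓝 x) := by
    refine ae_all_iff.2 fun i => ?_
    have := ae_tendsto_average_shift hα hβ (N := M₀ + i)
      (g := fun ω => tiltMean (M₀ + i) ω (θ i))
      (measurable_tiltMean _ _) (fun ω ω' h => tiltMean_congr _ h)
      ((integrable_const ((M₀ + i : ℕ) : ℝ)).mono' (measurable_tiltMean _ _).aestronglyMeasurable
        (Eventually.of_forall fun ω => abs_tiltMean_le (by omega) ω _))
    rwa [hθ i] at this
  filter_upwards [hl1, hl2, ae_forall_passGF_one hβ hαβ] with ω h1 h2 h3 δ hδ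
  refine EReal.ge_of_forall_gt_iff_ge.1 fun b hb => ?_
  obtain ⟨M, hM, hMb⟩ := exists_lt_truncLyap hβ hαβ hM₀ ha hC hb
  obtain ⟨i, rfl⟩ := Nat.exists_eq_add_of_le hM
  have hg := hMb (θ i)
  -- The window shrinks until its tilting cost `|θ i| * δ'` fits into the gap above `b`; the added
  -- `1` keeps the denominator positive when `θ i = 0`.
  set δ' := min δ ((truncLyap hα hβ (M₀ + i) (θ i) - θ i * x - b) / (2 * (|θ i| + 1))) with hδ'
  have hpos : 0 < 2 * (|θ i| + 1) := by positivity
  have hδ0 : 0 < δ' := lt_min hδ (div_pos (by linarith) hpos)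
  have hδ1 : |θ i| * δ' < truncLyap hα hβ (M₀ + i) (θ i) - θ i * x - b := by
    have h4 := (le_div_iff₀ hpos).1 (min_le_right δ
      ((truncLyap hα hβ (M₀ + i) (θ i) - θ i * x - b) / (2 * (|θ i| + 1))))
    rw [← hδ'] at h4
    have h5 := mul_nonneg (abs_nonneg (θ i)) hδ0.le
    linarith
  refine le_liminf_of_le (by isBoundedDefault) ?_
  filter_upwards [eventually_le_hitLaw_Ioo (b := b) (fun j => h3 j) (by omega) hδ0 (h1 i) (h2 i)
    (by linarith), eventually_gt_atTop 0] with k hk hk0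
  have h6 : δ' ≤ δ := min_le_left _ _
  refine le_ereal_log_div hk0 (hk.trans (measure_mono ?_))
  exact Set.Ioo_subset_Ioo (by linarith) (by linarith)

/-- Points below `1` have infinite rate. Any other `x ∈ G` is replaced by a rational `q > x` in `G`,
at no cost because the rate function is antitone; then `q > 1`, and only countably many null sets
are involved. -/
theorem ldp_lower_bound {α β : ℝ} (hβ : 0 < β) (hαβ : β < α) {ω : Env}
    (hω : ∀ q : ℚ, (1 : ℝ) < q → ∀ δ > 0,
      -legendre (Set.Ioc 0 1) (lyap α β (hβ.trans hαβ) hβ) q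
        ≤ liminf (fun k : ℕ => ENNReal.log (hitLaw ω k (Set.Ioo (q - δ) (q + δ))) / (k : EReal))
          atTop) {G : Set ℝ} (hG : IsOpen G) :
    -⨅ x ∈ G, legendre (Set.Ioc 0 1) (lyap α β (hβ.trans hαβ) hβ) x
      ≤ liminf (fun k : ℕ => ENNReal.log (hitLaw ω k G) / (k : EReal)) atTop := by
  refine EReal.neg_le_of_neg_le (le_iInf₂ fun x hx => ?_)
  rcases lt_or_ge x 1 with hx1 | hx1
  · rw [legendre_eq_top _ _ hx1]
    exact le_top
  refine EReal.neg_le_of_neg_le ?_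
  obtain ⟨ε, hε, hεG⟩ := Metric.isOpen_iff.1 hG x hx
  obtain ⟨q, hq1, hq2⟩ := exists_rat_btwn (show x < x + ε by linarith)
  have h1 := hω q (hx1.trans_lt hq1) (min (q - x) (x + ε - q))
    (lt_min (by linarith) (by linarith))
  refine (EReal.neg_le_neg_iff.2 (legendre_antitone _ hq1.le)).trans (h1.trans ?_)
  refine liminf_le_liminf (Eventually.of_forall fun k => ?_) (by isBoundedDefault)
    (by isBoundedDefault)
  refine EReal.div_le_div_right_of_nonneg (EReal.coe_nonneg.2 (Nat.cast_nonneg k))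
    (ENNReal.log_le_log (measure_mono fun y hy => hεG ?_))
  rw [Metric.mem_ball, Real.dist_eq, abs_lt]
  have h2 := min_le_left ((q : ℝ) - x) (x + ε - q)
  have h3 := min_le_right ((q : ℝ) - x) (x + ε - q)
  constructor <;> linarith [hy.1, hy.2]

end BetaWalk

end

theorem mainTheorem1 (α β : ℝ) (hβ : 0 < β) (hαβ : β < α) :
    -- the law of `Z` for `0 < l < 1`
    (∀ l ∈ Set.Ioo (0 : ℝ) 1,
      HasLaw (BetaWalk.Z l) (BetaWalk.hypLaw α β (l ^ 2))
        (BetaWalk.envLaw α β (hβ.trans hαβ) hβ)) ∧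
    -- the endpoint `l = 0`, where `Z` is the limit of `φ(ω, l) / l`
    (∃ Z₀ : BetaWalk.Env → ℝ,
      (∀ ω, Tendsto (fun l => BetaWalk.Z l ω) (𝓝[>] 0) (𝓝 (Z₀ ω))) ∧
      HasLaw Z₀ (BetaWalk.hypLaw α β 0) (BetaWalk.envLaw α β (hβ.trans hαβ) hβ)) ∧
    -- the endpoint `l = 1`, where the hypergeometric law is the weak limit as `z ↑ 1`, i.e. `δ₁`
    (HasLaw (BetaWalk.Z 1) (Measure.dirac 1) (BetaWalk.envLaw α β (hβ.trans hαβ) hβ) ∧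
      ∀ f : BoundedContinuousFunction ℝ ℝ,
        Tendsto (fun z => ∫ u, f u ∂(BetaWalk.hypLaw α β z)) (𝓝[<] 1)
          (𝓝 (∫ u, f u ∂(Measure.dirac (1 : ℝ))))) ∧
    -- the expectation of `log φ(ω, l)` is an explicit integral
    (∀ l ∈ Set.Ioo (0 : ℝ) 1,
      Integrable (fun ω => Real.log (BetaWalk.phi ω l))
        (BetaWalk.envLaw α β (hβ.trans hαβ) hβ) ∧
      IntervalIntegrable (fun u => Real.log u * BetaWalk.hypDensity α β (l ^ 2) u) volume 0 1 ∧
      ∫ ω, Real.log (BetaWalk.phi ω l) ∂(BetaWalk.envLaw α β (hβ.trans hαβ) hβ) =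
        Real.log l + ∫ u in (0 : ℝ)..1, Real.log u * BetaWalk.hypDensity α β (l ^ 2) u) ∧
    -- the hitting times are almost surely finite
    (∀ᵐ ω ∂(BetaWalk.envLaw α β (hβ.trans hαβ) hβ),
      ∀ᵐ X ∂(BetaWalk.quenched 0 ω), ∀ k : ℕ, BetaWalk.hit k X ≠ ⊤) ∧
    -- the large deviation principle for `H_k / k`
    (∀ᵐ ω ∂(BetaWalk.envLaw α β (hβ.trans hαβ) hβ),
      BetaWalk.LargeDeviationPrinciple (BetaWalk.hitLaw ω)
        (BetaWalk.legendre (Set.Ioc 0 1)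
          (fun l => ∫ ω', Real.log (BetaWalk.phi ω' l)
            ∂(BetaWalk.envLaw α β (hβ.trans hαβ) hβ)))) ∧
    -- its rate function is the Legendre transform of the explicit integral
    (∀ x : ℝ,
      BetaWalk.legendre (Set.Ioc 0 1)
          (fun l => ∫ ω, Real.log (BetaWalk.phi ω l)
            ∂(BetaWalk.envLaw α β (hβ.trans hαβ) hβ)) x =
        BetaWalk.legendre (Set.Ioo 0 1)
          (fun l => Real.log l +
            ∫ u in (0 : ℝ)..1, Real.log u * BetaWalk.hypDensity α β (l ^ 2) u) x) := by
  have hα := hβ.trans hαβ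
  have hprob := BetaWalk.isProbabilityMeasure_envLaw hα hβ
  have hreg := BetaWalk.ae_forall_passGF_one hβ hαβ
  refine ⟨fun l hl => BetaWalk.hasLaw_Z hα hβ hl.1 hl.2,
    ⟨fun ω => ω 0, BetaWalk.tendsto_Z_zero, BetaWalk.hasLaw_env_zero hα hβ⟩, ⟨?_, fun f => ?_⟩,
    fun l hl => ⟨BetaWalk.integrable_log_phi hα hβ hl.1 hl.2.le, ?_,
      BetaWalk.lyap_eq_hypDensity hα hβ hl.1 hl.2⟩, ?_, ?_, BetaWalk.legendre_lyap_eq hα hβ⟩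
  · refine hasLaw_dirac_of_ae_eq ?_
    filter_upwards [BetaWalk.ae_phi_one hβ hαβ] with ω hω
    simp [BetaWalk.Z, hω]
  · rw [integral_dirac]
    exact BetaWalk.tendsto_hypLaw hβ hαβ f
  · rw [intervalIntegrable_iff_integrableOn_Ioo_of_le zero_le_one]
    exact (BetaWalk.integrable_log_hypDensity hα hβ hl.1 hl.2).1
  · filter_upwards [hreg] with ω hω
    exact BetaWalk.ae_hit_ne_top ω fun i => hω i
  · have hup : ∀ᵐ ω ∂(BetaWalk.envLaw α β hα hβ), ∀ l : ℚ, (l : ℝ) ∈ Set.Ioo (0 : ℝ) 1 →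
        ∀ c, BetaWalk.lyap α β hα hβ l < c → ∀ᶠ k : ℕ in atTop,
          ∑ i ∈ Finset.range k, Real.log (BetaWalk.phi (BetaWalk.shift i ω) l) ≤ k * c :=
      ae_all_iff.2 fun l => eventually_imp_distrib_left.2 fun hl => BetaWalk.ae_sum_log_phi_le hα hβ hl.1 hl.2
    have hlow := ae_all_iff.2 fun q : ℚ => eventually_imp_distrib_left.2
      fun hq : (1 : ℝ) < q => BetaWalk.ae_le_liminf_hitLaw_Ioo hβ hαβ hq
    filter_upwards [hreg, hup, hlow] with ω h1 h2 h3
    exact ⟨BetaWalk.legendre_nonneg hβ hαβ, BetaWalk.lowerSemicontinuous_legendre _ _,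
      fun F hF => BetaWalk.ldp_upper_bound hβ hαβ (fun i => h1 i) h2 hF,
      fun G hG => BetaWalk.ldp_lower_bound hβ hαβ h3 hG⟩
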